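/- Let $d,m\ge 1$. Let ${\bm a}\in L^2_{\rm loc}(\mathbb R^d;\mathbb R^d)$ and let $V:\mathbb R^d\to\mathbb R^{m\times m}$ have entries in $L^1_{\rm loc}(\mathbb R^d)$ and, for almost every $x$, be symmetric with smallest eigenvalue $\lambda_V(x)\ge 0$. Put $\nabla_{\bm a}=\nabla-i{\bm a}$ (in the sense of distributions), and let ${\bm A}$ be the nonnegative self-adjoint operator on $L^2(\mathbb R^d;\mathbb C^m)$ associated with the closed form $$\mathfrak a({\bm u},{\bm v})=\sum_{i=1}^m\int_{\mathbb R^d}\langle\nabla_{\bm a}u_i,\nabla_{\bm a}v_i\rangle\,dx+\int_{\mathbb R^d}\langle V{\bm u},{\bm v}\rangle\,dx$$ with domain $D(\mathfrak a)=\{{\bm u}\in L^2(\mathbb R^d;\mathbb C^m):\nabla_{\bm a}u_i\in L^2(\mathbb R^d;\mathbb C^d)\ (1\le i\le m),\ V^{1/2}{\bm u}\in L^2(\mathbb R^d;\mathbb C^m)\}$. Let ${\bm L}$ be the operator obtained in the same way with $V=0$. Let ${\bm A}^{1/2}$, ${\bm L}^{1/2}$ be the nonnegative self-adjoint square roots and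 ${\bm A}^{-1/2}$ the inverse of ${\bm A}^{1/2}$, defined on the range of ${\bm A}^{1/2}$. Assume that there is a constant $\kappa\ge1$ such that the smallest and largest eigenvalues $\lambda_V(x),\Lambda_V(x)$ of $V(x)$ satisfy $\lambda_V(x)\le\Lambda_V(x)\le\kappa\lambda_V(x)$ for almost every $x\in\mathbb R^d$. Assume further that ${\bm a}\in L^q_{\rm loc}(\mathbb R^d;\mathbb R^d)$ for some $q\in(2,\infty)$ and that the distributional divergence $\operatorname{div}{\bm a}$ belongs to $L^s_{\rm loc}(\mathbb R^d)$ for some $s\in(1,\infty)$. Then the operator ${\bm L}^{1/2}{\bm A}^{-1/2}$ has a unique extension to a bounded operator on $L^2(\mathbb R^d;\mathbb C^m)$, denoted by the same symbol, and there is a unique bounded operator on $L^1(\mathbb R^d;\mathbb C^m)$ that coincides with this extension on $L^1(\mathbb R^d;\mathbb C^m)\cap L^2(\mathbb R^d;\mathbb C^m)$. Denoting it again by ${\bm L}^{1/2}{\bm A}^{-1/2}$, one has $$\|{\bm L}^{1/2}{\bm A}^{-1/2}{\bm f}\|_1\le(1+\kappa)\|{\bm f}\|_1,\qquad {\bm f}\in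 L^1(\mathbb R^d;\mathbb C^m).$$ -/

import Mathlib

open MeasureTheory
open scoped ContDiff

noncomputable section

namespace MagneticSchrodinger

/-! ### Function spaces -/

/-- The Euclidean space `ℝ^d`. -/
abbrev RSpace (d : ℕ) : Type := EuclideanSpace ℝ (Fin d)

/-- The Hermitian space `ℂ^m`. -/
abbrev CSpace (m : ℕ) : Type := EuclideanSpace ℂ (Fin m)

/-- `L²(ℝ^d; ℂ^m)`. -/
abbrev LTwo (d m : ℕ) : Type := Lp (CSpace m) 2 (volume : Measure (RSpace d))

/-- `L¹(ℝ^d; ℂ^m)`. -/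
abbrev LOne (d m : ℕ) : Type := Lp (CSpace m) 1 (volume : Measure (RSpace d))

/-- `f ∈ L^p_loc`: `f` belongs to `L^p(Ω)` for every bounded measurable set `Ω`. -/
def MemLpLoc {d : ℕ} {F : Type*} [NormedAddCommGroup F] (f : RSpace d → F) (p : ENNReal) : Prop :=
  ∀ s : Set (RSpace d), Bornology.IsBounded s → MeasurableSet s → MemLp f p (volume.restrict s)

/-- The partial derivative `∂_k φ` of a (smooth) function. -/
def partialDeriv {d : ℕ} (k : Fin d) (φ : RSpace d → ℝ) (x : RSpace d) : ℝ :=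
  fderiv ℝ φ x (EuclideanSpace.single k 1)

/-- Real-valued functions in `C_c^∞(ℝ^d)`. -/
def IsTest {d : ℕ} (φ : RSpace d → ℝ) : Prop :=
  ContDiff ℝ ∞ φ ∧ HasCompactSupport φ

/-- `div a = h` in the sense of distributions. -/
def IsWeakDiv {d : ℕ} (a : RSpace d → RSpace d) (h : RSpace d → ℝ) : Prop :=
  ∀ φ : RSpace d → ℝ, IsTest φ →
    ∫ x, φ x * h x = - ∫ x, ∑ k, a x k * partialDeriv k φ x

/-- `∇u - i a u = g` in the sense of distributions, for a scalar function `u`. -/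
def IsWeakMagGrad {d : ℕ} (a : RSpace d → RSpace d) (u : RSpace d → ℂ)
    (g : RSpace d → CSpace d) : Prop :=
  ∀ (k : Fin d) (φ : RSpace d → ℝ), IsTest φ →
    ∫ x, φ x • g x k
      = - (∫ x, partialDeriv k φ x • u x) - Complex.I * ∫ x, φ x • (a x k • u x)

/-- The distribution `∇_a u = ∇u - i a u` is (represented by) a function in `L²(ℝ^d; ℂ^d)`. -/
def HasMagGrad {d : ℕ} (a : RSpace d → RSpace d) (u : RSpace d → ℂ) : Prop :=
  ∃ g : RSpace d → CSpace d, MemLp g 2 volume ∧ IsWeakMagGrad a u g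

open Classical in
/-- The magnetic gradient `∇_a u`, a function in `L²` that is unique up to null sets; the value is
meaningful when `HasMagGrad a u` holds. -/
def magGrad {d : ℕ} (a : RSpace d → RSpace d) (u : RSpace d → ℂ) : RSpace d → CSpace d :=
  if h : HasMagGrad a u then h.choose else 0

/-! ### The potentials -/

/-- The smallest eigenvalue of a symmetric real matrix. -/
def minEigenvalue {m : ℕ} (M : Matrix (Fin m) (Fin m) ℝ) : ℝ := sInf (spectrum ℝ M)

/-- The largest eigenvalue of a symmetric real matrix. -/
def maxEigenvalue {m : ℕ} (M : Matrix (Fin m) (Fin m) ℝ) : ℝ := sSup (spectrum ℝ M)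

/-- The action of a real matrix on `ℂ^m`. -/
def complexify {m : ℕ} (M : Matrix (Fin m) (Fin m) ℝ) : Matrix (Fin m) (Fin m) ℂ :=
  M.map (fun r : ℝ => (r : ℂ))

open scoped MatrixOrder in
/-- The nonnegative square root of a nonnegative symmetric matrix, acting on `ℂ^m`. -/
def matrixSqrt {m : ℕ} (M : Matrix (Fin m) (Fin m) ℝ) : Matrix (Fin m) (Fin m) ℂ :=
  CFC.sqrt (complexify M)

/-- Matrix-vector multiplication on `ℂ^m`. -/
def act {m : ℕ} (M : Matrix (Fin m) (Fin m) ℂ) (v : CSpace m) : CSpace m :=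
  WithLp.toLp 2 (M.mulVec (WithLp.ofLp v))

/-- The data of a vector-valued magnetic Schrödinger operator: a magnetic potential
`a ∈ L²_loc(ℝ^d; ℝ^d)` and an electric potential `V` with values in the symmetric nonnegative
`m × m` matrices and entries in `L¹_loc(ℝ^d)`. -/
structure Potentials (d m : ℕ) where
  /-- the magnetic potential -/
  a : RSpace d → RSpace d
  /-- the electric potential -/
  V : RSpace d → Matrix (Fin m) (Fin m) ℝ
  a_loc : MemLpLoc a 2
  V_loc : ∀ i j, MemLpLoc (fun x => V x i j) 1
  V_symm : ∀ᵐ x, (V x).IsSymm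
  V_nonneg : ∀ᵐ x, 0 ≤ minEigenvalue (V x)

/-- The same magnetic potential with `V = 0`. -/
def Potentials.magnetic {d m : ℕ} (S : Potentials d m) : Potentials d m where
  a := S.a
  V := 0
  a_loc := S.a_loc
  V_loc := fun _ _ _ _ _ => MemLp.zero'
  V_symm := Filter.Eventually.of_forall fun _ => Matrix.isSymm_zero
  V_nonneg := Filter.Eventually.of_forall fun _ => by
    refine Real.sInf_nonneg fun r hr => ?_
    by_contra hne
    have hne : r ≠ 0 := fun h => hne h.ge
    apply hr
    rw [spectrum.mem_resolventSet_iff, Pi.zero_apply, sub_zero]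
    exact (IsUnit.mk0 r hne).map (algebraMap ℝ (Matrix (Fin m) (Fin m) ℝ))

/-! ### The sesquilinear form -/

/-- The form domain: `u ∈ L²` with `∇_a u_i ∈ L²` for all `i` and `V^{1/2} u ∈ L²`. -/
def Potentials.MemForm {d m : ℕ} (S : Potentials d m) (u : LTwo d m) : Prop :=
  (∀ i, HasMagGrad S.a (fun x => u x i)) ∧
    MemLp (fun x => act (matrixSqrt (S.V x)) (u x)) 2 volume

/-- The form `𝔞(u, v) = ∑ i, ∫ ⟨∇_a u_i, ∇_a v_i⟩ + ∫ ⟨V u, v⟩`. Mathlib's inner product is linear in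
its second argument, hence the order of the arguments of `inner`. -/
def Potentials.form {d m : ℕ} (S : Potentials d m) (u v : LTwo d m) : ℂ :=
  (∑ i, ∫ x, inner ℂ (magGrad S.a (fun y => v y i) x) (magGrad S.a (fun y => u y i) x))
    + ∫ x, inner ℂ (v x) (act (complexify (S.V x)) (u x))

section Linearity

variable {d m : ℕ}

theorem MemLpLoc.locallyIntegrable {F : Type*} [NormedAddCommGroup F] {f : RSpace d → F}
    {p : ENNReal} (hp : 1 ≤ p) (hf : MemLpLoc f p) : LocallyIntegrable f volume := by
  intro x
  refine ⟨Metric.ball x 1, Metric.ball_mem_nhds x one_pos, ?_⟩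
  have h := hf (Metric.ball x 1) Metric.isBounded_ball Metric.isOpen_ball.measurableSet
  have : IsFiniteMeasure (volume.restrict (Metric.ball x 1)) :=
    ⟨by simpa using measure_ball_lt_top⟩
  exact h.integrable hp

theorem locallyIntegrable_coord_smul {a : RSpace d → RSpace d} (ha : MemLpLoc a 2)
    {u : RSpace d → ℂ} (hu : MemLp u 2 volume) (k : Fin d) :
    LocallyIntegrable (fun x => a x k • u x) volume := by
  refine MemLpLoc.locallyIntegrable (p := 1) le_rfl ?_
  intro s hs hm
  have h1 : MemLp (fun x => a x k) 2 (volume.restrict s) :=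
    (EuclideanSpace.proj (𝕜 := ℝ) k).comp_memLp' (ha s hs hm)
  exact MemLp.smul (p := 2) (q := 2) (r := 1) (hu.restrict s) h1

theorem memLp_coord {p : ENNReal} {n : ℕ} {g : RSpace d → CSpace n} (hg : MemLp g p volume)
    (k : Fin n) : MemLp (fun x => g x k) p volume :=
  (EuclideanSpace.proj (𝕜 := ℂ) k).comp_memLp' hg

theorem IsTest.integrable_smul {φ : RSpace d → ℝ} (hφ : IsTest φ) {f : RSpace d → ℂ}
    (hf : LocallyIntegrable f volume) : Integrable (fun x => φ x • f x) volume :=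
  hf.integrable_smul_left_of_hasCompactSupport hφ.1.continuous hφ.2

theorem IsTest.integrable_partialDeriv_smul {φ : RSpace d → ℝ} (hφ : IsTest φ) (k : Fin d)
    {f : RSpace d → ℂ} (hf : LocallyIntegrable f volume) :
    Integrable (fun x => partialDeriv k φ x • f x) volume := by
  refine hf.integrable_smul_left_of_hasCompactSupport ?_ ?_
  · exact (hφ.1.continuous_fderiv (by simp)).clm_apply continuous_const
  · exact hφ.2.fderiv_apply ℝ _

theorem memLp_two_locallyIntegrable {f : RSpace d → ℂ} (hf : MemLp f 2 volume) :
    LocallyIntegrable f volume :=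
  hf.locallyIntegrable one_le_two

theorem IsWeakMagGrad.add {a : RSpace d → RSpace d} (ha : MemLpLoc a 2) {u v : RSpace d → ℂ}
    (hu : MemLp u 2 volume) (hv : MemLp v 2 volume) {g h : RSpace d → CSpace d}
    (hg : MemLp g 2 volume) (hh : MemLp h 2 volume)
    (hug : IsWeakMagGrad a u g) (hvh : IsWeakMagGrad a v h) :
    IsWeakMagGrad a (u + v) (g + h) := by
  intro k φ hφ
  have e1 := hug k φ hφ
  have e2 := hvh k φ hφ
  have i1 := hφ.integrable_smul (memLp_two_locallyIntegrable (memLp_coord hg k))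
  have i2 := hφ.integrable_smul (memLp_two_locallyIntegrable (memLp_coord hh k))
  have i3 := hφ.integrable_partialDeriv_smul k (memLp_two_locallyIntegrable hu)
  have i4 := hφ.integrable_partialDeriv_smul k (memLp_two_locallyIntegrable hv)
  have i5 := hφ.integrable_smul (locallyIntegrable_coord_smul ha hu k)
  have i6 := hφ.integrable_smul (locallyIntegrable_coord_smul ha hv k)
  simp only [Pi.add_apply, PiLp.add_apply, smul_add]
  rw [integral_add i1 i2, integral_add i3 i4, integral_add i5 i6, e1, e2]
  ring

theorem IsWeakMagGrad.smul {a : RSpace d → RSpace d} {u : RSpace d → ℂ}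
    {g : RSpace d → CSpace d} (c : ℂ) (hug : IsWeakMagGrad a u g) :
    IsWeakMagGrad a (c • u) (c • g) := by
  intro k φ hφ
  have e1 := hug k φ hφ
  simp only [Pi.smul_apply, PiLp.smul_apply, smul_comm _ c]
  rw [integral_smul, integral_smul, integral_smul, e1]
  simp only [smul_eq_mul]
  ring

theorem IsWeakMagGrad.congr {a : RSpace d → RSpace d} {u v : RSpace d → ℂ}
    {g : RSpace d → CSpace d} (huv : u =ᵐ[volume] v) (hug : IsWeakMagGrad a u g) :
    IsWeakMagGrad a v g := by
  intro k φ hφ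
  rw [hug k φ hφ]
  congr 2
  · exact integral_congr_ae (huv.mono fun x hx => by simp only [hx])
  · exact integral_congr_ae (huv.mono fun x hx => by simp only [hx])

theorem IsWeakMagGrad.ae_eq {a : RSpace d → RSpace d} {u : RSpace d → ℂ}
    {g h : RSpace d → CSpace d} (hg : MemLp g 2 volume) (hh : MemLp h 2 volume)
    (hug : IsWeakMagGrad a u g) (huh : IsWeakMagGrad a u h) : g =ᵐ[volume] h := by
  have key : ∀ k, (fun x => g x k) =ᵐ[volume] fun x => h x k := fun k =>
    ae_eq_of_integral_contDiff_smul_eq (memLp_two_locallyIntegrable (memLp_coord hg k))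
      (memLp_two_locallyIntegrable (memLp_coord hh k)) fun φ h1 h2 => by
        rw [hug k φ ⟨h1, h2⟩, huh k φ ⟨h1, h2⟩]
  filter_upwards [ae_all_iff.2 key] with x hx
  ext k
  exact hx k

theorem HasMagGrad.spec {a : RSpace d → RSpace d} {u : RSpace d → ℂ} (h : HasMagGrad a u) :
    MemLp (magGrad a u) 2 volume ∧ IsWeakMagGrad a u (magGrad a u) := by
  unfold magGrad
  rw [dif_pos h]
  exact h.choose_spec

theorem IsWeakMagGrad.magGrad_ae_eq {a : RSpace d → RSpace d} {u : RSpace d → ℂ}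
    {g : RSpace d → CSpace d} (hg : MemLp g 2 volume) (hug : IsWeakMagGrad a u g) :
    magGrad a u =ᵐ[volume] g :=
  have h : HasMagGrad a u := ⟨g, hg, hug⟩
  h.spec.2.ae_eq h.spec.1 hg hug

theorem integrable_inner_of_memLp {n : ℕ} {f g : RSpace d → CSpace n} (hf : MemLp f 2 volume)
    (hg : MemLp g 2 volume) : Integrable (fun x => inner ℂ (f x) (g x)) volume := by
  refine (L2.integrable_inner (𝕜 := ℂ) (hf.toLp f) (hg.toLp g)).congr ?_
  filter_upwards [hf.coeFn_toLp, hg.coeFn_toLp] with x h1 h2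
  rw [h1, h2]

theorem act_add (M : Matrix (Fin m) (Fin m) ℂ) (v w : CSpace m) :
    act M (v + w) = act M v + act M w := by
  simp [act, Matrix.mulVec_add]

theorem act_smul (M : Matrix (Fin m) (Fin m) ℂ) (c : ℂ) (v : CSpace m) :
    act M (c • v) = c • act M v := by
  simp [act, Matrix.mulVec_smul]

theorem act_mul (M N : Matrix (Fin m) (Fin m) ℂ) (v : CSpace m) :
    act (M * N) v = act M (act N v) := by
  simp [act, Matrix.mulVec_mulVec]

theorem inner_act (M : Matrix (Fin m) (Fin m) ℂ) (v w : CSpace m) :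
    inner ℂ v (act M w) = inner ℂ (act M.conjTranspose v) w := by
  simp only [act, EuclideanSpace.inner_eq_star_dotProduct, Matrix.star_mulVec,
    Matrix.conjTranspose_conjTranspose]
  rw [dotProduct_comm, Matrix.dotProduct_mulVec, dotProduct_comm]

open scoped MatrixOrder ComplexOrder in
theorem complexify_posSemidef {M : Matrix (Fin m) (Fin m) ℝ} (hs : M.IsSymm)
    (h0 : 0 ≤ minEigenvalue M) : (complexify M).PosSemidef := by
  have hM : M.PosSemidef := by
    have hh : M.IsHermitian := by
      rw [Matrix.IsHermitian, Matrix.conjTranspose_eq_transpose_of_trivial]; exact hs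
    refine hh.posSemidef_iff_eigenvalues_nonneg.2 fun i => ?_
    have hmem : hh.eigenvalues i ∈ spectrum ℝ M := hh.eigenvalues_mem_spectrum_real i
    refine h0.trans (csInf_le ?_ hmem)
    rw [hh.spectrum_real_eq_range_eigenvalues]
    exact (Set.finite_range _).bddBelow
  have hM' : 0 ≤ M := Matrix.nonneg_iff_posSemidef.2 hM
  obtain ⟨B, hB⟩ : ∃ B : Matrix (Fin m) (Fin m) ℝ, M = B.conjTranspose * B :=
    ⟨CFC.sqrt M, by
      rw [(Matrix.nonneg_iff_posSemidef.1 (CFC.sqrt_nonneg M)).1, CFC.sqrt_mul_sqrt_self M hM']⟩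
  have : complexify (B.conjTranspose * B) = (complexify B).conjTranspose * complexify B := by
    ext i j
    simp [complexify, Matrix.mul_apply]
  rw [hB, this]
  exact Matrix.posSemidef_conjTranspose_mul_self _

open scoped MatrixOrder in
theorem inner_complexify {M : Matrix (Fin m) (Fin m) ℝ} (hs : M.IsSymm)
    (h0 : 0 ≤ minEigenvalue M) (v w : CSpace m) :
    inner ℂ v (act (complexify M) w) = inner ℂ (act (matrixSqrt M) v) (act (matrixSqrt M) w) := by
  have hp : 0 ≤ complexify M := Matrix.nonneg_iff_posSemidef.2 (complexify_posSemidef hs h0)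
  have hsq : matrixSqrt M * matrixSqrt M = complexify M := CFC.sqrt_mul_sqrt_self _ hp
  have hadj : (matrixSqrt M).conjTranspose = matrixSqrt M :=
    (Matrix.nonneg_iff_posSemidef.1 (CFC.sqrt_nonneg (complexify M))).1
  rw [← hsq, act_mul, inner_act, hadj]

variable (S : Potentials d m)

theorem Potentials.integrable_potential {u v : LTwo d m} (hu : S.MemForm u) (hv : S.MemForm v) :
    Integrable (fun x => inner ℂ (v x) (act (complexify (S.V x)) (u x))) volume := by
  refine (integrable_inner_of_memLp hv.2 hu.2).congr ?_
  filter_upwards [S.V_symm, S.V_nonneg] with x h1 h2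
  exact (inner_complexify h1 h2 _ _).symm

theorem Potentials.magGrad_add {u v : LTwo d m} (hu : S.MemForm u) (hv : S.MemForm v)
    (i : Fin m) :
    HasMagGrad S.a (fun x => (u + v) x i) ∧
      magGrad S.a (fun x => (u + v) x i) =ᵐ[volume]
        magGrad S.a (fun x => u x i) + magGrad S.a (fun x => v x i) := by
  have sU := (hu.1 i).spec
  have sV := (hv.1 i).spec
  have hw := IsWeakMagGrad.add S.a_loc (memLp_coord (Lp.memLp u) i) (memLp_coord (Lp.memLp v) i)
    sU.1 sV.1 sU.2 sV.2
  have hc : ((fun x => u x i) + fun x => v x i) =ᵐ[volume] fun x => (u + v) x i := by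
    filter_upwards [Lp.coeFn_add u v] with x hx
    rw [hx]
    simp
  exact ⟨⟨_, sU.1.add sV.1, hw.congr hc⟩, (hw.congr hc).magGrad_ae_eq (sU.1.add sV.1)⟩

theorem Potentials.magGrad_smul (c : ℂ) {u : LTwo d m} (hu : S.MemForm u) (i : Fin m) :
    HasMagGrad S.a (fun x => (c • u) x i) ∧
      magGrad S.a (fun x => (c • u) x i) =ᵐ[volume] c • magGrad S.a (fun x => u x i) := by
  have sU := (hu.1 i).spec
  have hw := sU.2.smul c
  have hc : (c • fun x => u x i) =ᵐ[volume] fun x => (c • u) x i := by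
    filter_upwards [Lp.coeFn_smul c u] with x hx
    rw [hx]
    simp
  exact ⟨⟨_, sU.1.const_smul c, hw.congr hc⟩, (hw.congr hc).magGrad_ae_eq (sU.1.const_smul c)⟩

theorem Potentials.MemForm.add {u v : LTwo d m} (hu : S.MemForm u) (hv : S.MemForm v) :
    S.MemForm (u + v) := by
  refine ⟨fun i => (S.magGrad_add hu hv i).1, (hu.2.add hv.2).ae_eq ?_⟩
  filter_upwards [Lp.coeFn_add u v] with x hx
  rw [hx]
  simp [act_add]

theorem Potentials.MemForm.smul (c : ℂ) {u : LTwo d m} (hu : S.MemForm u) :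
    S.MemForm (c • u) := by
  refine ⟨fun i => (S.magGrad_smul c hu i).1, (hu.2.const_smul c).ae_eq ?_⟩
  filter_upwards [Lp.coeFn_smul c u] with x hx
  rw [hx]
  simp [act_smul]

theorem Potentials.memForm_zero : S.MemForm 0 := by
  have h0 : ∀ i, (0 : RSpace d → ℂ) =ᵐ[volume] fun x => (0 : LTwo d m) x i := fun i => by
    filter_upwards [Lp.coeFn_zero (CSpace m) 2 (volume : Measure (RSpace d))] with x hx
    rw [hx]
    simp
  refine ⟨fun i => ⟨0, MemLp.zero, ?_⟩, (MemLp.zero (ε := CSpace m)).ae_eq ?_⟩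
  · refine IsWeakMagGrad.congr (h0 i) ?_
    intro k φ _
    simp
  · filter_upwards [Lp.coeFn_zero (CSpace m) 2 (volume : Measure (RSpace d))] with x hx
    rw [hx]
    simp [act]

theorem Potentials.form_add_left {u u' v : LTwo d m} (hu : S.MemForm u) (hu' : S.MemForm u')
    (hv : S.MemForm v) : S.form (u + u') v = S.form u v + S.form u' v := by
  have e1 : ∀ i, ∫ x, inner ℂ (magGrad S.a (fun y => v y i) x)
        (magGrad S.a (fun y => (u + u') y i) x)
      = (∫ x, inner ℂ (magGrad S.a (fun y => v y i) x) (magGrad S.a (fun y => u y i) x))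
        + ∫ x, inner ℂ (magGrad S.a (fun y => v y i) x) (magGrad S.a (fun y => u' y i) x) := by
    intro i
    rw [← integral_add (integrable_inner_of_memLp (hv.1 i).spec.1 (hu.1 i).spec.1)
      (integrable_inner_of_memLp (hv.1 i).spec.1 (hu'.1 i).spec.1)]
    refine integral_congr_ae ?_
    filter_upwards [(S.magGrad_add hu hu' i).2] with x hx
    rw [hx, Pi.add_apply, inner_add_right]
  have e2 : ∫ x, inner ℂ (v x) (act (complexify (S.V x)) ((u + u') x))
      = (∫ x, inner ℂ (v x) (act (complexify (S.V x)) (u x)))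
        + ∫ x, inner ℂ (v x) (act (complexify (S.V x)) (u' x)) := by
    rw [← integral_add (S.integrable_potential hu hv) (S.integrable_potential hu' hv)]
    refine integral_congr_ae ?_
    filter_upwards [Lp.coeFn_add u u'] with x hx
    rw [hx, Pi.add_apply, act_add, inner_add_right]
  unfold Potentials.form
  rw [e2, Finset.sum_congr rfl fun i _ => e1 i, Finset.sum_add_distrib]
  ring

theorem Potentials.form_smul_left (c : ℂ) {u v : LTwo d m} (hu : S.MemForm u) :
    S.form (c • u) v = c * S.form u v := by
  have e1 : ∀ i, ∫ x, inner ℂ (magGrad S.a (fun y => v y i) x)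
        (magGrad S.a (fun y => (c • u) y i) x)
      = c * ∫ x, inner ℂ (magGrad S.a (fun y => v y i) x) (magGrad S.a (fun y => u y i) x) := by
    intro i
    rw [← integral_const_mul]
    refine integral_congr_ae ?_
    filter_upwards [(S.magGrad_smul c hu i).2] with x hx
    rw [hx, Pi.smul_apply, inner_smul_right]
  have e2 : ∫ x, inner ℂ (v x) (act (complexify (S.V x)) ((c • u) x))
      = c * ∫ x, inner ℂ (v x) (act (complexify (S.V x)) (u x)) := by
    rw [← integral_const_mul]
    refine integral_congr_ae ?_
    filter_upwards [Lp.coeFn_smul c u] with x hx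
    rw [hx, Pi.smul_apply, act_smul, inner_smul_right]
  unfold Potentials.form
  rw [e2, Finset.sum_congr rfl fun i _ => e1 i, ← Finset.mul_sum]
  ring

end Linearity

/-! ### The operator associated with the form -/

/-- The graph of the operator associated with the form: all `(u, f)` with `u` in the form domain and
`𝔞(u, v) = ⟨f, v⟩` for every `v` in the form domain. -/
def Potentials.graph {d m : ℕ} (S : Potentials d m) : Submodule ℂ (LTwo d m × LTwo d m) where
  carrier := {p | S.MemForm p.1 ∧ ∀ v, S.MemForm v → S.form p.1 v = inner ℂ v p.2}
  add_mem' := fun {p q} hp hq => ⟨hp.1.add S hq.1, fun v hv => by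
    rw [Prod.fst_add, Prod.snd_add, S.form_add_left hp.1 hq.1 hv, hp.2 v hv, hq.2 v hv,
      inner_add_right]⟩
  zero_mem' := ⟨S.memForm_zero, fun v _ => by
    have h := S.form_smul_left 0 (v := v) S.memForm_zero
    rw [zero_smul, zero_mul] at h
    rw [Prod.fst_zero, Prod.snd_zero, h, inner_zero_right]⟩
  smul_mem' := fun c p hp => ⟨hp.1.smul S c, fun v hv => by
    rw [Prod.smul_fst, Prod.smul_snd, S.form_smul_left c hp.1, hp.2 v hv, inner_smul_right]⟩

/-- The self-adjoint realization in `L²(ℝ^d; ℂ^m)` of `-Δ_a + V`, associated with the form. -/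
def Potentials.operator {d m : ℕ} (S : Potentials d m) : LTwo d m →ₗ.[ℂ] LTwo d m :=
  S.graph.toLinearPMap

/-! ### Square roots of nonnegative self-adjoint operators -/

section SquareRoot

variable {E : Type*} [NormedAddCommGroup E] [InnerProductSpace ℂ E] [CompleteSpace E]

/-- `R` is the bounded inverse `(1 + A)⁻¹`. -/
def IsResolvent (A : E →ₗ.[ℂ] E) (R : E →L[ℂ] E) : Prop :=
  ∀ u f : E, (∃ h : u ∈ A.domain, u + A ⟨u, h⟩ = f) ↔ u = R f

open Classical in
/-- The resolvent `(1 + A)⁻¹`, which exists for every nonnegative self-adjoint operator `A`. -/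
def resolvent (A : E →ₗ.[ℂ] E) : E →L[ℂ] E :=
  if h : ∃ R : E →L[ℂ] E, IsResolvent A R then h.choose else 0

/-- The nonnegative self-adjoint square root of a (possibly unbounded) nonnegative self-adjoint
operator `A`, by functional calculus: with `R = (1 + A)⁻¹`, so `0 ≤ R ≤ 1` and `A = (1 - R) R⁻¹`,
it is `A^{1/2} = (1 - R)^{1/2} (R^{1/2})⁻¹`, with domain the range of `R^{1/2}`; that is, its graph
consists of all pairs `(R^{1/2} g, (1 - R)^{1/2} g)`. -/
def sqrtOp (A : E →ₗ.[ℂ] E) : E →ₗ.[ℂ] E :=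
  (LinearMap.range ((CFC.sqrt (resolvent A) : E →L[ℂ] E).toLinearMap.prod
    (CFC.sqrt (1 - resolvent A) : E →L[ℂ] E).toLinearMap)).toLinearPMap

/-- The composition `T ∘ U` of two partially defined operators with its natural domain
`{f ∈ D(U) : U f ∈ D(T)}`. -/
def compOp (T U : E →ₗ.[ℂ] E) : E →ₗ.[ℂ] E :=
  T.comp (U.domRestrict ((T.domain.comap U.toFun).map U.domain.subtype)) (by
    rintro ⟨x, hx⟩
    obtain ⟨y, hy, hyx⟩ := hx.1
    have e := LinearPMap.domRestrict_apply (f := U) (x := ⟨x, hx⟩) (y := y) hyx.symm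
    exact (congrArg (· ∈ T.domain) e).mpr hy)

/-- `(sqrtOp A)² = A` for every `A` with a resolvent `0 ≤ (1 + A)⁻¹ ≤ 1`, in particular for every
nonnegative self-adjoint `A`: `(u, z)` lies on the graph of `A` if and only if there is `w` such that
`(u, w)` and `(w, z)` lie on the graph of `sqrtOp A`. -/
theorem sqrtOp_sq {A : E →ₗ.[ℂ] E} {R : E →L[ℂ] E} (hR : IsResolvent A R) (h0 : 0 ≤ R)
    (h1 : 0 ≤ 1 - R) (u z : E) :
    (u, z) ∈ A.graph ↔ ∃ w, (u, w) ∈ (sqrtOp A).graph ∧ (w, z) ∈ (sqrtOp A).graph := by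
  have hres : resolvent A = R := by
    have h : ∃ R : E →L[ℂ] E, IsResolvent A R := ⟨R, hR⟩
    unfold resolvent
    rw [dif_pos h]
    ext f
    obtain ⟨hd, hf⟩ := (h.choose_spec (h.choose f) f).2 rfl
    exact (hR _ f).1 ⟨hd, hf⟩
  have hRinj : ∀ f, R f = 0 → f = 0 := fun f hf => by
    obtain ⟨hd, h2⟩ := (hR 0 f).2 hf.symm
    rw [← h2, zero_add]
    exact A.map_zero
  set P : E →L[ℂ] E := CFC.sqrt R with hP
  set Q : E →L[ℂ] E := CFC.sqrt (1 - R) with hQ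
  have hPP : ∀ f, P (P f) = R f := fun f => congrArg (fun T : E →L[ℂ] E => T f)
    (CFC.sqrt_mul_sqrt_self R h0)
  have hQQ : ∀ f, Q (Q f) = f - R f := fun f => congrArg (fun T : E →L[ℂ] E => T f)
    (CFC.sqrt_mul_sqrt_self (1 - R) h1)
  have hcomm : Commute P Q := by
    have c1 : Commute R (1 - R) := (Commute.one_right R).sub_right (Commute.refl R)
    have c2 : Commute P (1 - R) := by
      rw [hP, CFC.sqrt_eq_cfc]
      exact c1.cfc_nnreal _
    rw [hQ, CFC.sqrt_eq_cfc]
    exact (c2.symm.cfc_nnreal _).symm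
  have hPQ : ∀ f, P (Q f) = Q (P f) := fun f => congrArg (fun T : E →L[ℂ] E => T f) hcomm.eq
  have hgraph : ∀ x y, (x, y) ∈ (sqrtOp A).graph ↔ ∃ g, P g = x ∧ Q g = y := by
    intro x y
    unfold sqrtOp
    rw [hres, Submodule.toLinearPMap_graph_eq]
    · simp [LinearMap.mem_range, ← hP, ← hQ]
    · rintro _ ⟨g, rfl⟩ hg
      have hg' : P g = 0 := hg
      have : g = 0 := hRinj g (by rw [← hPP, hg', map_zero])
      simp [this]
  have hA : (u, z) ∈ A.graph ↔ u = R (u + z) := by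
    rw [← hR u (u + z), LinearPMap.mem_graph_iff]
    constructor
    · rintro ⟨y, rfl, rfl⟩
      exact ⟨y.2, rfl⟩
    · rintro ⟨hd, h⟩
      exact ⟨⟨u, hd⟩, rfl, add_left_cancel h⟩
  rw [hA]
  constructor
  · intro h
    refine ⟨P (Q (u + z)), (hgraph _ _).2 ⟨P (u + z), ?_, ?_⟩, (hgraph _ _).2 ⟨Q (u + z), rfl, ?_⟩⟩
    · rw [hPP, ← h]
    · rw [hPQ]
    · rw [hQQ, ← h, add_sub_cancel_left]
  · rintro ⟨w, hw1, hw2⟩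
    obtain ⟨g, rfl, rfl⟩ := (hgraph _ _).1 hw1
    obtain ⟨k, hk, rfl⟩ := (hgraph _ _).1 hw2
    have e1 : R (Q k) = P (g - R g) := by
      rw [← hPP, hPQ k, hk, hQQ]
    have e2 : R (P g) = P (R g) := by
      rw [← hPP, ← hPP]
    rw [map_add, e1, e2, map_sub]
    abel

end SquareRoot

/-- `L^{1/2} A^{-1/2}` on its natural domain in `L²(ℝ^d; ℂ^m)`, where `A` is the realization of
`-Δ_a + V`, `L` that of `-Δ_a`, and `A^{-1/2}` is the inverse of `A^{1/2}`. -/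
def Potentials.rieszOp {d m : ℕ} (S : Potentials d m) : LTwo d m →ₗ.[ℂ] LTwo d m :=
  compOp (sqrtOp S.magnetic.operator) (sqrtOp S.operator).inverse

/-! ### Hypotheses and extensions -/

/-- The eigenvalues of `V` are comparable: `λ_V ≤ Λ_V ≤ κ λ_V` almost everywhere. -/
def Potentials.Comparable {d m : ℕ} (S : Potentials d m) (κ : ℝ) : Prop :=
  ∀ᵐ x, minEigenvalue (S.V x) ≤ maxEigenvalue (S.V x) ∧
    maxEigenvalue (S.V x) ≤ κ * minEigenvalue (S.V x)

/-- `a ∈ L^q_loc` for some `q ∈ (2, ∞)` and `div a ∈ L^s_loc` for some `s ∈ (1, ∞)`. -/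
def Potentials.Regular {d m : ℕ} (S : Potentials d m) : Prop :=
  (∃ q : ℝ, 2 < q ∧ MemLpLoc S.a (ENNReal.ofReal q)) ∧
    ∃ s : ℝ, 1 < s ∧ ∃ h : RSpace d → ℝ, MemLpLoc h (ENNReal.ofReal s) ∧ IsWeakDiv S.a h

/-- The bounded operator `T` on `L²` extends the partially defined operator `U`. -/
def ExtendsOp {d m : ℕ} (T : LTwo d m →L[ℂ] LTwo d m) (U : LTwo d m →ₗ.[ℂ] LTwo d m) : Prop :=
  ∀ f : U.domain, T f = U f

/-- The bounded operator `T` on `L¹` agrees with the operator `U` on `L²` on `L¹ ∩ L²`. -/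
def AgreeOnInter {d m : ℕ} (T : LOne d m →L[ℂ] LOne d m) (U : LTwo d m →L[ℂ] LTwo d m) : Prop :=
  ∀ (f : LOne d m) (g : LTwo d m), f =ᵐ[volume] g → T f =ᵐ[volume] U g

end MagneticSchrodinger

end

/-! Write $R=(1+A)^{-1}$, $R'=(1+L)^{-1}$. The form domain of $A$ embeds contractively in that of
$L$, so $R^{1/2}=R'^{1/2}H$ with a contraction $H$. Since $A^{1/2}R^{1/2}=(1-R)^{1/2}$, the operator
$L^{1/2}A^{-1/2}$ is $(1-R)^{1/2}g\mapsto(1-R')^{1/2}Hg$. It is bounded, and it is densely defined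
because $A$ has trivial kernel: $\nabla_a f=0$ makes $(1+|f|^2)^{1/2}-1$ an integrable function with
zero derivative (`exists_riesz_extension`, `ae_eq_zero_of_isVecMagGrad_zero`).

The $L^1$ bound rests on a vector-valued Kato inequality: testing $-\nabla_a^2u=p$ with a cutoff
times $u/(|u|^2+\delta^2)^{1/2}$ leaves a nonnegative gradient term, and removing the cutoff and
$\delta$ gives `Potentials.Solves.lintegral_le`. Put $u=(1+\eta A)^{-1}f$ and $w=(1+\eta L)^{-1}f$.
Then $\|u\|_1+\eta\int\langle Vu,u\rangle/|u|\le\|f\|_1$. Moreover $w-u$ solves the equation for $L$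
with source $\eta Vu$, and comparability of eigenvalues gives $|Vu|\le\kappa\langle
Vu,u\rangle/|u|$. Hence $$\|w-u\|_1+\kappa\|u\|_1\le\kappa\|f\|_1$$
(`Potentials.ResolventEq.lintegral_sub_le`).

For $J=(1+\eta L)^{-1}$, $K=(1+\eta A)^{-1}$ this is the relation `Dominated`, which is stable under
products, averages, scaling by $c\in[0,1]$ and limits. It therefore passes to $1-(1-\theta J)^{1/2}$
and $1-(1-\theta K)^{1/2}$, obtained by the iteration $Y\mapsto(X+Y^2)/2$. With $\theta=1-\eta^2$,
$S=(1-\theta K)^{1/2}$ and $S'=(1-\theta J)^{1/2}$ it says $\|S'w-Sw\|_1\le\kappa\|Sw\|_1$. Taking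
$w=S^{-1}f$ gives $\|S'S^{-1}f\|_1\le(1+\kappa)\|f\|_1$ (`Potentials.mass_approx_le`).

Finally $S^2=\eta(A+\eta)(1+\eta A)^{-1}$, so $\eta^{-1/2}S$ approximates $A^{1/2}$ and $S'S^{-1}\to
L^{1/2}A^{-1/2}$ strongly in $L^2$ as $\eta\to0$ (`tendsto_approx`). Fatou's lemma carries the $L^1$
bound to the limit. -/

noncomputable section

namespace MagneticSchrodinger

/-! ### Mollifiers and the chain rule for weak derivatives. -/

section Mollification

open Filter Topology
open scoped Convolution

variable {d : ℕ} {E : Type*} [NormedAddCommGroup E] [NormedSpace ℝ E]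

/-- `w` is the weak partial derivative `∂_k u`. -/
def IsWeakDeriv (k : Fin d) (u w : RSpace d → E) : Prop :=
  ∀ φ : RSpace d → ℝ, IsTest φ → ∫ x, partialDeriv k φ x • u x = - ∫ x, φ x • w x

/-- A sequence of bump functions supported in balls of radius `1 / (n + 1)`. -/
def mollBump (d n : ℕ) : ContDiffBump (0 : RSpace d) where
  -- The ratio of the radii stays equal to 2, as almost everywhere convergence at Lebesgue points
  -- requires; the outer radius is at most 1.
  rIn := 1 / (2 * ((n : ℝ) + 1))
  rOut := 1 / ((n : ℝ) + 1)
  rIn_pos := by positivity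
  rIn_lt_rOut := by
    apply one_div_lt_one_div_of_lt (by positivity)
    have : (0 : ℝ) ≤ n := n.cast_nonneg
    linarith

/-- The standard mollifiers. -/
def moll (d n : ℕ) : RSpace d → ℝ := (mollBump d n).normed volume

/-- The mollification of a function. -/
def mollify (n : ℕ) (u : RSpace d → E) : RSpace d → E :=
  moll d n ⋆[ContinuousLinearMap.lsmul ℝ ℝ, volume] u

theorem moll_contDiff (n : ℕ) : ContDiff ℝ ∞ (moll d n) := (mollBump d n).contDiff_normed

theorem moll_hasCompactSupport (n : ℕ) : HasCompactSupport (moll d n) :=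
  (mollBump d n).hasCompactSupport_normed

theorem moll_nonneg (n : ℕ) (x : RSpace d) : 0 ≤ moll d n x := (mollBump d n).nonneg_normed x

theorem integral_moll (n : ℕ) : ∫ x, moll d n x = 1 := (mollBump d n).integral_normed

theorem moll_eq_zero {n : ℕ} {x : RSpace d} (hx : 1 ≤ ‖x‖) : moll d n x = 0 := by
  have h : x ∉ Function.support (moll d n) := by
    unfold moll
    rw [ContDiffBump.support_normed_eq]
    simp only [Metric.mem_ball, dist_zero_right, not_lt]
    refine le_trans ?_ hx
    change 1 / ((n : ℝ) + 1) ≤ 1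
    rw [div_le_one (by positivity)]
    have : (0 : ℝ) ≤ n := n.cast_nonneg
    linarith
  simpa using h

theorem integrable_moll (n : ℕ) : Integrable (moll d n) := (mollBump d n).integrable_normed

theorem ae_tendsto_mollify [CompleteSpace E] {u : RSpace d → E} (hu : LocallyIntegrable u) :
    ∀ᵐ x, Tendsto (fun n => mollify n u x) atTop (𝓝 (u x)) := by
  refine ContDiffBump.ae_convolution_tendsto_right_of_locallyIntegrable (K := 2)
    (φ := mollBump d) ?_ (Eventually.of_forall fun n => ?_) hu
  · exact tendsto_one_div_add_atTop_nhds_zero_nat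
  · change 1 / ((n : ℝ) + 1) ≤ 2 * (1 / (2 * ((n : ℝ) + 1)))
    field_simp
    exact le_rfl

theorem integrable_mollify (n : ℕ) {u : RSpace d → E} (hu : Integrable u) :
    Integrable (mollify n u) :=
  (integrable_moll n).integrable_convolution _ hu

theorem norm_mollify_le (n : ℕ) (u : RSpace d → E) (x : RSpace d) :
    ‖mollify n u x‖ ≤ mollify n (fun y => ‖u y‖) x := by
  unfold mollify convolution
  refine (norm_integral_le_integral_norm _).trans_eq (integral_congr_ae (.of_forall fun t => ?_))
  simp [norm_smul, abs_of_nonneg (moll_nonneg n t)]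

theorem integral_norm_mollify_le (n : ℕ) {u : RSpace d → E} (hu : Integrable u) :
    ∫ x, ‖mollify n u x‖ ≤ ∫ x, ‖u x‖ := by
  refine (integral_mono (integrable_mollify n hu).norm (integrable_mollify n hu.norm)
    (norm_mollify_le n u)).trans_eq ?_
  unfold mollify
  rw [integral_convolution _ (integrable_moll n) hu.norm, integral_moll]
  simp

/-- Scheffé's lemma. -/
theorem tendsto_integral_norm_sub_of_ae {α : Type*} [MeasurableSpace α] {μ : Measure α}
    {F : Type*} [NormedAddCommGroup F] {u : α → F} {v : ℕ → α → F}
    (hu : Integrable u μ) (hv : ∀ n, Integrable (v n) μ)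
    (hle : ∀ n, ∫ x, ‖v n x‖ ∂μ ≤ ∫ x, ‖u x‖ ∂μ)
    (hlim : ∀ᵐ x ∂μ, Tendsto (fun n => v n x) atTop (𝓝 (u x))) :
    Tendsto (fun n => ∫ x, ‖v n x - u x‖ ∂μ) atTop (𝓝 0) := by
  -- This function is nonnegative and tends to $2\|u\|$ almost everywhere, so Fatou's lemma bounds
  -- the limit superior of $\int\|v_n-u\|$ by 0.
  set h : ℕ → α → ℝ := fun n x => ‖v n x‖ + ‖u x‖ - ‖v n x - u x‖ with hh
  have hpos : ∀ n x, 0 ≤ h n x := fun n x => by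
    have := norm_sub_le (v n x) (u x)
    simp only [hh]; linarith
  have hint : ∀ n, Integrable (h n) μ := fun n =>
    ((hv n).norm.add hu.norm).sub ((hv n).sub hu).norm
  have hval : ∀ n, ∫ x, h n x ∂μ = ∫ x, ‖v n x‖ ∂μ + ∫ x, ‖u x‖ ∂μ - ∫ x, ‖v n x - u x‖ ∂μ := by
    intro n
    have e1 := integral_sub ((hv n).norm.add hu.norm) ((hv n).sub hu).norm
    have e2 := integral_add (hv n).norm hu.norm
    simp only [Pi.add_apply, Pi.sub_apply] at e1 e2
    rw [← e2, ← e1]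
  have hfatou : ∫⁻ x, ENNReal.ofReal (2 * ‖u x‖) ∂μ
      ≤ liminf (fun n => ∫⁻ x, ENNReal.ofReal (h n x) ∂μ) atTop := by
    refine le_trans (lintegral_mono_ae ?_)
      (lintegral_liminf_le' fun n => (hint n).aemeasurable.ennreal_ofReal)
    filter_upwards [hlim] with x hx
    have h1 : Tendsto (fun n => h n x) atTop (𝓝 (‖u x‖ + ‖u x‖ - ‖u x - u x‖)) :=
      ((hx.norm.add tendsto_const_nhds).sub (hx.sub tendsto_const_nhds).norm)
    have h2 := (ENNReal.continuous_ofReal.tendsto _).comp h1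
    rw [sub_self, norm_zero, sub_zero, ← two_mul] at h2
    exact h2.liminf_eq.ge
  rw [← ofReal_integral_eq_lintegral_ofReal (hu.norm.const_mul 2)
    (.of_forall fun x => by positivity)] at hfatou
  simp_rw [← ofReal_integral_eq_lintegral_ofReal (hint _) (.of_forall (hpos _))] at hfatou
  rw [integral_const_mul] at hfatou
  set U := ∫ x, ‖u x‖ ∂μ with hU
  refine tendsto_order.2 ⟨fun b hb => .of_forall fun n =>
    hb.trans_le (integral_nonneg fun x => norm_nonneg _), fun b hb => ?_⟩
  -- `ENNReal.ofReal` truncates at 0, so the strict inequality transfers only when $2U-b\ge0$.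
  -- Otherwise $\int\|v_n-u\|\le2U<b$ already.
  by_cases hU0 : 2 * U - b < 0
  · refine .of_forall fun n => ?_
    have h1 := hval n
    have h2 : 0 ≤ ∫ x, h n x ∂μ := integral_nonneg (hpos n)
    have h3 := hle n
    linarith
  · have hlt : ENNReal.ofReal (2 * U - b) < liminf (fun n => ENNReal.ofReal (∫ x, h n x ∂μ)) atTop :=
      lt_of_lt_of_le ((ENNReal.ofReal_lt_ofReal_iff (by linarith)).2 (by linarith)) hfatou
    filter_upwards [eventually_lt_of_lt_liminf hlt] with n hn
    have h4 := (ENNReal.ofReal_lt_ofReal_iff' .. |>.1 hn).1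
    have h1 := hval n
    have h3 := hle n
    linarith

theorem mollify_congr_of_ball {n : ℕ} {r : ℝ} (u : RSpace d → E) {x : RSpace d} (hx : ‖x‖ ≤ r) :
    mollify n ((Metric.closedBall 0 (r + 1)).indicator u) x = mollify n u x := by
  unfold mollify convolution
  refine integral_congr_ae (.of_forall fun t => ?_)
  by_cases ht : 1 ≤ ‖t‖
  · simp [moll_eq_zero ht]
  · have : x - t ∈ Metric.closedBall (0 : RSpace d) (r + 1) := by
      rw [mem_closedBall_zero_iff]
      have := norm_sub_le x t
      linarith
    simp [Set.indicator_of_mem this]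

/-- On the ball of radius $r$ the mollification only sees $u$ on the ball of radius $r+1$. Scheffé's
lemma applies to $u$ truncated there, since mollifying does not increase the $L^1$ norm. -/
theorem tendsto_setIntegral_norm_mollify_sub [CompleteSpace E] {u : RSpace d → E} (hu : LocallyIntegrable u) (r : ℝ) :
    Tendsto (fun n => ∫ x in Metric.closedBall 0 r, ‖mollify n u x - u x‖) atTop (𝓝 0) := by
  set B : Set (RSpace d) := Metric.closedBall 0 (r + 1)
  have hU : Integrable (B.indicator u) :=
    (integrable_indicator_iff Metric.isClosed_closedBall.measurableSet).2
      (hu.integrableOn_isCompact (isCompact_closedBall _ _))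
  have key := tendsto_integral_norm_sub_of_ae hU (fun n => integrable_mollify n hU)
    (fun n => integral_norm_mollify_le n hU) (ae_tendsto_mollify hU.locallyIntegrable)
  refine squeeze_zero (fun n => integral_nonneg fun x => norm_nonneg _) (fun n => ?_) key
  have : ∫ x in Metric.closedBall 0 r, ‖mollify n u x - u x‖
      = ∫ x in Metric.closedBall 0 r, ‖mollify n (B.indicator u) x - B.indicator u x‖ := by
    refine setIntegral_congr_fun Metric.isClosed_closedBall.measurableSet fun x hx => ?_
    have hx' : ‖x‖ ≤ r := by simpa using hx
    have hxB : x ∈ B := by simp only [B, mem_closedBall_zero_iff]; linarith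
    simp only [B] at hxB ⊢
    rw [mollify_congr_of_ball u hx', Set.indicator_of_mem hxB]
  rw [this]
  exact setIntegral_le_integral ((integrable_mollify n hU).sub hU).norm
    (.of_forall fun x => norm_nonneg _)

theorem contDiff_mollify (n : ℕ) {u : RSpace d → E} (hu : LocallyIntegrable u) :
    ContDiff ℝ ∞ (mollify n u) :=
  (moll_hasCompactSupport n).contDiff_convolution_left _ (moll_contDiff n) hu

/-- The derivative falls on the kernel, and $y\mapsto\rho_n(x-y)$ is a test function for the weak
derivative. -/
theorem fderiv_mollify {k : Fin d} {u w : RSpace d → E} (hu : LocallyIntegrable u)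
    (h : IsWeakDeriv k u w) (n : ℕ) (x : RSpace d) :
    fderiv ℝ (mollify n u) x (EuclideanSpace.single k 1) = mollify n w x := by
  have hd := (moll_hasCompactSupport (d := d) n).hasFDerivAt_convolution_left
    (ContinuousLinearMap.lsmul ℝ ℝ) ((moll_contDiff n).of_le (by simp)) hu x
  unfold mollify
  rw [hd.fderiv, convolution_eq_swap, convolution_eq_swap, ContinuousLinearMap.integral_apply]
  · set φ : RSpace d → ℝ := fun y => moll d n (x - y) with hφ
    have hφt : IsTest φ :=
      ⟨(moll_contDiff n).comp (contDiff_const.sub contDiff_id),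
        (moll_hasCompactSupport n).comp_homeomorph (Homeomorph.subLeft x)⟩
    have h1 := h φ hφt
    have h2 : ∀ y, partialDeriv k φ y = - fderiv ℝ (moll d n) (x - y) (EuclideanSpace.single k 1) := by
      intro y
      have : HasFDerivAt φ ((fderiv ℝ (moll d n) (x - y)).comp (-ContinuousLinearMap.id ℝ _)) y :=
        (((moll_contDiff n).differentiable (by simp)) (x - y)).hasFDerivAt.comp y
          ((hasFDerivAt_id y).const_sub x)
      unfold partialDeriv
      rw [this.fderiv]
      simp
    simp only [h2, neg_smul, integral_neg, neg_inj] at h1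
    simpa [hφ] using h1
  · have := ((moll_hasCompactSupport (d := d) n).fderiv ℝ).convolutionExists_left
      ((ContinuousLinearMap.lsmul ℝ ℝ : ℝ →L[ℝ] E →L[ℝ] E).precompL (RSpace d))
      ((moll_contDiff n).continuous_fderiv (by simp)) hu x
    exact this.integrable_swap

theorem tendsto_integral_smul_of_setIntegral {a : RSpace d → E} {b : ℕ → RSpace d → E}
    (ha : LocallyIntegrable a) (hb : ∀ n, LocallyIntegrable (b n))
    (hlim : ∀ r, Tendsto (fun n => ∫ x in Metric.closedBall 0 r, ‖b n x - a x‖) atTop (𝓝 0))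
    {ψ : RSpace d → ℝ} (hψ : Continuous ψ) (hc : HasCompactSupport ψ) :
    Tendsto (fun n => ∫ x, ψ x • b n x) atTop (𝓝 (∫ x, ψ x • a x)) := by
  obtain ⟨M, hM⟩ := hψ.bounded_above_of_compact_support hc
  obtain ⟨r, hr⟩ := hc.isCompact.isBounded.subset_closedBall 0
  have hia := ha.integrable_smul_left_of_hasCompactSupport hψ hc
  have hib := fun n => (hb n).integrable_smul_left_of_hasCompactSupport hψ hc
  have hM0 : 0 ≤ M := (norm_nonneg _).trans (hM 0)
  rw [tendsto_iff_norm_sub_tendsto_zero]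
  refine squeeze_zero (fun n => norm_nonneg _) (fun n => ?_)
    (by simpa using (hlim r).const_mul M)
  rw [← integral_sub (hib n) hia]
  refine (norm_integral_le_integral_norm _).trans ?_
  have hz : ∀ x, x ∉ Metric.closedBall (0 : RSpace d) r → ‖ψ x • b n x - ψ x • a x‖ = 0 := by
    intro x hx
    have : ψ x = 0 := image_eq_zero_of_notMem_tsupport fun h => hx (hr h)
    simp [this]
  rw [← setIntegral_eq_integral_of_forall_compl_eq_zero hz, ← integral_const_mul]
  have hloc : IntegrableOn (fun x => b n x - a x) (Metric.closedBall 0 r) :=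
    ((hb n).sub ha).integrableOn_isCompact (isCompact_closedBall _ _)
  refine integral_mono ((hib n).sub hia).norm.integrableOn (hloc.norm.const_mul M) fun x => ?_
  simp only [← smul_sub, norm_smul]
  exact mul_le_mul_of_nonneg_right (hM x) (norm_nonneg _)

variable {G : Type*} [NormedAddCommGroup G] [NormedSpace ℝ G]

theorem locallyIntegrable_norm {E : Type*} [NormedAddCommGroup E] {u : RSpace d → E} (hu : LocallyIntegrable u) :
    LocallyIntegrable (fun x => ‖u x‖) :=
  hu.mono hu.aestronglyMeasurable.norm (.of_forall fun x => by simp)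

theorem norm_sub_le_of_fderiv_bound {F : E → G} (hF : ContDiff ℝ 1 F) {C : ℝ}
    (hC : ∀ z, ‖fderiv ℝ F z‖ ≤ C) (y z : E) : ‖F y - F z‖ ≤ C * ‖y - z‖ :=
  convex_univ.norm_image_sub_le_of_norm_fderiv_le
    (fun x _ => (hF.differentiable one_ne_zero) x) (fun x _ => hC x) trivial trivial

theorem locallyIntegrable_comp {u : RSpace d → E} (hu : LocallyIntegrable u) {F : E → G}
    (hF : ContDiff ℝ 1 F) {C : ℝ} (hC : ∀ z, ‖fderiv ℝ F z‖ ≤ C) :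
    LocallyIntegrable (fun x => F (u x)) := by
  have h0 : LocallyIntegrable (fun x => C * ‖u x‖ + ‖F 0‖) :=
    (LocallyIntegrable.smul (locallyIntegrable_norm hu) C).add (locallyIntegrable_const _)
  refine h0.mono (hF.continuous.comp_aestronglyMeasurable hu.aestronglyMeasurable) ?_
  refine .of_forall fun x => ?_
  have h1 := norm_sub_le_of_fderiv_bound hF hC (u x) 0
  have h2 := norm_le_norm_sub_add (F (u x)) (F 0)
  rw [sub_zero] at h1
  exact (h2.trans (by gcongr)).trans (Real.le_norm_self _)

theorem locallyIntegrable_fderiv_apply {u w : RSpace d → E} (hu : LocallyIntegrable u)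
    (hw : LocallyIntegrable w) {F : E → G}
    (hF : ContDiff ℝ 1 F) {C : ℝ} (hC : ∀ z, ‖fderiv ℝ F z‖ ≤ C) :
    LocallyIntegrable (fun x => fderiv ℝ F (u x) (w x)) := by
  have h0 : LocallyIntegrable (fun x => C * ‖w x‖) := LocallyIntegrable.smul (locallyIntegrable_norm hw) C
  refine h0.mono ?_ (.of_forall fun x => ?_)
  · have hc : Continuous fun p : (E →L[ℝ] G) × E => p.1 p.2 :=
      isBoundedBilinearMap_apply.continuous
    exact hc.comp_aestronglyMeasurable (((hF.continuous_fderiv one_ne_zero).comp_aestronglyMeasurable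
      hu.aestronglyMeasurable).prodMk hw.aestronglyMeasurable)
  · exact ((fderiv ℝ F (u x)).le_of_opNorm_le (hC _) _).trans (Real.le_norm_self _)

theorem isTest_partialDeriv {k : Fin d} {φ : RSpace d → ℝ} (hφ : IsTest φ) :
    Continuous (partialDeriv k φ) ∧ HasCompactSupport (partialDeriv k φ) :=
  ⟨(hφ.1.continuous_fderiv (by simp)).clm_apply continuous_const, hφ.2.fderiv_apply ℝ _⟩

/-- The chain rule for weak derivatives. -/
theorem IsWeakDeriv.comp [CompleteSpace E] {k : Fin d} {u w : RSpace d → E}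
    (h : IsWeakDeriv k u w) (hu : LocallyIntegrable u) (hw : LocallyIntegrable w) {F : E → G}
    (hF : ContDiff ℝ 1 F) {C : ℝ} (hC : ∀ z, ‖fderiv ℝ F z‖ ≤ C) :
    IsWeakDeriv k (fun x => F (u x)) (fun x => fderiv ℝ F (u x) (w x)) := by
  intro φ hφ
  have hun := fun n => contDiff_mollify n hu
  have hwn := fun n => contDiff_mollify n hw
  have hul := fun n => (hun n).continuous.locallyIntegrable (μ := volume)
  have hwl := fun n => (hwn n).continuous.locallyIntegrable (μ := volume)
  have hFn := fun n => locallyIntegrable_comp (hul n) hF hC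
  have hDn := fun n => locallyIntegrable_fderiv_apply (hul n) (hwl n) hF hC
  have hF0 := locallyIntegrable_comp hu hF hC
  have hD0 := locallyIntegrable_fderiv_apply hu hw hF hC
  have hC0 : 0 ≤ C := (norm_nonneg _).trans (hC 0)
  -- For the smooth mollified function the chain rule and integration by parts are classical.
  have step : ∀ n, ∫ x, partialDeriv k φ x • F (mollify n u x)
      = - ∫ x, φ x • fderiv ℝ F (mollify n u x) (mollify n w x) := by
    intro n
    have hdF : ∀ x, fderiv ℝ (fun y => F (mollify n u y)) x (EuclideanSpace.single k 1)
        = fderiv ℝ F (mollify n u x) (mollify n w x) := by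
      intro x
      rw [fderiv_fun_comp x (hF.differentiable one_ne_zero _) ((hun n).differentiable (by simp) x)]
      simp [fderiv_mollify hu h]
    have ibp := integral_smul_fderiv_eq_neg_fderiv_smul_of_integrable (μ := volume) (f := φ)
      (g := fun y => F (mollify n u y)) (v := EuclideanSpace.single k 1)
      ((hFn n).integrable_smul_left_of_hasCompactSupport (isTest_partialDeriv hφ).1
        (isTest_partialDeriv hφ).2)
      (by
        simp only [hdF]
        exact (hDn n).integrable_smul_left_of_hasCompactSupport hφ.1.continuous hφ.2)
      ((hFn n).integrable_smul_left_of_hasCompactSupport hφ.1.continuous hφ.2)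
      (fun x _ => hφ.1.differentiable (by simp) x)
      (fun x _ => (hF.differentiable one_ne_zero _).comp x ((hun n).differentiable (by simp) x))
    simp only [hdF] at ibp
    rw [ibp, neg_neg]
    rfl
  have lim1 := tendsto_integral_smul_of_setIntegral hF0 hFn (fun r => by
    refine squeeze_zero (fun n => integral_nonneg fun x => norm_nonneg _) (fun n => ?_)
      (by simpa using (tendsto_setIntegral_norm_mollify_sub hu r).const_mul C)
    rw [← integral_const_mul]
    exact integral_mono
      (((hFn n).sub hF0).integrableOn_isCompact (isCompact_closedBall _ _)).norm
      ((((hul n).sub hu).integrableOn_isCompact (isCompact_closedBall _ _)).norm.const_mul C)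
      fun x => norm_sub_le_of_fderiv_bound hF hC _ _)
    (isTest_partialDeriv (k := k) hφ).1 (isTest_partialDeriv hφ).2
  -- Split $F'(u_n)w_n-F'(u)w$ into $F'(u_n)(w_n-w)$, small because $w_n\to w$ in $L^1_{\rm loc}$,
  -- and $(F'(u_n)-F'(u))w$, which is dominated by $2C|w|$.
  have lim2 := tendsto_integral_smul_of_setIntegral hD0 hDn (fun r => by
    have hDu := fun n => locallyIntegrable_fderiv_apply (hul n) hw hF hC
    have dct : Tendsto (fun n => ∫ x in Metric.closedBall 0 r,
        ‖fderiv ℝ F (mollify n u x) (w x) - fderiv ℝ F (u x) (w x)‖) atTop (𝓝 0) := by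
      have := tendsto_integral_of_dominated_convergence
        (μ := volume.restrict (Metric.closedBall (0 : RSpace d) r)) (f := fun _ => (0 : ℝ))
        (F := fun n x => ‖fderiv ℝ F (mollify n u x) (w x) - fderiv ℝ F (u x) (w x)‖)
        (fun x => 2 * C * ‖w x‖)
        (fun n => ((hDu n).sub hD0).aestronglyMeasurable.norm.restrict)
        ((hw.integrableOn_isCompact (isCompact_closedBall _ _)).norm.const_mul _)
        (fun n => .of_forall fun x => by
          rw [norm_norm]
          have h1 := (fderiv ℝ F (mollify n u x)).le_of_opNorm_le (hC _) (w x)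
          have h2 := (fderiv ℝ F (u x)).le_of_opNorm_le (hC _) (w x)
          have h3 := norm_sub_le (fderiv ℝ F (mollify n u x) (w x)) (fderiv ℝ F (u x) (w x))
          linarith)
        (ae_restrict_of_ae ((ae_tendsto_mollify hu).mono fun x hx => by
          have h1 := (((hF.continuous_fderiv one_ne_zero).tendsto (u x)).comp hx)
          have h2 : Tendsto (fun n => fderiv ℝ F (mollify n u x) (w x)) atTop
              (𝓝 (fderiv ℝ F (u x) (w x))) :=
            ((ContinuousLinearMap.apply ℝ G (w x)).continuous.tendsto _).comp h1
          simpa using (h2.sub_const (fderiv ℝ F (u x) (w x))).norm))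
      simpa using this
    refine squeeze_zero (fun n => integral_nonneg fun x => norm_nonneg _) (fun n => ?_)
      (by simpa using ((tendsto_setIntegral_norm_mollify_sub hw r).const_mul C).add dct)
    have i1 : IntegrableOn (fun x => C * ‖mollify n w x - w x‖) (Metric.closedBall 0 r) :=
      (((hwl n).sub hw).integrableOn_isCompact (isCompact_closedBall _ _)).norm.const_mul C
    have i2 : IntegrableOn (fun x => ‖fderiv ℝ F (mollify n u x) (w x) - fderiv ℝ F (u x) (w x)‖)
        (Metric.closedBall 0 r) :=
      (((hDu n).sub hD0).integrableOn_isCompact (isCompact_closedBall _ _)).norm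
    rw [← integral_const_mul, ← integral_add i1 i2]
    refine integral_mono
      (((hDn n).sub hD0).integrableOn_isCompact (isCompact_closedBall _ _)).norm
      (i1.add i2) fun x => ?_
    have h1 := (fderiv ℝ F (mollify n u x)).le_of_opNorm_le (hC _) (mollify n w x - w x)
    rw [map_sub] at h1
    exact (norm_sub_le_norm_sub_add_norm_sub _ _ _).trans (add_le_add_left h1 _))
    hφ.1.continuous hφ.2
  exact tendsto_nhds_unique (lim1.congr step) lim2.neg

end Mollification

/-! ### The regularized direction $z/(|z|^2+\delta^2)^{1/2}$ and its derivative. -/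

section Normalization

variable {m : ℕ}

/-- The regularized norm `(|z|² + δ²)^{1/2}`. -/
def reg (δ : ℝ) (z : CSpace m) : ℝ := √(‖z‖ ^ 2 + δ ^ 2)

/-- The regularized direction `z / (|z|² + δ²)^{1/2}`. -/
def direction (δ : ℝ) (z : CSpace m) : CSpace m := (reg δ z)⁻¹ • z

/-- The real-linear functional `ζ ↦ Re ⟨z, ζ⟩`. -/
def reInner (z : CSpace m) : CSpace m →L[ℝ] ℝ :=
  Complex.reCLM.comp ((innerSL ℂ z).restrictScalars ℝ)

theorem reInner_apply (z w : CSpace m) : reInner z w = (inner ℂ z w).re := rfl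

theorem abs_reInner_le (z w : CSpace m) : |reInner z w| ≤ ‖z‖ * ‖w‖ :=
  (Complex.abs_re_le_norm _).trans (norm_inner_le_norm z w)

theorem inner_real_smul_left (r : ℝ) (z w : CSpace m) : inner ℂ (r • z) w = r * inner ℂ z w := by
  rw [← Complex.coe_smul, inner_smul_left, Complex.conj_ofReal]

theorem inner_real_smul_right (r : ℝ) (z w : CSpace m) : inner ℂ z (r • w) = r * inner ℂ z w := by
  rw [← Complex.coe_smul, inner_smul_right]

theorem re_inner_self (z : CSpace m) : (inner ℂ z z).re = ‖z‖ ^ 2 := by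
  rw [← inner_self_eq_norm_sq (𝕜 := ℂ) z]; rfl

theorem reg_sq (δ : ℝ) (z : CSpace m) : reg δ z ^ 2 = ‖z‖ ^ 2 + δ ^ 2 :=
  Real.sq_sqrt (by positivity)

variable {δ : ℝ}

theorem norm_le_reg (z : CSpace m) : ‖z‖ ≤ reg δ z :=
  Real.le_sqrt_of_sq_le (by nlinarith [sq_nonneg δ])

theorem le_reg (z : CSpace m) : δ ≤ reg δ z :=
  Real.le_sqrt_of_sq_le (by nlinarith [sq_nonneg ‖z‖])

theorem reg_pos (hδ : 0 < δ) (z : CSpace m) : 0 < reg δ z := hδ.trans_le (le_reg z)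

theorem hasFDerivAt_reg (hδ : 0 < δ) (z : CSpace m) :
    HasFDerivAt (reg δ) ((reg δ z)⁻¹ • reInner z) z := by
  have h1 : HasFDerivAt (fun z : CSpace m => ‖z‖ ^ 2) (2 • reInner z) z := by
    have h := Complex.reCLM.hasFDerivAt.comp z
      ((hasFDerivAt_id (𝕜 := ℝ) z).inner ℂ (hasFDerivAt_id z))
    have e : (fun z : CSpace m => ‖z‖ ^ 2) = Complex.reCLM ∘ fun t : CSpace m => inner ℂ (id t) (id t) := by
      ext w
      simp [← re_inner_self]
    rw [e]
    convert! h using 1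
    ext w
    simp only [ContinuousLinearMap.coe_comp, Function.comp, fderivInnerCLM_apply, nsmul_eq_mul,
      smul_apply, reInner_apply, ContinuousLinearMap.prod_apply, id]
    simp only [Complex.reCLM_apply, Complex.add_re, ContinuousLinearMap.id_apply]
    rw [← inner_conj_symm w z, Complex.conj_re]
    norm_num
    ring
  have h2 := (h1.add_const (δ ^ 2)).sqrt (by positivity)
  convert! h2 using 1
  ext w
  have := (reg_pos hδ z).ne'
  simp only [smul_apply, smul_eq_mul, nsmul_eq_mul]
  rw [show √(‖z‖ ^ 2 + δ ^ 2) = reg δ z from rfl]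
  field_simp
  norm_num

theorem contDiff_reg (hδ : 0 < δ) : ContDiff ℝ 1 (reg δ : CSpace m → ℝ) := by
  have h1 : ContDiff ℝ 1 (fun z : CSpace m => ‖z‖ ^ 2) := by
    have e : (fun z : CSpace m => ‖z‖ ^ 2) = Complex.reCLM ∘ fun t : CSpace m => inner ℂ (id t) (id t) := by
      ext w
      simp [← re_inner_self]
    rw [e]
    exact Complex.reCLM.contDiff.comp (contDiff_id.inner ℂ contDiff_id)
  exact (h1.add contDiff_const).sqrt fun z => by positivity

theorem fderiv_reg_apply (hδ : 0 < δ) (z w : CSpace m) :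
    fderiv ℝ (reg δ) z w = (reg δ z)⁻¹ * reInner z w := by
  rw [(hasFDerivAt_reg hδ z).fderiv]; rfl

theorem norm_fderiv_reg_le (hδ : 0 < δ) (z : CSpace m) : ‖fderiv ℝ (reg δ) z‖ ≤ 1 := by
  refine ContinuousLinearMap.opNorm_le_bound _ zero_le_one fun w => ?_
  rw [fderiv_reg_apply hδ, Real.norm_eq_abs, abs_mul, abs_of_pos (inv_pos.2 (reg_pos hδ z)),
    inv_mul_le_iff₀ (reg_pos hδ z), one_mul]
  exact (abs_reInner_le z w).trans (by gcongr; exact norm_le_reg z)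

theorem contDiff_direction (hδ : 0 < δ) : ContDiff ℝ 1 (direction δ : CSpace m → CSpace m) :=
  ((contDiff_reg hδ).inv fun z => (reg_pos hδ z).ne').smul contDiff_id

theorem fderiv_direction_apply (hδ : 0 < δ) (z w : CSpace m) :
    fderiv ℝ (direction δ) z w
      = (reg δ z)⁻¹ • w - ((reg δ z)⁻¹ ^ 3 * reInner z w) • z := by
  have h1 := (hasDerivAt_inv (reg_pos hδ z).ne').comp_hasFDerivAt z (hasFDerivAt_reg hδ z)
  have h2 := h1.smul (hasFDerivAt_id (𝕜 := ℝ) z)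
  have h3 : HasFDerivAt (direction δ : CSpace m → CSpace m) _ z := h2
  rw [h3.fderiv]
  simp only [add_apply, smul_apply, Function.comp,
    ContinuousLinearMap.smulRight_apply, ContinuousLinearMap.id_apply, id, smul_eq_mul]
  rw [sub_eq_add_neg, ← neg_smul]
  congr 2
  have := (reg_pos hδ z).ne'
  field_simp

theorem norm_direction_le_one (hδ : 0 < δ) (z : CSpace m) : ‖direction δ z‖ ≤ 1 := by
  rw [direction, norm_smul, norm_inv, Real.norm_of_nonneg (reg_pos hδ z).le,
    inv_mul_le_iff₀ (reg_pos hδ z), mul_one]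
  exact norm_le_reg z

theorem norm_direction_le (hδ : 0 < δ) (z : CSpace m) : ‖direction δ z‖ ≤ δ⁻¹ * ‖z‖ := by
  rw [direction, norm_smul, norm_inv, Real.norm_of_nonneg (reg_pos hδ z).le]
  gcongr
  exact le_reg z

theorem norm_fderiv_direction_le (hδ : 0 < δ) (z : CSpace m) :
    ‖fderiv ℝ (direction δ) z‖ ≤ 2 * δ⁻¹ := by
  refine ContinuousLinearMap.opNorm_le_bound _ (by positivity) fun w => ?_
  have hr := reg_pos hδ z
  rw [fderiv_direction_apply hδ]
  have hi : (reg δ z)⁻¹ ≤ δ⁻¹ := by gcongr; exact le_reg z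
  have hz : (reg δ z)⁻¹ * ‖z‖ ≤ 1 := by
    rw [inv_mul_le_iff₀ hr, mul_one]; exact norm_le_reg z
  have h1 : ‖(reg δ z)⁻¹ • w‖ ≤ δ⁻¹ * ‖w‖ := by
    rw [norm_smul, norm_inv, Real.norm_of_nonneg hr.le]; gcongr
  have h2 : ‖((reg δ z)⁻¹ ^ 3 * reInner z w) • z‖ ≤ δ⁻¹ * ‖w‖ := by
    rw [norm_smul, Real.norm_eq_abs, abs_mul, abs_of_pos (by positivity)]
    calc (reg δ z)⁻¹ ^ 3 * |reInner z w| * ‖z‖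
        ≤ (reg δ z)⁻¹ ^ 3 * (‖z‖ * ‖w‖) * ‖z‖ := by gcongr; exact abs_reInner_le z w
      _ = (reg δ z)⁻¹ * ‖w‖ * ((reg δ z)⁻¹ * ‖z‖) ^ 2 := by ring
      _ ≤ (reg δ z)⁻¹ * ‖w‖ * 1 := by
          gcongr
          exact pow_le_one₀ (by positivity) hz
      _ ≤ δ⁻¹ * ‖w‖ := by rw [mul_one]; gcongr
  calc _ ≤ _ := norm_sub_le _ _
    _ ≤ δ⁻¹ * ‖w‖ + δ⁻¹ * ‖w‖ := add_le_add h1 h2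
    _ = 2 * δ⁻¹ * ‖w‖ := by ring

/-- The vector $icz$ is tangent to the sphere through $z$. This is why the magnetic term disappears
from derivatives of functions of $|u|$. -/
theorem reInner_phase (c : ℝ) (z : CSpace m) : reInner z ((Complex.I * c) • z) = 0 := by
  rw [reInner_apply, inner_smul_right, inner_self_eq_norm_sq_to_K]
  simp [← Complex.ofReal_pow]

/-- `direction` commutes with phase rotations $z\mapsto e^{i\theta}z$. Hence it transforms the
magnetic gradient by the plain chain rule, with no extra term in the potential. -/
theorem fderiv_direction_phase (hδ : 0 < δ) (c : ℝ) (z : CSpace m) :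
    fderiv ℝ (direction δ) z ((Complex.I * c) • z) = (Complex.I * c) • direction δ z := by
  rw [fderiv_direction_apply hδ, reInner_phase, mul_zero, zero_smul, sub_zero, direction,
    smul_comm]

/-- By Cauchy–Schwarz the radial correction is at most $|z|^2|w|^2/(|z|^2+\delta^2)^{3/2}$, which
the main term $|w|^2/(|z|^2+\delta^2)^{1/2}$ absorbs. This is the pointwise core of Kato's
inequality. -/
theorem re_inner_fderiv_direction_nonneg (hδ : 0 < δ) (z w : CSpace m) :
    0 ≤ (inner ℂ (fderiv ℝ (direction δ) z w) w).re := by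
  have hr := reg_pos hδ z
  rw [fderiv_direction_apply hδ, inner_sub_left, inner_real_smul_left, inner_real_smul_left,
    Complex.sub_re, Complex.re_ofReal_mul, Complex.re_ofReal_mul, re_inner_self, ← reInner_apply]
  have h1 : (reInner z w) ^ 2 ≤ (reg δ z) ^ 2 * ‖w‖ ^ 2 := by
    rw [← mul_pow, ← sq_abs]
    gcongr
    exact (abs_reInner_le z w).trans (by gcongr; exact norm_le_reg z)
  have h2 : (reg δ z)⁻¹ ^ 3 * reInner z w * reInner z w ≤ (reg δ z)⁻¹ * ‖w‖ ^ 2 := by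
    calc (reg δ z)⁻¹ ^ 3 * reInner z w * reInner z w = (reg δ z)⁻¹ ^ 3 * (reInner z w) ^ 2 := by ring
      _ ≤ (reg δ z)⁻¹ ^ 3 * ((reg δ z) ^ 2 * ‖w‖ ^ 2) := by gcongr
      _ = (reg δ z)⁻¹ * ‖w‖ ^ 2 := by field_simp
  linarith

end Normalization

/-! ### Magnetic gradients of vector-valued functions. -/

section VectorGradient

variable {d m : ℕ} {a : RSpace d → RSpace d} {u : RSpace d → CSpace m}
  {D : Fin d → RSpace d → CSpace m}

/-- `D k` is the `k`-th component of `∇_a u` for a vector-valued function `u`. -/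
def IsVecMagGrad (a : RSpace d → RSpace d) (u : RSpace d → CSpace m)
    (D : Fin d → RSpace d → CSpace m) : Prop :=
  ∀ k, IsWeakDeriv k u fun x => D k x + (Complex.I * (a x k : ℂ)) • u x

theorem locallyIntegrable_magnetic_smul (ha : MemLpLoc a 2) (hu : MemLp u 2 volume) (k : Fin d) :
    LocallyIntegrable (fun x => (Complex.I * (a x k : ℂ)) • u x) := by
  refine MemLpLoc.locallyIntegrable (p := 1) le_rfl fun s hs hm => ?_
  have h1 : MemLp (fun x => a x k) 2 (volume.restrict s) :=
    (EuclideanSpace.proj (𝕜 := ℝ) k).comp_memLp' (ha s hs hm)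
  have h2 : MemLp (fun x => Complex.I * (a x k : ℂ)) 2 (volume.restrict s) :=
    h1.ofReal.const_mul Complex.I
  exact MemLp.smul (p := 2) (q := 2) (r := 1) (hu.restrict s) h2

theorem integral_apply_coord {f : RSpace d → CSpace m} (hf : Integrable f) (i : Fin m) :
    (∫ x, f x) i = ∫ x, f x i :=
  ((EuclideanSpace.proj (𝕜 := ℂ) i).integral_comp_comm hf).symm

theorem IsVecMagGrad.coord (ha : MemLpLoc a 2) (hu : MemLp u 2 volume)
    (hD : ∀ k, MemLp (D k) 2 volume) (h : IsVecMagGrad a u D) (i : Fin m) :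
    IsWeakMagGrad a (fun x => u x i) fun x => WithLp.toLp 2 fun k => D k x i := by
  intro k φ hφ
  have i1 := (hu.locallyIntegrable one_le_two).integrable_smul_left_of_hasCompactSupport
    (isTest_partialDeriv (k := k) hφ).1 (isTest_partialDeriv hφ).2
  have i2 := ((hD k).locallyIntegrable one_le_two).integrable_smul_left_of_hasCompactSupport
    hφ.1.continuous hφ.2
  have i3 := (locallyIntegrable_magnetic_smul ha hu k).integrable_smul_left_of_hasCompactSupport
    hφ.1.continuous hφ.2
  have e := h k φ hφ
  simp only [smul_add] at e
  rw [integral_add i2 i3] at e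
  have e' := congrArg (fun v : CSpace m => v i) e
  simp only [PiLp.neg_apply, PiLp.add_apply] at e'
  rw [integral_apply_coord i1, integral_apply_coord i2, integral_apply_coord i3] at e'
  simp only [PiLp.smul_apply, smul_eq_mul] at e' ⊢
  rw [e']
  have e3 : ∫ x, φ x • (Complex.I * (a x k : ℂ) * u x i)
      = Complex.I * ∫ x, φ x • (a x k • u x i) := by
    rw [← integral_const_mul]
    refine integral_congr_ae (.of_forall fun x => ?_)
    simp only [Complex.real_smul]
    ring
  rw [e3]
  ring

/-- The definition of the form works with components, whereas `direction` mixes them; this lemma and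
`IsVecMagGrad.coord` translate between the two descriptions. -/
theorem isVecMagGrad_of_coord (ha : MemLpLoc a 2) (hu : MemLp u 2 volume)
    {g : Fin m → RSpace d → CSpace d} (hg : ∀ i, MemLp (g i) 2 volume)
    (h : ∀ i, IsWeakMagGrad a (fun x => u x i) (g i)) :
    IsVecMagGrad a u fun k x => WithLp.toLp 2 fun i => g i x k := by
  intro k φ hφ
  have hD : MemLp (fun x => (WithLp.toLp 2 fun i => g i x k : CSpace m)) 2 volume :=
    MemLp.of_eval_piLp fun i => memLp_coord (hg i) k
  have i1 := (hu.locallyIntegrable one_le_two).integrable_smul_left_of_hasCompactSupport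
    (isTest_partialDeriv (k := k) hφ).1 (isTest_partialDeriv hφ).2
  have i2 := (hD.locallyIntegrable one_le_two).integrable_smul_left_of_hasCompactSupport
    hφ.1.continuous hφ.2
  have i3 := (locallyIntegrable_magnetic_smul ha hu k).integrable_smul_left_of_hasCompactSupport
    hφ.1.continuous hφ.2
  simp only [smul_add]
  rw [integral_add i2 i3]
  ext i
  simp only [PiLp.neg_apply, PiLp.add_apply]
  rw [integral_apply_coord i1, integral_apply_coord i2, integral_apply_coord i3]
  have e := h i k φ hφ
  simp only [PiLp.smul_apply, smul_eq_mul] at e ⊢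
  have e3 : ∫ x, φ x • (Complex.I * (a x k : ℂ) * u x i)
      = Complex.I * ∫ x, φ x • (a x k • u x i) := by
    rw [← integral_const_mul]
    refine integral_congr_ae (.of_forall fun x => ?_)
    simp only [Complex.real_smul]
    ring
  rw [e3, e]
  ring

theorem memLp_direction {δ : ℝ} (hδ : 0 < δ) (hu : MemLp u 2 volume) :
    MemLp (fun x => direction δ (u x)) 2 volume :=
  hu.of_le_mul ((contDiff_direction hδ).continuous.comp_aestronglyMeasurable hu.1)
    (.of_forall fun x => norm_direction_le hδ (u x))

theorem memLp_fderiv_direction {δ : ℝ} (hδ : 0 < δ) (hu : MemLp u 2 volume)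
    {w : RSpace d → CSpace m} (hw : MemLp w 2 volume) :
    MemLp (fun x => fderiv ℝ (direction δ) (u x) (w x)) 2 volume :=
  hw.of_le_mul (locallyIntegrable_fderiv_apply (hu.locallyIntegrable one_le_two)
    (hw.locallyIntegrable one_le_two) (contDiff_direction hδ)
    (norm_fderiv_direction_le hδ)).aestronglyMeasurable
    (.of_forall fun x => (fderiv ℝ (direction δ) (u x)).le_of_opNorm_le
      (norm_fderiv_direction_le hδ _) _)

theorem IsVecMagGrad.direction {δ : ℝ} (hδ : 0 < δ) (ha : MemLpLoc a 2) (hu : MemLp u 2 volume)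
    (hD : ∀ k, MemLp (D k) 2 volume) (h : IsVecMagGrad a u D) :
    IsVecMagGrad a (fun x => direction δ (u x))
      fun k x => fderiv ℝ (MagneticSchrodinger.direction δ) (u x) (D k x) := by
  intro k
  have := (h k).comp (hu.locallyIntegrable one_le_two)
    (((hD k).locallyIntegrable one_le_two).add (locallyIntegrable_magnetic_smul ha hu k))
    (contDiff_direction hδ) (norm_fderiv_direction_le hδ)
  simpa only [map_add, fderiv_direction_phase hδ] using this

theorem IsTest.mul {φ ψ : RSpace d → ℝ} (hφ : IsTest φ) (hψ : IsTest ψ) :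
    IsTest fun x => φ x * ψ x :=
  ⟨hφ.1.mul hψ.1, hφ.2.mul_right⟩

theorem partialDeriv_mul {φ ψ : RSpace d → ℝ} (hφ : IsTest φ) (hψ : IsTest ψ) (k : Fin d)
    (x : RSpace d) : partialDeriv k (fun x => φ x * ψ x) x
      = φ x * partialDeriv k ψ x + partialDeriv k φ x * ψ x := by
  unfold partialDeriv
  rw [fderiv_fun_mul (hφ.1.differentiable (by simp) x) (hψ.1.differentiable (by simp) x)]
  simp [mul_comm]

theorem memLp_continuous_smul {χ : RSpace d → ℝ} (hχ : Continuous χ) (hc : HasCompactSupport χ)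
    {p : ENNReal} {w : RSpace d → CSpace m} (hw : MemLp w p volume) :
    MemLp (fun x => χ x • w x) p volume := by
  obtain ⟨C, hC⟩ := hχ.bounded_above_of_compact_support hc
  refine hw.of_le_mul (c := C) (hχ.aestronglyMeasurable.smul hw.1) (.of_forall fun x => ?_)
  rw [norm_smul]
  exact mul_le_mul_of_nonneg_right (hC x) (norm_nonneg _)

theorem IsVecMagGrad.test_smul {χ : RSpace d → ℝ} (hχ : IsTest χ) (ha : MemLpLoc a 2)
    (hu : MemLp u 2 volume) (hD : ∀ k, MemLp (D k) 2 volume) (h : IsVecMagGrad a u D) :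
    IsVecMagGrad a (fun x => χ x • u x)
      fun k x => χ x • D k x + partialDeriv k χ x • u x := by
  intro k φ hφ
  have e := h k _ (hφ.mul hχ)
  simp only [partialDeriv_mul hφ hχ] at e
  have hul := hu.locallyIntegrable one_le_two
  have hwl := ((hD k).locallyIntegrable one_le_two).add (locallyIntegrable_magnetic_smul ha hu k)
  have hχ' := isTest_partialDeriv (k := k) hχ
  have hφ' := isTest_partialDeriv (k := k) hφ
  have i1 : Integrable fun x => (φ x * partialDeriv k χ x) • u x :=
    hul.integrable_smul_left_of_hasCompactSupport (hφ.1.continuous.mul hχ'.1) hφ.2.mul_right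
  have i2 : Integrable fun x => (partialDeriv k φ x * χ x) • u x :=
    hul.integrable_smul_left_of_hasCompactSupport (hφ'.1.mul hχ.1.continuous) hφ'.2.mul_right
  have i3 : Integrable fun x => (φ x * χ x) • (D k x + (Complex.I * (a x k : ℂ)) • u x) :=
    hwl.integrable_smul_left_of_hasCompactSupport (hφ.1.continuous.mul hχ.1.continuous)
      hφ.2.mul_right
  simp only [add_smul] at e
  rw [integral_add i1 i2] at e
  have e1 : ∫ x, φ x • (χ x • D k x + partialDeriv k χ x • u x
        + (Complex.I * (a x k : ℂ)) • χ x • u x)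
      = (∫ x, (φ x * χ x) • (D k x + (Complex.I * (a x k : ℂ)) • u x))
        + ∫ x, (φ x * partialDeriv k χ x) • u x := by
    rw [← integral_add i3 i1]
    refine integral_congr_ae (.of_forall fun x => ?_)
    simp only [smul_add, mul_smul, smul_comm (χ x) (Complex.I) , smul_comm (χ x) ((a x k : ℂ))]
    abel
  rw [e1]
  simp only [smul_smul] at e ⊢
  rw [neg_add, ← e]
  abel

end VectorGradient

/-! ### Measurability and integrability of $V^{1/2}u$. -/

section MatrixSqrt

open scoped MatrixOrder Matrix.Norms.L2Operator in
theorem continuousOn_sqrt_matrix (m : ℕ) :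
    ContinuousOn (CFC.sqrt : Matrix (Fin m) (Fin m) ℂ → Matrix (Fin m) (Fin m) ℂ)
      {M | 0 ≤ M} :=
  ContinuousOn.cfcₙ_nnreal_of_mem_nhdsSet (s := Set.univ) NNReal.sqrt Filter.univ_mem
    continuousOn_id (fun _ h => h) NNReal.continuous_sqrt.continuousOn NNReal.sqrt_zero

open scoped MatrixOrder Matrix.Norms.L2Operator in
theorem isClosed_nonneg_matrix (m : ℕ) :
    IsClosed {M : Matrix (Fin m) (Fin m) ℂ | 0 ≤ M} :=
  CStarAlgebra.isClosed_nonneg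

open scoped MatrixOrder in
open Classical in
-- The square root is continuous on the closed cone of nonnegative matrices and takes the default
-- value 0 off it, so it is a Borel map on all matrices.
theorem aemeasurable_sqrt_apply {d m : ℕ} {M : RSpace d → Matrix (Fin m) (Fin m) ℂ}
    (hM : ∀ i j, AEMeasurable (fun x => M x i j)) (i j : Fin m) :
    AEMeasurable (fun x => CFC.sqrt (M x) i j) := by
  let _ : MeasurableSpace (Matrix (Fin m) (Fin m) ℂ) :=
    inferInstanceAs (MeasurableSpace (Fin m → Fin m → ℂ))
  have _ : BorelSpace (Matrix (Fin m) (Fin m) ℂ) :=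
    inferInstanceAs (BorelSpace (Fin m → Fin m → ℂ))
  have h1 : AEMeasurable M :=
    aemeasurable_pi_lambda _ fun i => aemeasurable_pi_lambda _ fun j => hM i j
  have h2 : Measurable (CFC.sqrt : Matrix (Fin m) (Fin m) ℂ → Matrix (Fin m) (Fin m) ℂ) := by
    have := ContinuousOn.measurable_piecewise (g := fun _ => (0 : Matrix (Fin m) (Fin m) ℂ))
      (continuousOn_sqrt_matrix m) continuousOn_const (isClosed_nonneg_matrix m).measurableSet
    convert! this using 1
    ext1 N
    by_cases hN : 0 ≤ N
    · rw [Set.piecewise_eq_of_mem _ _ _ (by exact hN)]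
    · rw [Set.piecewise_eq_of_notMem _ _ _ (by exact hN), CFC.sqrt_of_not_nonneg hN]
  have h3 : Measurable fun N : Matrix (Fin m) (Fin m) ℂ => N i j :=
    (measurable_pi_apply j).comp (measurable_pi_apply i)
  exact (h3.comp h2).comp_aemeasurable h1

variable {d m : ℕ}

theorem act_apply (M : Matrix (Fin m) (Fin m) ℂ) (v : CSpace m) (i : Fin m) :
    act M v i = ∑ j, M i j * v j := rfl

theorem aestronglyMeasurable_act {M : RSpace d → Matrix (Fin m) (Fin m) ℂ}
    (hM : ∀ i j, AEMeasurable (fun x => M x i j)) {u : RSpace d → CSpace m}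
    (hu : AEStronglyMeasurable u) : AEStronglyMeasurable (fun x => act (M x) (u x)) := by
  have h : AEMeasurable fun x => (fun i => ∑ j, M x i j * u x j : Fin m → ℂ) := by
    refine aemeasurable_pi_lambda _ fun i => Finset.aemeasurable_fun_sum _ fun j _ => ?_
    exact (hM i j).mul
      ((EuclideanSpace.proj (𝕜 := ℂ) j).continuous.comp_aestronglyMeasurable hu).aemeasurable
  exact (PiLp.continuous_toLp 2 _).comp_aestronglyMeasurable h.aestronglyMeasurable

theorem Potentials.aemeasurable_V (S : Potentials d m) (i j : Fin m) :
    AEMeasurable (fun x => S.V x i j) :=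
  ((S.V_loc i j).locallyIntegrable le_rfl).aestronglyMeasurable.aemeasurable

theorem Potentials.aemeasurable_complexify (S : Potentials d m) (i j : Fin m) :
    AEMeasurable (fun x => complexify (S.V x) i j) :=
  Complex.measurable_ofReal.comp_aemeasurable (S.aemeasurable_V i j)

theorem Potentials.aestronglyMeasurable_act_V (S : Potentials d m) {u : RSpace d → CSpace m}
    (hu : AEStronglyMeasurable u) : AEStronglyMeasurable (fun x => act (complexify (S.V x)) (u x)) :=
  aestronglyMeasurable_act S.aemeasurable_complexify hu

theorem Potentials.aestronglyMeasurable_act_sqrt (S : Potentials d m) {u : RSpace d → CSpace m}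
    (hu : AEStronglyMeasurable u) : AEStronglyMeasurable (fun x => act (matrixSqrt (S.V x)) (u x)) :=
  aestronglyMeasurable_act (fun i j => aemeasurable_sqrt_apply S.aemeasurable_complexify i j) hu

theorem norm_act_complexify_le (M : Matrix (Fin m) (Fin m) ℝ) (v : CSpace m) :
    ‖act (complexify M) v‖ ≤ (∑ i, ∑ j, |M i j|) * ‖v‖ := by
  have h : ‖act (complexify M) v‖ ≤ ∑ i, ‖act (complexify M) v i‖ := by
    rw [EuclideanSpace.norm_eq]
    refine Real.sqrt_le_iff.2 ⟨by positivity, ?_⟩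
    exact Finset.sum_sq_le_sq_sum_of_nonneg fun i _ => norm_nonneg _
  refine h.trans ?_
  rw [Finset.sum_mul]
  refine Finset.sum_le_sum fun i _ => ?_
  rw [act_apply, Finset.sum_mul]
  refine (norm_sum_le _ _).trans (Finset.sum_le_sum fun j _ => ?_)
  rw [norm_mul]
  refine mul_le_mul (by simp [complexify]) (PiLp.norm_apply_le v j) (norm_nonneg _) (abs_nonneg _)

theorem Potentials.norm_act_sqrt_sq (S : Potentials d m) :
    ∀ᵐ x, ∀ v : CSpace m, ‖act (matrixSqrt (S.V x)) v‖ ^ 2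
      = (inner ℂ v (act (complexify (S.V x)) v)).re := by
  filter_upwards [S.V_symm, S.V_nonneg] with x h1 h2 v
  rw [inner_complexify h1 h2, re_inner_self]

/-- Here $|V^{1/2}v|^2=\langle Vv,v\rangle\le C^2\sum|V_{ij}|$, which is integrable on the compact
support. Bounded compactly supported functions thus meet the potential condition of the form domain
although $V$ is only in $L^1_{\rm loc}$. -/
theorem Potentials.memLp_act_sqrt_of_bounded (S : Potentials d m) {v : RSpace d → CSpace m}
    (hv : AEStronglyMeasurable v) {C : ℝ} (hC : ∀ x, ‖v x‖ ≤ C) (hc : HasCompactSupport v) :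
    MemLp (fun x => act (matrixSqrt (S.V x)) (v x)) 2 volume := by
  rw [memLp_two_iff_integrable_sq_norm (S.aestronglyMeasurable_act_sqrt hv)]
  have hC0 : 0 ≤ C := (norm_nonneg _).trans (hC 0)
  have hloc : IntegrableOn (fun x => C ^ 2 * ∑ i, ∑ j, |S.V x i j|) (tsupport v) := by
    refine Integrable.const_mul (integrable_finsetSum _ fun i _ => integrable_finsetSum _
      fun j _ => ?_) _
    exact (((S.V_loc i j).locallyIntegrable le_rfl).integrableOn_isCompact hc).norm
  have hint := hloc.integrable_indicator hc.isCompact.measurableSet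
  refine hint.mono' ((S.aestronglyMeasurable_act_sqrt hv).norm.pow 2) ?_
  filter_upwards [S.norm_act_sqrt_sq] with x hx
  rw [hx (v x)]
  by_cases hxs : x ∈ tsupport v
  · rw [Set.indicator_of_mem hxs]
    calc _ ≤ ‖v x‖ * ‖act (complexify (S.V x)) (v x)‖ :=
          (Complex.abs_re_le_norm _).trans (norm_inner_le_norm _ _)
      _ ≤ ‖v x‖ * ((∑ i, ∑ j, |S.V x i j|) * ‖v x‖) := by
          gcongr; exact norm_act_complexify_le _ _
      _ = ‖v x‖ ^ 2 * (∑ i, ∑ j, |S.V x i j|) := by ring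
      _ ≤ _ := by gcongr; exact hC x
  · rw [Set.indicator_of_notMem hxs, image_eq_zero_of_notMem_tsupport hxs]
    simp

end MatrixSqrt

/-! ### The form in terms of vector-valued gradients. -/

section Form

variable {d m : ℕ}

theorem Potentials.MemForm.isVecMagGrad {S : Potentials d m} {u : LTwo d m} (hu : S.MemForm u) :
    IsVecMagGrad S.a u fun k x => WithLp.toLp 2 fun i => magGrad S.a (fun y => u y i) x k :=
  isVecMagGrad_of_coord S.a_loc (Lp.memLp u) (fun i => (hu.1 i).spec.1) fun i => (hu.1 i).spec.2

theorem Potentials.MemForm.memLp_grad {S : Potentials d m} {u : LTwo d m} (hu : S.MemForm u)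
    (k : Fin d) :
    MemLp (fun x => (WithLp.toLp 2 fun i => magGrad S.a (fun y => u y i) x k : CSpace m)) 2 volume :=
  MemLp.of_eval_piLp fun i => memLp_coord (hu.1 i).spec.1 k

theorem memLp_transpose {D : Fin d → RSpace d → CSpace m} (hD : ∀ k, MemLp (D k) 2 volume)
    (i : Fin m) : MemLp (fun x => (WithLp.toLp 2 fun k => D k x i : CSpace d)) 2 volume :=
  MemLp.of_eval_piLp fun k => memLp_coord (hD k) i

theorem Potentials.memForm_of_isVecMagGrad (S : Potentials d m) {u : LTwo d m}
    {D : Fin d → RSpace d → CSpace m} (hD : ∀ k, MemLp (D k) 2 volume)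
    (h : IsVecMagGrad S.a u D) (hV : MemLp (fun x => act (matrixSqrt (S.V x)) (u x)) 2 volume) :
    S.MemForm u :=
  ⟨fun i => ⟨_, memLp_transpose hD i, h.coord S.a_loc (Lp.memLp u) hD i⟩, hV⟩

theorem IsVecMagGrad.congr {a : RSpace d → RSpace d} {u v : RSpace d → CSpace m}
    {D : Fin d → RSpace d → CSpace m} (huv : u =ᵐ[volume] v) (h : IsVecMagGrad a u D) :
    IsVecMagGrad a v D := by
  intro k φ hφ
  have e := h k φ hφ
  have e1 : ∫ x, partialDeriv k φ x • v x = ∫ x, partialDeriv k φ x • u x :=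
    integral_congr_ae (huv.mono fun x hx => by simp only [hx])
  have e2 : ∫ x, φ x • (D k x + (Complex.I * (a x k : ℂ)) • v x)
      = ∫ x, φ x • (D k x + (Complex.I * (a x k : ℂ)) • u x) :=
    integral_congr_ae (huv.mono fun x hx => by simp only [hx])
  rw [e1, e2, e]

theorem integrable_inner_scalar {f g : RSpace d → ℂ} (hf : MemLp f 2 volume)
    (hg : MemLp g 2 volume) : Integrable (fun x => inner ℂ (f x) (g x)) := by
  refine (L2.integrable_inner (𝕜 := ℂ) (hf.toLp f) (hg.toLp g)).congr ?_
  filter_upwards [hf.coeFn_toLp, hg.coeFn_toLp] with x h1 h2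
  rw [h1, h2]

/-- Weak gradients in $L^2$ are unique up to null sets, so any representatives may replace the
chosen `magGrad`; the double sum is then reordered. -/
theorem Potentials.form_eq (S : Potentials d m) {u v : LTwo d m}
    {D D' : Fin d → RSpace d → CSpace m} (hD : ∀ k, MemLp (D k) 2 volume)
    (hD' : ∀ k, MemLp (D' k) 2 volume) (h : IsVecMagGrad S.a u D) (h' : IsVecMagGrad S.a v D') :
    S.form u v = (∑ k, ∫ x, inner ℂ (D' k x) (D k x))
      + ∫ x, inner ℂ (v x) (act (complexify (S.V x)) (u x)) := by
  unfold Potentials.form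
  congr 1
  have e : ∀ i : Fin m, ∫ x, inner ℂ (magGrad S.a (fun y => v y i) x)
      (magGrad S.a (fun y => u y i) x) = ∑ k, ∫ x, inner ℂ (D' k x i) (D k x i) := by
    intro i
    have m1 := memLp_transpose hD i
    have m2 := memLp_transpose hD' i
    have e1 := (h.coord S.a_loc (Lp.memLp u) hD i).magGrad_ae_eq m1
    have e2 := (h'.coord S.a_loc (Lp.memLp v) hD' i).magGrad_ae_eq m2
    rw [← integral_finsetSum _ fun k _ => ?_]
    · refine integral_congr_ae ?_
      filter_upwards [e1, e2] with x h1 h2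
      rw [h1, h2, PiLp.inner_apply]
    · exact integrable_inner_scalar (memLp_coord (hD' k) i) (memLp_coord (hD k) i)
  rw [Finset.sum_congr rfl fun i _ => e i, Finset.sum_comm]
  refine Finset.sum_congr rfl fun k _ => ?_
  rw [← integral_finsetSum _ fun i _ =>
    integrable_inner_scalar (memLp_coord (hD' k) i) (memLp_coord (hD k) i)]
  exact integral_congr_ae (.of_forall fun x => (PiLp.inner_apply _ _).symm)

end Form

/-! ### Smooth cutoffs with gradients of order $1/n$. -/

section Cutoff

open Filter Topology

variable {d : ℕ}

/-- A smooth function that is `1` on the unit ball and vanishes off the ball of radius `2`. -/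
def bump (d : ℕ) : ContDiffBump (0 : RSpace d) where
  rIn := 1
  rOut := 2
  rIn_pos := one_pos
  rIn_lt_rOut := one_lt_two

/-- Dilation of a function by the factor `n + 1`. -/
def dilate (n : ℕ) (f : RSpace d → ℝ) (x : RSpace d) : ℝ := f (((n : ℝ) + 1)⁻¹ • x)

/-- The cutoff functions. -/
def cutoff (d n : ℕ) : RSpace d → ℝ := dilate n (bump d)

theorem isTest_dilate (n : ℕ) {f : RSpace d → ℝ} (hf : IsTest f) : IsTest (dilate n f) := by
  have hn : ((n : ℝ) + 1)⁻¹ ≠ 0 := by positivity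
  exact ⟨hf.1.comp (contDiff_const_smul _), hf.2.comp_homeomorph (Homeomorph.smulOfNeZero _ hn)⟩

theorem partialDeriv_dilate (n : ℕ) {f : RSpace d → ℝ} (hf : IsTest f) (k : Fin d) (x : RSpace d) :
    partialDeriv k (dilate n f) x = ((n : ℝ) + 1)⁻¹ * dilate n (partialDeriv k f) x := by
  have h1 : HasFDerivAt (dilate n f) _ x :=
    ((hf.1.differentiable (by simp)) (((n : ℝ) + 1)⁻¹ • x)).hasFDerivAt.comp x
      ((hasFDerivAt_id x).const_smul (((n : ℝ) + 1)⁻¹))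
  unfold partialDeriv
  rw [h1.fderiv]
  simp [dilate]

theorem isTest_bump : IsTest (bump d) := ⟨(bump d).contDiff, (bump d).hasCompactSupport⟩

theorem isTest_cutoff (n : ℕ) : IsTest (cutoff d n) := isTest_dilate n isTest_bump

theorem cutoff_nonneg (n : ℕ) (x : RSpace d) : 0 ≤ cutoff d n x := (bump d).nonneg

theorem cutoff_le_one (n : ℕ) (x : RSpace d) : cutoff d n x ≤ 1 := (bump d).le_one

theorem tendsto_inv_smul (x : RSpace d) :
    Tendsto (fun n : ℕ => ((n : ℝ) + 1)⁻¹ • x) atTop (𝓝 0) := by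
  have := (tendsto_one_div_add_atTop_nhds_zero_nat (𝕜 := ℝ)).smul_const x
  simpa using this

theorem tendsto_cutoff (x : RSpace d) : Tendsto (fun n => cutoff d n x) atTop (𝓝 1) := by
  have := ((bump d).contDiff (n := 0)).continuous.tendsto 0 |>.comp (tendsto_inv_smul x)
  rwa [(bump d).one_of_mem_closedBall (by simp [bump])] at this

theorem exists_partialDeriv_cutoff_bound (d : ℕ) :
    ∃ M : ℝ, 0 ≤ M ∧ ∀ n k (x : RSpace d), |partialDeriv k (cutoff d n) x| ≤ M * ((n : ℝ) + 1)⁻¹ := by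
  have h : ∀ k : Fin d, ∃ M : ℝ, ∀ x, |partialDeriv k (bump d) x| ≤ M := fun k =>
    (isTest_partialDeriv (k := k) isTest_bump).1.bounded_above_of_compact_support
      (isTest_partialDeriv isTest_bump).2
  choose M hM using h
  have hM0 : ∀ k, 0 ≤ M k := fun k => (abs_nonneg _).trans (hM k 0)
  refine ⟨∑ k, M k, Finset.sum_nonneg fun k _ => hM0 k, fun n k x => ?_⟩
  rw [cutoff, partialDeriv_dilate n isTest_bump, abs_mul, abs_of_pos (by positivity), mul_comm]
  gcongr
  exact (hM k _).trans (Finset.single_le_sum (fun k _ => hM0 k) (Finset.mem_univ k))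

end Cutoff

/-! ### Kato's inequality in integrated form. -/

section Energy

open Filter Topology

variable {d m : ℕ} (S : Potentials d m) {u : RSpace d → CSpace m} {D : Fin d → RSpace d → CSpace m}

/-- `-∇_a² u = p` when tested with functions in the form domain of `S`. -/
def Potentials.Solves (D : Fin d → RSpace d → CSpace m) (p : RSpace d → CSpace m) : Prop :=
  ∀ (v : LTwo d m) (D' : Fin d → RSpace d → CSpace m), (∀ k, MemLp (D' k) 2 volume) →
    IsVecMagGrad S.a v D' → S.MemForm v →
    Integrable (fun x => inner ℂ (v x) (p x)) ∧
      ∑ k, ∫ x, inner ℂ (D' k x) (D k x) = ∫ x, inner ℂ (v x) (p x)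

variable {S}

/-- The test function $\chi u/(|u|^2+\delta^2)^{1/2}$ is bounded with compact support, hence lies in
the form domain of `S` even when $u$ itself does not. -/
theorem Potentials.Solves.test_direction {p : RSpace d → CSpace m} (hp : S.Solves D p)
    (hu : MemLp u 2 volume) (hD : ∀ k, MemLp (D k) 2 volume) (h : IsVecMagGrad S.a u D)
    {χ : RSpace d → ℝ} (hχ : IsTest χ) {δ : ℝ} (hδ : 0 < δ) :
    Integrable (fun x => inner ℂ (χ x • direction δ (u x)) (p x)) ∧
      ∑ k, ∫ x, inner ℂ (χ x • fderiv ℝ (direction δ) (u x) (D k x)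
          + partialDeriv k χ x • direction δ (u x)) (D k x)
        = ∫ x, inner ℂ (χ x • direction δ (u x)) (p x) := by
  have hF := memLp_direction hδ hu
  have hDF := fun k => memLp_fderiv_direction hδ hu (hD k)
  have hv := memLp_continuous_smul hχ.1.continuous hχ.2 hF
  have hD' : ∀ k, MemLp (fun x => χ x • fderiv ℝ (direction δ) (u x) (D k x)
      + partialDeriv k χ x • direction δ (u x)) 2 volume := fun k =>
    (memLp_continuous_smul hχ.1.continuous hχ.2 (hDF k)).add
      (memLp_continuous_smul (isTest_partialDeriv hχ).1 (isTest_partialDeriv hχ).2 hF)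
  have hgrad := ((h.direction hδ S.a_loc hu hD).test_smul hχ S.a_loc hF hDF).congr
    hv.coeFn_toLp.symm
  have hVm : MemLp (fun x => act (matrixSqrt (S.V x)) (χ x • direction δ (u x))) 2 volume := by
    obtain ⟨C, hC⟩ := hχ.1.continuous.bounded_above_of_compact_support hχ.2
    refine S.memLp_act_sqrt_of_bounded hv.1 (C := C) (fun x => ?_) hχ.2.smul_right
    rw [norm_smul]
    exact (mul_le_mul (hC x) (norm_direction_le_one hδ _) (norm_nonneg _)
      ((norm_nonneg _).trans (hC x))).trans_eq (mul_one _)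
  have hmem : S.MemForm (hv.toLp _) := by
    refine S.memForm_of_isVecMagGrad hD' hgrad (hVm.ae_eq ?_)
    filter_upwards [hv.coeFn_toLp] with x hx
    rw [hx]
  have key := hp _ _ hD' hgrad hmem
  have e : (fun x => inner ℂ ((hv.toLp _ : LTwo d m) x) (p x))
      =ᵐ[volume] fun x => inner ℂ (χ x • direction δ (u x)) (p x) := by
    filter_upwards [hv.coeFn_toLp] with x hx
    rw [hx]
  exact ⟨key.1.congr e, key.2.trans (integral_congr_ae e)⟩

/-- The right-hand side $p$ need not be integrable: it is split into an integrable source $p_0$ and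
an absorption controlled from below by $b$. The gradient term has a good sign, and only the
derivative of the cutoff contributes an error. -/
theorem Potentials.Solves.lintegral_reg_cutoff_le {p p₀ : RSpace d → CSpace m}
    (hp : S.Solves D p) (hu : MemLp u 2 volume) (hD : ∀ k, MemLp (D k) 2 volume)
    (h : IsVecMagGrad S.a u D) (hp₀ : Integrable p₀) {b : RSpace d → ℝ}
    (hb0 : ∀ᵐ x, 0 ≤ b x) (hb : ∀ᵐ x, (inner ℂ (u x) (p x)).re + b x ≤ ‖p₀ x‖ * ‖u x‖)
    {χ : RSpace d → ℝ} (hχ : IsTest χ) (hχ0 : ∀ x, 0 ≤ χ x) (hχ1 : ∀ x, χ x ≤ 1)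
    {ε : ℝ} (hε : ∀ k x, |partialDeriv k χ x| ≤ ε) {δ : ℝ} (hδ : 0 < δ) :
    ∫⁻ x, ENNReal.ofReal (χ x * (b x / reg δ (u x)))
      ≤ ENNReal.ofReal ((∫ x, ‖p₀ x‖) + ε * ∑ k, ∫ x, ‖direction δ (u x)‖ * ‖D k x‖) := by
  obtain ⟨hint, heq⟩ := hp.test_direction hu hD h hχ hδ
  have hF := memLp_direction hδ hu
  have hDF := fun k => memLp_fderiv_direction hδ hu (hD k)
  have hcross : ∀ k, Integrable (fun x => ‖direction δ (u x)‖ * ‖D k x‖) := fun k =>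
    hF.norm.integrable_mul (hD k).norm
  have hlow : -(ε * ∑ k, ∫ x, ‖direction δ (u x)‖ * ‖D k x‖)
      ≤ (∫ x, inner ℂ (χ x • direction δ (u x)) (p x)).re := by
    rw [← heq, Complex.re_sum, Finset.mul_sum, ← Finset.sum_neg_distrib]
    refine Finset.sum_le_sum fun k _ => ?_
    have hi : Integrable (fun x => inner ℂ (χ x • fderiv ℝ (direction δ) (u x) (D k x)
          + partialDeriv k χ x • direction δ (u x)) (D k x)) :=
      integrable_inner_of_memLp ((memLp_continuous_smul hχ.1.continuous hχ.2 (hDF k)).add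
        (memLp_continuous_smul (isTest_partialDeriv hχ).1 (isTest_partialDeriv hχ).2 hF)) (hD k)
    rw [← integral_const_mul, ← integral_neg]
    refine le_trans ?_ (integral_re hi).le
    refine integral_mono ((hcross k).const_mul ε).neg hi.re fun x => ?_
    have h1 := re_inner_fderiv_direction_nonneg hδ (u x) (D k x)
    have h2 : |(inner ℂ (direction δ (u x)) (D k x)).re| ≤ ‖direction δ (u x)‖ * ‖D k x‖ :=
      abs_reInner_le _ _
    have h3 : |partialDeriv k χ x * (inner ℂ (direction δ (u x)) (D k x)).re|
        ≤ ε * (‖direction δ (u x)‖ * ‖D k x‖) := by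
      rw [abs_mul]
      exact mul_le_mul (hε k x) h2 (abs_nonneg _) ((abs_nonneg _).trans (hε k x))
    have h4 := mul_nonneg (hχ0 x) h1
    have h5 := (abs_le.1 h3).1
    simp only [RCLike.re_to_complex, inner_add_left, inner_real_smul_left, Complex.add_re,
      Complex.re_ofReal_mul]
    linarith
  have hχp : Integrable (fun x => χ x * ‖p₀ x‖) := by
    refine hp₀.norm.mono' (hχ.1.continuous.aestronglyMeasurable.mul hp₀.1.norm)
      (.of_forall fun x => ?_)
    rw [norm_mul, norm_norm, Real.norm_of_nonneg (hχ0 x)]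
    exact mul_le_of_le_one_left (norm_nonneg _) (hχ1 x)
  have hχp' : ∫ x, χ x * ‖p₀ x‖ ≤ ∫ x, ‖p₀ x‖ :=
    integral_mono hχp hp₀.norm fun x => mul_le_of_le_one_left (norm_nonneg _) (hχ1 x)
  have hdiff : Integrable
      (fun x => χ x * ‖p₀ x‖ - (inner ℂ (χ x • direction δ (u x)) (p x)).re) := hχp.sub hint.re
  -- Divide the hypothesis on $b$ by `reg δ (u x)`, which is at least $|u(x)|$, and multiply by
  -- $\chi$.
  have hpt : ∀ᵐ x, χ x * (b x / reg δ (u x))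
      ≤ χ x * ‖p₀ x‖ - (inner ℂ (χ x • direction δ (u x)) (p x)).re := by
    filter_upwards [hb] with x hx
    have hr := reg_pos hδ (u x)
    rw [inner_real_smul_left, Complex.re_ofReal_mul, ← mul_sub]
    refine mul_le_mul_of_nonneg_left ?_ (hχ0 x)
    rw [direction, inner_real_smul_left, Complex.re_ofReal_mul, div_le_iff₀ hr, sub_mul,
      mul_comm (reg δ (u x))⁻¹, inv_mul_cancel_right₀ hr.ne']
    have := mul_le_mul_of_nonneg_left (norm_le_reg (δ := δ) (u x)) (norm_nonneg (p₀ x))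
    linarith
  have hI : ∫ x, (χ x * ‖p₀ x‖ - (inner ℂ (χ x • direction δ (u x)) (p x)).re)
      = (∫ x, χ x * ‖p₀ x‖) - (∫ x, inner ℂ (χ x • direction δ (u x)) (p x)).re := by
    exact (integral_sub hχp hint.re).trans (congrArg _ (integral_re hint))
  have hnn : ∀ᵐ x, 0 ≤ χ x * ‖p₀ x‖ - (inner ℂ (χ x • direction δ (u x)) (p x)).re := by
    filter_upwards [hpt, hb0] with x h1 h2
    exact (mul_nonneg (hχ0 x) (div_nonneg h2 (reg_pos hδ _).le)).trans h1
  refine (lintegral_mono_ae (hpt.mono fun x hx => ENNReal.ofReal_le_ofReal hx)).trans ?_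
  rw [← ofReal_integral_eq_lintegral_ofReal hdiff hnn, hI]
  exact ENNReal.ofReal_le_ofReal (by linarith)

/-- For fixed $\delta$ both the regularized direction and the gradient are in $L^2$, so the error is
a fixed constant times the cutoff gradient bound, which tends to 0. Fatou's lemma treats the left
side. -/
theorem Potentials.Solves.lintegral_reg_le {p p₀ : RSpace d → CSpace m}
    (hp : S.Solves D p) (hu : MemLp u 2 volume) (hD : ∀ k, MemLp (D k) 2 volume)
    (h : IsVecMagGrad S.a u D) (hp₀ : Integrable p₀) {b : RSpace d → ℝ} (hbm : AEMeasurable b)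
    (hb0 : ∀ᵐ x, 0 ≤ b x) (hb : ∀ᵐ x, (inner ℂ (u x) (p x)).re + b x ≤ ‖p₀ x‖ * ‖u x‖)
    {δ : ℝ} (hδ : 0 < δ) :
    ∫⁻ x, ENNReal.ofReal (b x / reg δ (u x)) ≤ ENNReal.ofReal (∫ x, ‖p₀ x‖) := by
  obtain ⟨M, hM0, hM⟩ := exists_partialDeriv_cutoff_bound d
  set Q := ∑ k, ∫ x, ‖direction δ (u x)‖ * ‖D k x‖
  have h1 := fun n => hp.lintegral_reg_cutoff_le hu hD h hp₀ hb0 hb (isTest_cutoff n)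
    (cutoff_nonneg n) (cutoff_le_one n) (hM n) hδ
  have hregm : AEMeasurable (fun x => reg δ (u x)) :=
    ((contDiff_reg hδ).continuous.comp_aestronglyMeasurable hu.1).aemeasurable
  have h2 : ∫⁻ x, ENNReal.ofReal (b x / reg δ (u x))
      ≤ liminf (fun n => ∫⁻ x, ENNReal.ofReal (cutoff d n x * (b x / reg δ (u x)))) atTop := by
    refine le_trans (lintegral_mono fun x => ?_) (lintegral_liminf_le' fun n =>
      ((isTest_cutoff n).1.continuous.measurable.aemeasurable.mul
        (hbm.div hregm)).ennreal_ofReal)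
    have := ((tendsto_cutoff x).mul_const (b x / reg δ (u x)))
    rw [one_mul] at this
    exact ((ENNReal.continuous_ofReal.tendsto _).comp this).liminf_eq.ge
  refine h2.trans ((liminf_le_liminf (.of_forall h1)).trans_eq (Tendsto.liminf_eq ?_))
  refine (ENNReal.continuous_ofReal.tendsto _).comp ?_
  have h3 := ((tendsto_one_div_add_atTop_nhds_zero_nat (𝕜 := ℝ)).const_mul M).mul_const Q
  simpa using h3.const_add (∫ x, ‖p₀ x‖)

theorem tendsto_div_reg {b : ℝ} {z : CSpace m} (hz : z ≠ 0) :
    Tendsto (fun n : ℕ => b / reg (1 / ((n : ℝ) + 1)) z) atTop (𝓝 (b / ‖z‖)) := by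
  refine Tendsto.div tendsto_const_nhds ?_ (norm_ne_zero_iff.2 hz)
  have h1 := (tendsto_one_div_add_atTop_nhds_zero_nat (𝕜 := ℝ)).pow 2
  have h2 := (Real.continuous_sqrt.tendsto _).comp (h1.const_add (‖z‖ ^ 2))
  simpa [reg, Function.comp_def, Real.sqrt_sq (norm_nonneg z)] using h2

/-- The `L¹` estimate behind Kato's inequality. -/
theorem Potentials.Solves.lintegral_le {p p₀ : RSpace d → CSpace m}
    (hp : S.Solves D p) (hu : MemLp u 2 volume) (hD : ∀ k, MemLp (D k) 2 volume)
    (h : IsVecMagGrad S.a u D) (hp₀ : AEStronglyMeasurable p₀) {b : RSpace d → ℝ}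
    (hbm : AEMeasurable b)
    (hb0 : ∀ᵐ x, 0 ≤ b x) (hb : ∀ᵐ x, (inner ℂ (u x) (p x)).re + b x ≤ ‖p₀ x‖ * ‖u x‖) :
    ∫⁻ x, ENNReal.ofReal (b x / ‖u x‖) ≤ ∫⁻ x, ‖p₀ x‖ₑ := by
  by_cases hfin : ∫⁻ x, ‖p₀ x‖ₑ = ⊤
  · rw [hfin]; exact le_top
  have hint : Integrable p₀ := ⟨hp₀, Ne.lt_top hfin⟩
  rw [← ofReal_integral_norm_eq_lintegral_enorm hint]
  have h1 := fun n : ℕ => hp.lintegral_reg_le hu hD h hint hbm hb0 hb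
    (δ := 1 / ((n : ℝ) + 1)) (by positivity)
  refine le_trans (le_trans (lintegral_mono fun x => ?_)
    (lintegral_liminf_le' (f := fun (n : ℕ) x => ENNReal.ofReal (b x / reg (1 / ((n : ℝ) + 1)) (u x)))
      fun n => ?_)) ((liminf_le_liminf (f := atTop) (.of_forall h1)).trans_eq (liminf_const _))
  -- On the zero set of $u$ the limiting quotient is 0 because division by zero returns 0, so
  -- nothing is claimed there.
  · by_cases hx : u x = 0
    · simp [hx]
    · exact ((ENNReal.continuous_ofReal.tendsto _).comp (tendsto_div_reg hx)).liminf_eq.ge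
  · exact (hbm.div ((contDiff_reg (by positivity)).continuous.comp_aestronglyMeasurable
      hu.1).aemeasurable).ennreal_ofReal

end Energy

/-! ### Eigenvalue bounds for the matrix potential. -/

section Eigenvalues

variable {m : ℕ}

theorem act_complexify_sub_smul (M : Matrix (Fin m) (Fin m) ℝ) (c : ℝ) (v : CSpace m) :
    act (complexify (M - algebraMap ℝ _ c)) v = act (complexify M) v - c • v := by
  ext i
  simp only [act_apply, PiLp.sub_apply, PiLp.smul_apply, complexify, Matrix.map_apply,
    Matrix.sub_apply, Matrix.algebraMap_matrix_apply, Complex.ofReal_sub, sub_mul,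
    Finset.sum_sub_distrib]
  simp [apply_ite Complex.ofReal]

theorem re_inner_act_complexify_nonneg {M : Matrix (Fin m) (Fin m) ℝ} (hs : M.IsSymm)
    (h0 : 0 ≤ minEigenvalue M) (v : CSpace m) : 0 ≤ (inner ℂ v (act (complexify M) v)).re := by
  rw [inner_complexify hs h0, re_inner_self]
  positivity

theorem isSymm_algebraMap (c : ℝ) : (algebraMap ℝ (Matrix (Fin m) (Fin m) ℝ) c).IsSymm := by
  rw [Matrix.algebraMap_eq_diagonal]
  exact Matrix.isSymm_diagonal _

theorem finite_spectrum (M : Matrix (Fin m) (Fin m) ℝ) : (spectrum ℝ M).Finite :=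
  Module.End.finite_spectrum M.toLin' |>.subset (by rw [Matrix.spectrum_toLin'])

/-- Shifting $M$ by its smallest eigenvalue leaves a matrix with nonnegative spectrum, to which
positivity of the quadratic form applies. -/
theorem minEigenvalue_mul_sq_le {M : Matrix (Fin m) (Fin m) ℝ} (hs : M.IsSymm) (v : CSpace m) :
    minEigenvalue M * ‖v‖ ^ 2 ≤ (inner ℂ v (act (complexify M) v)).re := by
  have h0 : 0 ≤ minEigenvalue (M - algebraMap ℝ _ (minEigenvalue M)) := by
    refine Real.sInf_nonneg fun r hr => ?_
    rw [← spectrum.sub_singleton_eq] at hr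
    obtain ⟨s, hs', t, rfl, rfl⟩ := hr
    exact sub_nonneg.2 (csInf_le (finite_spectrum M).bddBelow hs')
  have h := re_inner_act_complexify_nonneg (hs.sub (isSymm_algebraMap _)) h0 v
  rw [act_complexify_sub_smul, inner_sub_right, inner_real_smul_right, Complex.sub_re,
    Complex.re_ofReal_mul, re_inner_self] at h
  linarith

theorem re_inner_le_maxEigenvalue {M : Matrix (Fin m) (Fin m) ℝ} (hs : M.IsSymm) (v : CSpace m) :
    (inner ℂ v (act (complexify M) v)).re ≤ maxEigenvalue M * ‖v‖ ^ 2 := by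
  -- The same shift argument, applied to the matrix $\Lambda_M-M$.
  have h0 : 0 ≤ minEigenvalue (-M - algebraMap ℝ _ (-maxEigenvalue M)) := by
    refine Real.sInf_nonneg fun r hr => ?_
    rw [← spectrum.sub_singleton_eq] at hr
    obtain ⟨s, hs', t, rfl, rfl⟩ := hr
    rw [← spectrum.neg_eq, Set.mem_neg] at hs'
    have := le_csSup (finite_spectrum M).bddAbove hs'
    change -s ≤ maxEigenvalue M at this
    change 0 ≤ s - -maxEigenvalue M
    linarith
  have h := re_inner_act_complexify_nonneg (hs.neg.sub (isSymm_algebraMap _)) h0 v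
  have hneg : act (complexify (-M)) v = -act (complexify M) v := by
    ext i
    simp [act_apply, complexify]
  rw [act_complexify_sub_smul, hneg, inner_sub_right, inner_real_smul_right, Complex.sub_re,
    Complex.re_ofReal_mul, re_inner_self, inner_neg_right, Complex.neg_re] at h
  linarith

open scoped MatrixOrder in
-- With $w=M^{1/2}v$, one has $|Mv|^2=\langle Mw,w\rangle\le\Lambda|w|^2=\Lambda\langle
-- Mv,v\rangle\le\Lambda^2|v|^2$.
theorem norm_act_complexify_le_maxEigenvalue {M : Matrix (Fin m) (Fin m) ℝ} (hs : M.IsSymm)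
    (h0 : 0 ≤ minEigenvalue M) (h1 : 0 ≤ maxEigenvalue M) (v : CSpace m) :
    ‖act (complexify M) v‖ ≤ maxEigenvalue M * ‖v‖ := by
  set w := act (matrixSqrt M) v
  have e1 : ‖w‖ ^ 2 = (inner ℂ v (act (complexify M) v)).re := by
    rw [inner_complexify hs h0, re_inner_self]
  have e2 : ‖act (complexify M) v‖ ^ 2 = (inner ℂ w (act (complexify M) w)).re := by
    have hsq : act (matrixSqrt M) w = act (complexify M) v := by
      have hp : 0 ≤ complexify M :=
        Matrix.nonneg_iff_posSemidef.2 (complexify_posSemidef hs h0)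
      have : matrixSqrt M * matrixSqrt M = complexify M :=
        CFC.sqrt_mul_sqrt_self _ hp
      rw [← this, act_mul]
    rw [inner_complexify hs h0, re_inner_self, hsq]
  have h2 := re_inner_le_maxEigenvalue hs v
  have h3 := re_inner_le_maxEigenvalue hs w
  refine abs_le_of_sq_le_sq' ?_ (by positivity) |>.2
  rw [e2]
  calc _ ≤ maxEigenvalue M * ‖w‖ ^ 2 := h3
    _ ≤ maxEigenvalue M * (maxEigenvalue M * ‖v‖ ^ 2) := by rw [e1]; gcongr
    _ = _ := by ring

/-- The chain $|Vv||v|\le\Lambda_V|v|^2\le\kappa\lambda_V|v|^2\le\kappa\langle Vv,v\rangle$. The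
comparability of the eigenvalues enters the $L^1$ estimates only through this inequality. -/
theorem Potentials.Comparable.norm_act_mul_le {d : ℕ} {S : Potentials d m} {κ : ℝ}
    (hκ : 0 ≤ κ) (hV : S.Comparable κ) : ∀ᵐ x, ∀ v : CSpace m,
      ‖act (complexify (S.V x)) v‖ * ‖v‖ ≤ κ * (inner ℂ v (act (complexify (S.V x)) v)).re := by
  filter_upwards [S.V_symm, S.V_nonneg, hV] with x h1 h2 h3 v
  calc _ ≤ maxEigenvalue (S.V x) * ‖v‖ * ‖v‖ := by
        gcongr
        exact norm_act_complexify_le_maxEigenvalue h1 h2 (h2.trans h3.1) v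
    _ ≤ κ * minEigenvalue (S.V x) * ‖v‖ * ‖v‖ := by gcongr; exact h3.2
    _ = κ * (minEigenvalue (S.V x) * ‖v‖ ^ 2) := by ring
    _ ≤ _ := by gcongr; exact minEigenvalue_mul_sq_le h1 v

end Eigenvalues

/-! ### $L^1$ estimates for the resolvents of $A$ and $L$. -/

section Resolvent

variable {d m : ℕ} {S : Potentials d m}

/-- `u = (1 + η A)⁻¹ f` in the weak form. -/
def Potentials.ResolventEq (S : Potentials d m) (η : ℝ) (f u : LTwo d m) : Prop :=
  S.MemForm u ∧ ∀ v, S.MemForm v → η * S.form u v + inner ℂ v u = inner ℂ v f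

theorem act_zero_matrix (v : CSpace m) : act (0 : Matrix (Fin m) (Fin m) ℂ) v = 0 := by
  ext i; simp [act_apply]

theorem complexify_zero : complexify (0 : Matrix (Fin m) (Fin m) ℝ) = 0 := by
  ext i j; simp [complexify]

theorem matrixSqrt_zero : matrixSqrt (0 : Matrix (Fin m) (Fin m) ℝ) = 0 := by
  open scoped MatrixOrder in
  rw [matrixSqrt, complexify_zero, CFC.sqrt_zero]

theorem Potentials.MemForm.magnetic {u : LTwo d m} (hu : S.MemForm u) : S.magnetic.MemForm u := by
  refine ⟨hu.1, ?_⟩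
  have : (fun x => act (matrixSqrt (S.magnetic.V x)) (u x)) = 0 := by
    ext1 x
    change act (matrixSqrt 0) (u x) = 0
    rw [matrixSqrt_zero, act_zero_matrix]
  rw [this]
  exact MemLp.zero

theorem Potentials.magnetic_form_eq {u v : LTwo d m} {D D' : Fin d → RSpace d → CSpace m}
    (hD : ∀ k, MemLp (D k) 2 volume) (hD' : ∀ k, MemLp (D' k) 2 volume)
    (h : IsVecMagGrad S.a u D) (h' : IsVecMagGrad S.a v D') :
    S.magnetic.form u v = ∑ k, ∫ x, inner ℂ (D' k x) (D k x) := by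
  rw [S.magnetic.form_eq hD hD' h h']
  have : (fun x => inner ℂ (v x) (act (complexify (S.magnetic.V x)) (u x))) = 0 := by
    ext1 x
    change inner ℂ (v x) (act (complexify 0) (u x)) = 0
    rw [complexify_zero, act_zero_matrix, inner_zero_right]
  rw [this]
  simp

theorem Potentials.form_eq_magnetic {u v : LTwo d m} (hu : S.MemForm u) (hv : S.MemForm v) :
    S.form u v = S.magnetic.form u v + ∫ x, inner ℂ (v x) (act (complexify (S.V x)) (u x)) := by
  rw [S.form_eq hu.memLp_grad hv.memLp_grad hu.isVecMagGrad hv.isVecMagGrad,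
    S.magnetic_form_eq hu.memLp_grad hv.memLp_grad hu.isVecMagGrad hv.isVecMagGrad]

theorem integral_inner_eq (u v : LTwo d m) : ∫ x, inner ℂ (u x) (v x) = inner ℂ u v :=
  (L2.inner_def u v).symm

theorem Potentials.ResolventEq.solves {η : ℝ} (hη : 0 < η) {f u : LTwo d m}
    (h : S.ResolventEq η f u) :
    S.Solves (fun k x => WithLp.toLp 2 fun i => magGrad S.a (fun y => u y i) x k)
      fun x => η⁻¹ • (f x - u x) - act (complexify (S.V x)) (u x) := by
  intro v D' hD' hv hvm
  have e := h.2 v hvm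
  rw [S.form_eq h.1.memLp_grad hD' h.1.isVecMagGrad hv] at e
  have i1 : Integrable fun x => inner ℂ (v x) (f x) := L2.integrable_inner v f
  have i2 : Integrable fun x => inner ℂ (v x) (u x) := L2.integrable_inner v u
  have i3 := S.integrable_potential h.1 hvm
  have hfun : (fun x => inner ℂ (v x) (η⁻¹ • (f x - u x) - act (complexify (S.V x)) (u x)))
      = fun x => ((η⁻¹ : ℝ) : ℂ) * (inner ℂ (v x) (f x) - inner ℂ (v x) (u x))
        - inner ℂ (v x) (act (complexify (S.V x)) (u x)) := by
    ext1 x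
    rw [inner_sub_right, inner_real_smul_right, inner_sub_right]
  have i4 : Integrable fun x => ((η⁻¹ : ℝ) : ℂ) * (inner ℂ (v x) (f x) - inner ℂ (v x) (u x)) :=
    (i1.sub i2).const_mul _
  rw [hfun]
  refine ⟨i4.sub i3, ?_⟩
  rw [integral_sub i4 i3, integral_const_mul, integral_sub i1 i2, integral_inner_eq,
    integral_inner_eq, ← e]
  have : (η : ℂ) ≠ 0 := by exact_mod_cast hη.ne'
  push_cast
  field_simp
  ring

theorem Potentials.re_inner_potential_nonneg (S : Potentials d m) :
    ∀ᵐ x, ∀ v : CSpace m, 0 ≤ (inner ℂ v (act (complexify (S.V x)) v)).re := by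
  filter_upwards [S.V_symm, S.V_nonneg] with x h1 h2 v
  exact re_inner_act_complexify_nonneg h1 h2 v

theorem Potentials.aemeasurable_re_inner (S : Potentials d m) (u : LTwo d m) :
    AEMeasurable fun x => (inner ℂ (u x) (act (complexify (S.V x)) (u x))).re :=
  Complex.measurable_re.comp_aemeasurable ((Lp.aestronglyMeasurable u).inner
    (S.aestronglyMeasurable_act_V (Lp.aestronglyMeasurable u))).aemeasurable

theorem lintegral_enorm_const_smul {c : ℝ} (hc : 0 ≤ c) (f : RSpace d → CSpace m) :
    ∫⁻ x, ‖c • f x‖ₑ = ENNReal.ofReal c * ∫⁻ x, ‖f x‖ₑ := by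
  rw [← lintegral_const_mul' _ _ ENNReal.ofReal_ne_top]
  refine lintegral_congr fun x => ?_
  rw [enorm_smul, Real.enorm_of_nonneg hc]

theorem div_norm_sq (z : CSpace m) : ‖z‖ ^ 2 / ‖z‖ = ‖z‖ := by
  rw [sq, mul_self_div_self]

theorem Potentials.re_inner_resolventEq_le (S : Potentials d m) {c : ℝ} (hc : 0 ≤ c) (x : RSpace d)
    (u f : CSpace m) :
    (inner ℂ u (c • (f - u) - act (complexify (S.V x)) u)).re
      + (c * ‖u‖ ^ 2 + (inner ℂ u (act (complexify (S.V x)) u)).re) ≤ ‖c • f‖ * ‖u‖ := by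
  rw [inner_sub_right, inner_real_smul_right, inner_sub_right, Complex.sub_re,
    Complex.re_ofReal_mul, Complex.sub_re, re_inner_self, norm_smul, Real.norm_of_nonneg hc]
  have h1 : (inner ℂ u f).re ≤ ‖f‖ * ‖u‖ := by
    rw [mul_comm]
    exact (le_abs_self _).trans (abs_reInner_le _ _)
  have := mul_le_mul_of_nonneg_left h1 hc
  linarith

theorem enorm_smul_add_ofReal_div {c q : ℝ} (hc : 0 ≤ c) (z : CSpace m) (hq : 0 ≤ q) :
    ‖c • z‖ₑ + ENNReal.ofReal (q / ‖z‖) = ENNReal.ofReal ((c * ‖z‖ ^ 2 + q) / ‖z‖) := by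
  have h1 : ‖c • z‖ₑ = ENNReal.ofReal (c * ‖z‖ ^ 2 / ‖z‖) := by
    rw [mul_div_assoc, div_norm_sq, ENNReal.ofReal_mul hc, enorm_smul, Real.enorm_of_nonneg hc,
      ofReal_norm]
  rw [h1, add_div, ENNReal.ofReal_add (div_nonneg (mul_nonneg hc (sq_nonneg _)) (norm_nonneg _))
    (div_nonneg hq (norm_nonneg _))]

theorem Potentials.ResolventEq.lintegral_div_le {η : ℝ} (hη : 0 < η) {f u : LTwo d m}
    (h : S.ResolventEq η f u) :
    ∫⁻ x, ENNReal.ofReal ((η⁻¹ * ‖u x‖ ^ 2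
        + (inner ℂ (u x) (act (complexify (S.V x)) (u x))).re) / ‖u x‖)
      ≤ ∫⁻ x, ‖η⁻¹ • f x‖ₑ := by
  have hη' : 0 ≤ η⁻¹ := (inv_pos.2 hη).le
  have h₀ : AEStronglyMeasurable (fun x => η⁻¹ • f x) volume :=
    (Lp.aestronglyMeasurable f).const_smul η⁻¹
  have h₁ : AEMeasurable (fun x => η⁻¹ * ‖u x‖ ^ 2) volume :=
    ((Lp.aestronglyMeasurable u).norm.aemeasurable.pow_const 2).const_mul η⁻¹
  exact (h.solves hη).lintegral_le (Lp.memLp u) h.1.memLp_grad h.1.isVecMagGrad h₀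
    (h₁.add (S.aemeasurable_re_inner u))
    (S.re_inner_potential_nonneg.mono fun x hx => add_nonneg (mul_nonneg hη' (sq_nonneg _)) (hx _))
    (.of_forall fun x => S.re_inner_resolventEq_le hη' x (u x) (f x))

/-- Kato's estimate with $p_0=\eta^{-1}f$ and $b=\eta^{-1}|u|^2+\langle Vu,u\rangle$. Keeping the
potential term, rather than only the contraction property, is what controls $\|Vu\|_1$ later. -/
theorem Potentials.ResolventEq.lintegral_add_le {η : ℝ} (hη : 0 < η) {f u : LTwo d m}
    (h : S.ResolventEq η f u) :
    (ENNReal.ofReal η⁻¹ * ∫⁻ x, ‖u x‖ₑ)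
        + ∫⁻ x, ENNReal.ofReal ((inner ℂ (u x) (act (complexify (S.V x)) (u x))).re / ‖u x‖)
      ≤ ENNReal.ofReal η⁻¹ * ∫⁻ x, ‖f x‖ₑ := by
  have hη' : 0 ≤ η⁻¹ := (inv_pos.2 hη).le
  have hus : AEMeasurable (fun x => ‖η⁻¹ • u x‖ₑ) volume :=
    ((Lp.aestronglyMeasurable u).const_smul η⁻¹).enorm
  have e : ∫⁻ x, (‖η⁻¹ • u x‖ₑ
        + ENNReal.ofReal ((inner ℂ (u x) (act (complexify (S.V x)) (u x))).re / ‖u x‖))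
      = ∫⁻ x, ENNReal.ofReal ((η⁻¹ * ‖u x‖ ^ 2
        + (inner ℂ (u x) (act (complexify (S.V x)) (u x))).re) / ‖u x‖) :=
    lintegral_congr_ae (S.re_inner_potential_nonneg.mono fun x hx =>
      enorm_smul_add_ofReal_div hη' (u x) (hx (u x)))
  rw [← lintegral_enorm_const_smul hη' u, ← lintegral_enorm_const_smul hη' f,
    ← lintegral_add_left' hus, e]
  exact h.lintegral_div_le hη

theorem Potentials.ResolventEq.lintegral_enorm_le {η : ℝ} (hη : 0 < η) {f u : LTwo d m}
    (h : S.ResolventEq η f u) : ∫⁻ x, ‖u x‖ₑ ≤ ∫⁻ x, ‖f x‖ₑ := by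
  have h1 := le_self_add.trans (h.lintegral_add_le hη)
  have h0 : ENNReal.ofReal η⁻¹ ≠ 0 := by simpa using hη
  exact (ENNReal.mul_le_mul_iff_right h0 ENNReal.ofReal_ne_top).1 h1

/-- Since $(1+\eta L)(w-u)=\eta Vu$, Kato's estimate gives
$\|w-u\|_1\le\eta\|Vu\|_1\le\kappa\eta\int\langle Vu,u\rangle/|u|$. By
`Potentials.ResolventEq.lintegral_add_le` the last expression is at most the loss of mass
$\kappa(\|f\|_1-\|u\|_1)$, written additively since the norms may be infinite. -/
theorem Potentials.ResolventEq.lintegral_sub_le {κ : ℝ} (hκ : 0 ≤ κ) (hV : S.Comparable κ)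
    {η : ℝ} (hη : 0 < η) {f u w : LTwo d m}
    (h : S.ResolventEq η f u) (h' : S.magnetic.ResolventEq η f w) :
    (∫⁻ x, ‖(w - u) x‖ₑ) + ENNReal.ofReal κ * ∫⁻ x, ‖u x‖ₑ
      ≤ ENNReal.ofReal κ * ∫⁻ x, ‖f x‖ₑ := by
  have hη' : 0 < η⁻¹ := inv_pos.2 hη
  have hηC : (η : ℂ) ≠ 0 := by exact_mod_cast hη.ne'
  have hum := h.1.magnetic
  have hneg := hum.smul S.magnetic (-1)
  have hz : S.magnetic.MemForm (w - u) := by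
    have := h'.1.add S.magnetic hneg
    rwa [neg_one_smul, ← sub_eq_add_neg] at this
  -- Difference of the two resolvent equations. The function $w-u$ is only known to lie in the
  -- larger magnetic form domain; testing with the form domain of `S` makes the pairing with $Vu$
  -- integrable.
  have hsol : S.Solves
      (fun k x => WithLp.toLp 2 fun i => magGrad S.a (fun y => (w - u) y i) x k)
      fun x => act (complexify (S.V x)) (u x) - η⁻¹ • (w - u) x := by
    intro v D' hD' hv hvm
    have i3 := S.integrable_potential h.1 hvm
    have i1 : Integrable fun x => inner ℂ (v x) ((w - u) x) := L2.integrable_inner v (w - u)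
    have i2 : Integrable fun x => ((η⁻¹ : ℝ) : ℂ) * inner ℂ (v x) ((w - u) x) := i1.const_mul _
    simp only [inner_sub_right, inner_real_smul_right]
    refine ⟨i3.sub i2, ?_⟩
    have e0 := S.magnetic_form_eq hz.memLp_grad hD' hz.isVecMagGrad hv
    refine e0.symm.trans ?_
    rw [integral_sub i3 i2, integral_const_mul, integral_inner_eq]
    have e1 := h.2 v hvm
    have e2 := h'.2 v hvm.magnetic
    have e3 : S.magnetic.form (w - u) v = S.magnetic.form w v - S.magnetic.form u v := by
      have := S.magnetic.form_add_left h'.1 hneg hvm.magnetic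
      rw [S.magnetic.form_smul_left _ hum, neg_one_smul, ← sub_eq_add_neg] at this
      rw [this]; ring
    rw [S.form_eq_magnetic h.1 hvm] at e1
    rw [e3, inner_sub_right]
    push_cast
    field_simp
    linear_combination e2 - e1
  have hVm := S.aestronglyMeasurable_act_V (Lp.aestronglyMeasurable u)
  have key := hsol.lintegral_le (Lp.memLp (w - u)) hz.memLp_grad hz.isVecMagGrad
    (p₀ := fun x => act (complexify (S.V x)) (u x)) (b := fun x => η⁻¹ * ‖(w - u) x‖ ^ 2)
    hVm (((Lp.memLp (w - u)).1.norm.aemeasurable.pow_const 2).const_mul _)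
    (.of_forall fun x => by positivity)
    (.of_forall fun x => by
      rw [inner_sub_right, inner_real_smul_right, Complex.sub_re, Complex.re_ofReal_mul,
        re_inner_self, sub_add_cancel, mul_comm]
      exact (le_abs_self _).trans (abs_reInner_le _ _))
  have key2 : ∫⁻ x, ‖act (complexify (S.V x)) (u x)‖ₑ ≤ ENNReal.ofReal κ *
      ∫⁻ x, ENNReal.ofReal ((inner ℂ (u x) (act (complexify (S.V x)) (u x))).re / ‖u x‖) := by
    rw [← lintegral_const_mul' _ _ ENNReal.ofReal_ne_top]
    refine lintegral_mono_ae ((hV.norm_act_mul_le hκ).mono fun x hx => ?_)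
    rw [← ENNReal.ofReal_mul hκ, ← ofReal_norm, ← mul_div_assoc]
    refine ENNReal.ofReal_le_ofReal ?_
    -- The quotient is 0 by convention here, and so is $Vu$.
    by_cases hux : u x = 0
    · have h0 : act (complexify (S.V x)) (u x) = 0 := by
        have := norm_act_complexify_le (S.V x) (u x)
        rw [hux, norm_zero, mul_zero] at this
        rw [hux]
        exact norm_le_zero_iff.1 this
      simp [h0]
    · rw [le_div_iff₀ (norm_pos_iff.2 hux)]
      exact hx _
  have key3 : ENNReal.ofReal η⁻¹ * ∫⁻ x, ‖(w - u) x‖ₑ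
      ≤ ∫⁻ x, ‖act (complexify (S.V x)) (u x)‖ₑ := by
    refine le_trans (le_of_eq ?_) key
    rw [← lintegral_enorm_const_smul hη'.le]
    refine lintegral_congr fun x => ?_
    rw [mul_div_assoc, div_norm_sq, enorm_smul, ENNReal.ofReal_mul hη'.le,
      Real.enorm_of_nonneg hη'.le, ofReal_norm]
  have h0 : ENNReal.ofReal η⁻¹ ≠ 0 := by simpa using hη
  refine (ENNReal.mul_le_mul_iff_right h0 ENNReal.ofReal_ne_top).1 ?_
  have h1 := mul_le_mul_right (h.lintegral_add_le hη) (ENNReal.ofReal κ)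
  rw [mul_add] at h1 ⊢
  calc _ ≤ _ := add_le_add_left (key3.trans key2) _
    _ = _ := by rw [add_comm, mul_left_comm]
    _ ≤ _ := h1
    _ = _ := mul_left_comm _ _ _

end Resolvent

/-! ### Functional calculus for $0\le R\le1$ and the approximate square roots. -/

section HilbertSpace

open Filter Topology
open scoped InnerProduct

variable {E : Type*} [NormedAddCommGroup E] [InnerProductSpace ℂ E] [CompleteSpace E]

theorem denseRange_of_adjoint_injective {F : Type*} [NormedAddCommGroup F] [InnerProductSpace ℂ F]
    [CompleteSpace F] {T : F →L[ℂ] E} (h : ∀ x, T.adjoint x = 0 → x = 0) : DenseRange T := by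
  have h1 : T.rangeᗮ = ⊥ := by
    rw [ContinuousLinearMap.orthogonal_range]
    exact (Submodule.eq_bot_iff _).2 fun x hx => h x hx
  have h2 := (Submodule.topologicalClosure_eq_top_iff (K := T.range)).2 h1
  have h3 := Submodule.dense_iff_topologicalClosure_eq_top.2 h2
  exact h3

theorem inner_self_apply_eq_of_sq {T R : E →L[ℂ] E} (hT : 0 ≤ T) (h : T * T = R) (x : E) :
    ‖T x‖ ^ 2 = (inner ℂ (R x) x).re := by
  have hs : IsSelfAdjoint T := IsSelfAdjoint.of_nonneg hT
  rw [← h, mul_apply_eq_comp, ← inner_self_eq_norm_sq (𝕜 := ℂ)]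
  rw [← ContinuousLinearMap.adjoint_inner_left, hs.adjoint_eq]
  rfl

theorem sqrt_norm_sq {R : E →L[ℂ] E} (hR : 0 ≤ R) (x : E) :
    ‖CFC.sqrt R x‖ ^ 2 = (inner ℂ (R x) x).re :=
  inner_self_apply_eq_of_sq (CFC.sqrt_nonneg R) (CFC.sqrt_mul_sqrt_self R hR) x

theorem sqrt_injective {R : E →L[ℂ] E} (hR : 0 ≤ R) (h : ∀ x, R x = 0 → x = 0) (x : E)
    (hx : CFC.sqrt R x = 0) : x = 0 := by
  refine h x ?_
  have := congrArg (fun T : E →L[ℂ] E => T x) (CFC.sqrt_mul_sqrt_self R hR)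
  rw [← this, mul_apply_eq_comp, hx, map_zero]

theorem sqrt_denseRange {R : E →L[ℂ] E} (hR : 0 ≤ R) (h : ∀ x, R x = 0 → x = 0) :
    DenseRange (CFC.sqrt R : E →L[ℂ] E) := by
  refine denseRange_of_adjoint_injective fun x hx => ?_
  rw [(IsSelfAdjoint.of_nonneg (CFC.sqrt_nonneg R)).adjoint_eq] at hx
  exact sqrt_injective hR h x hx

/-! ### Functions of an operator `0 ≤ R ≤ 1` -/

variable {R : E →L[ℂ] E}

theorem mem_Icc_of_mem_spectrum (h0 : 0 ≤ R) (h1 : 0 ≤ 1 - R) {r : ℝ} (hr : r ∈ spectrum ℝ R) :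
    r ∈ Set.Icc (0 : ℝ) 1 := by
  refine ⟨spectrum_nonneg_of_nonneg h0 hr, ?_⟩
  have : 1 - r ∈ spectrum ℝ (1 - R) := by
    have := spectrum.singleton_sub_eq R (1 : ℝ)
    rw [map_one] at this
    rw [← this]
    exact ⟨1, rfl, r, hr, rfl⟩
  linarith [spectrum_nonneg_of_nonneg h1 this]

/-- The denominator `r + η (1 - r)`. -/
def den (η r : ℝ) : ℝ := r + η * (1 - r)

/-- The function with `(1 + η A)⁻¹ = resFun η ((1 + A)⁻¹)`. -/
def resFun (η r : ℝ) : ℝ := r / den η r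

/-- The function `(1 - (1 - η²) resFun η)^{1/2}`. -/
def sqrtFun (η r : ℝ) : ℝ := √(1 - (1 - η ^ 2) * resFun η r)

theorem den_pos {η r : ℝ} (hη : 0 < η) (hr : r ∈ Set.Icc (0 : ℝ) 1) : 0 < den η r := by
  rcases hr.1.eq_or_lt with h | h
  · simp [den, ← h, hη]
  · have := mul_nonneg hη.le (sub_nonneg.2 hr.2)
    unfold den; linarith

theorem continuousOn_resFun {η : ℝ} (hη : 0 < η) : ContinuousOn (resFun η) (Set.Icc 0 1) := by
  refine continuousOn_id.div ?_ fun r hr => (den_pos hη hr).ne'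
  unfold den
  fun_prop

theorem resFun_mem {η r : ℝ} (hη : 0 < η) (hr : r ∈ Set.Icc (0 : ℝ) 1) :
    resFun η r ∈ Set.Icc (0 : ℝ) 1 := by
  have h := den_pos hη hr
  refine ⟨div_nonneg hr.1 h.le, (div_le_one h).2 ?_⟩
  have := mul_nonneg hη.le (sub_nonneg.2 hr.2)
  unfold den; linarith

theorem one_sub_mul_resFun {η r : ℝ} (hη : 0 < η) (hr : r ∈ Set.Icc (0 : ℝ) 1) :
    1 - (1 - η ^ 2) * resFun η r = η * (1 - r + η * r) / den η r := by
  have h := (den_pos hη hr).ne'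
  rw [resFun]
  field_simp
  unfold den
  ring

theorem sq_le_one_sub_mul_resFun {η r : ℝ} (hη : 0 < η) (hη1 : η ≤ 1)
    (hr : r ∈ Set.Icc (0 : ℝ) 1) : η ^ 2 ≤ 1 - (1 - η ^ 2) * resFun η r := by
  have h := resFun_mem hη hr
  have : 0 ≤ 1 - η ^ 2 := by nlinarith
  nlinarith [mul_nonneg this (sub_nonneg.2 h.2)]

theorem sqrtFun_mem {η r : ℝ} (hη : 0 < η) (hη1 : η ≤ 1) (hr : r ∈ Set.Icc (0 : ℝ) 1) :
    sqrtFun η r ∈ Set.Icc η 1 := by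
  refine ⟨Real.le_sqrt_of_sq_le (sq_le_one_sub_mul_resFun hη hη1 hr), ?_⟩
  refine Real.sqrt_le_one.2 ?_
  have : 0 ≤ 1 - η ^ 2 := by nlinarith
  linarith [mul_nonneg this (resFun_mem hη hr).1]

theorem sqrtFun_sq {η r : ℝ} (hη : 0 < η) (hη1 : η ≤ 1) (hr : r ∈ Set.Icc (0 : ℝ) 1) :
    sqrtFun η r ^ 2 = 1 - (1 - η ^ 2) * resFun η r :=
  Real.sq_sqrt ((sq_nonneg η).trans (sq_le_one_sub_mul_resFun hη hη1 hr))

theorem continuousOn_sqrtFun {η : ℝ} (hη : 0 < η) : ContinuousOn (sqrtFun η) (Set.Icc 0 1) :=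
  ((continuousOn_const.sub (continuousOn_const.mul (continuousOn_resFun hη)))).sqrt

/-- With $r=(1+A)^{-1}$, the square of `sqrtFun η` is $\eta(A+\eta)/(1+\eta A)$, whose reciprocal is
$1+\frac{1-\eta^2}{\eta^2}(1+\eta^{-1}A)^{-1}$. Writing $S^{-1}=S^{-2}S$ in this way expresses the
inverse by operators known to preserve finite $L^1$ norm. -/
theorem inv_sqrtFun {η r : ℝ} (hη : 0 < η) (hη1 : η ≤ 1) (hr : r ∈ Set.Icc (0 : ℝ) 1) :
    (sqrtFun η r)⁻¹ = sqrtFun η r + (1 - η ^ 2) / η ^ 2 * (resFun η⁻¹ r * sqrtFun η r) := by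
  have hs : sqrtFun η r ≠ 0 := (hη.trans_le (sqrtFun_mem hη hη1 hr).1).ne'
  have h2 := sqrtFun_sq hη hη1 hr
  rw [one_sub_mul_resFun hη hr] at h2
  have hd := (den_pos hη hr).ne'
  have hd' := (den_pos (inv_pos.2 hη) hr).ne'
  have hn : 1 - r + η * r ≠ 0 := by
    have : den η⁻¹ r = (1 - r + η * r) / η := by unfold den; field_simp; ring
    rw [this] at hd'
    exact (div_ne_zero_iff.1 hd').1
  have key : 1 = (1 + (1 - η ^ 2) / η ^ 2 * resFun η⁻¹ r) * sqrtFun η r ^ 2 := by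
    have : den η⁻¹ r = (1 - r + η * r) / η := by unfold den; field_simp; ring
    rw [h2, resFun, this]
    field_simp
    unfold den
    ring
  field_simp
  rw [sq] at key
  field_simp at key
  linear_combination key

/-- The operator `(1 + η A)⁻¹` in terms of `R = (1 + A)⁻¹`. -/
def resOp (η : ℝ) (R : E →L[ℂ] E) : E →L[ℂ] E := cfc (resFun η) R

/-- The operator `(1 - (1 - η²) (1 + η A)⁻¹)^{1/2}` in terms of `R = (1 + A)⁻¹`. -/
def sqrtRes (η : ℝ) (R : E →L[ℂ] E) : E →L[ℂ] E := cfc (sqrtFun η) R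

theorem continuousOn_spectrum (h0 : 0 ≤ R) (h1 : 0 ≤ 1 - R) {f : ℝ → ℝ}
    (hf : ContinuousOn f (Set.Icc 0 1)) : ContinuousOn f (spectrum ℝ R) :=
  hf.mono fun _ hr => mem_Icc_of_mem_spectrum h0 h1 hr

/-- Take $y=(R+\eta(1-R))^{-1}f$. As $ARy=y-Ry$, the two identities say that $Ry$ solves $(1+\eta
A)Ry=f$, without mentioning the unbounded operator. -/
theorem exists_resOp_eq (h0 : 0 ≤ R) (h1 : 0 ≤ 1 - R) {η : ℝ} (hη : 0 < η) (f : E) :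
    ∃ y, resOp η R f = R y ∧ f = R y + η • (y - R y) := by
  have hsa : IsSelfAdjoint R := .of_nonneg h0
  have hc : ContinuousOn (fun r => (den η r)⁻¹) (spectrum ℝ R) := by
    refine continuousOn_spectrum h0 h1 (ContinuousOn.inv₀ ?_ fun r hr => (den_pos hη hr).ne')
    unfold den; fun_prop
  have hcd : ContinuousOn (den η) (spectrum ℝ R) := by unfold den; fun_prop
  set Y : E →L[ℂ] E := cfc (fun r => (den η r)⁻¹) R with hY
  have e1 : resOp η R = R * Y := by
    have h := cfc_mul (fun r : ℝ => r) (fun r => (den η r)⁻¹) R (by fun_prop) hc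
    rw [cfc_id' ℝ R] at h
    exact h
  have e2 : 1 = R * Y + η • (Y - R * Y) := by
    have e3 : cfc (den η) R = R + η • (1 - R) := by
      unfold den
      rw [cfc_add R (fun r => r) (fun r => η * (1 - r)) (by fun_prop) (by fun_prop),
        cfc_const_mul η (fun r => 1 - r) R (by fun_prop),
        cfc_sub (fun _ => (1 : ℝ)) (fun r => r) R (by fun_prop) (by fun_prop),
        cfc_const_one ℝ R, cfc_id' ℝ R]
    have e4 : cfc (den η) R * Y = 1 := by
      rw [hY, ← cfc_mul _ _ R hcd hc, ← cfc_const_one ℝ R]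
      exact cfc_congr fun r hr => mul_inv_cancel₀ (den_pos hη (mem_Icc_of_mem_spectrum h0 h1 hr)).ne'
    rw [← e4, e3, add_mul, smul_mul_assoc, sub_mul, one_mul]
  exact ⟨Y f, congrArg (fun T : E →L[ℂ] E => T f) e1, congrArg (fun T : E →L[ℂ] E => T f) e2⟩

theorem cfc_sqrt_one_sub (h0 : 0 ≤ R) (h1 : 0 ≤ 1 - R) :
    CFC.sqrt (1 - R) = cfc (fun r : ℝ => √(1 - r)) R := by
  have hsa : IsSelfAdjoint R := .of_nonneg h0
  refine CFC.sqrt_unique ?_ (cfc_nonneg fun _ _ => Real.sqrt_nonneg _)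
  have : cfc (fun r : ℝ => 1 - r) R = 1 - R := by
    rw [cfc_sub (fun _ => (1 : ℝ)) (fun r => r) R (by fun_prop) (by fun_prop),
      cfc_const_one ℝ R, cfc_id' ℝ R]
  rw [← cfc_mul _ _ R (by fun_prop) (by fun_prop), ← this]
  exact cfc_congr fun r hr => Real.mul_self_sqrt
    (sub_nonneg.2 (mem_Icc_of_mem_spectrum h0 h1 hr).2)

theorem cfc_sqrt_eq (h0 : 0 ≤ R) : CFC.sqrt R = cfc Real.sqrt R := by
  have hsa : IsSelfAdjoint R := .of_nonneg h0
  refine CFC.sqrt_unique ?_ (cfc_nonneg fun _ _ => Real.sqrt_nonneg _)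
  rw [← cfc_mul _ _ R (by fun_prop) (by fun_prop)]
  conv_rhs => rw [← cfc_id' ℝ R]
  exact cfc_congr fun r hr => Real.mul_self_sqrt (spectrum_nonneg_of_nonneg h0 hr)

theorem sqrtRes_nonneg (η : ℝ) (R : E →L[ℂ] E) : 0 ≤ sqrtRes η R :=
  cfc_nonneg fun _ _ => Real.sqrt_nonneg _

theorem sqrtRes_mul_self (h0 : 0 ≤ R) (h1 : 0 ≤ 1 - R) {η : ℝ} (hη : 0 < η) (hη1 : η ≤ 1) :
    sqrtRes η R * sqrtRes η R = 1 - (1 - η ^ 2) • resOp η R := by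
  have hsa : IsSelfAdjoint R := .of_nonneg h0
  have hc := continuousOn_spectrum h0 h1 (continuousOn_sqrtFun hη)
  have hk := continuousOn_spectrum h0 h1 (continuousOn_resFun hη)
  unfold sqrtRes resOp
  rw [← cfc_mul _ _ R hc hc, ← cfc_const_mul (1 - η ^ 2) (resFun η) R hk, ← cfc_const_one ℝ R,
    ← cfc_sub (fun _ => (1 : ℝ)) (fun r => (1 - η ^ 2) * resFun η r) R (by fun_prop)
      (continuousOn_const.mul hk)]
  exact cfc_congr fun r hr => by
    have := sqrtFun_sq hη hη1 (mem_Icc_of_mem_spectrum h0 h1 hr)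
    rw [sq] at this
    exact this

theorem sqrtRes_mul_inv (h0 : 0 ≤ R) (h1 : 0 ≤ 1 - R) {η : ℝ} (hη : 0 < η) (hη1 : η ≤ 1) :
    sqrtRes η R * (sqrtRes η R + ((1 - η ^ 2) / η ^ 2) • (resOp η⁻¹ R * sqrtRes η R)) = 1 := by
  have hsa : IsSelfAdjoint R := .of_nonneg h0
  have hc := continuousOn_spectrum h0 h1 (continuousOn_sqrtFun hη)
  have hk := continuousOn_spectrum h0 h1 (continuousOn_resFun (inv_pos.2 hη))
  unfold sqrtRes resOp
  rw [← cfc_mul _ _ R hk hc,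
    ← cfc_const_mul ((1 - η ^ 2) / η ^ 2) (fun r => resFun η⁻¹ r * sqrtFun η r) R (hk.mul hc),
    ← cfc_add R (sqrtFun η) (fun r => (1 - η ^ 2) / η ^ 2 * (resFun η⁻¹ r * sqrtFun η r)) hc
      (continuousOn_const.mul (hk.mul hc)),
    ← cfc_mul (sqrtFun η)
      (fun r => sqrtFun η r + (1 - η ^ 2) / η ^ 2 * (resFun η⁻¹ r * sqrtFun η r)) R hc
      (hc.add (continuousOn_const.mul (hk.mul hc))), ← cfc_const_one ℝ R]
  refine cfc_congr fun r hr => ?_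
  have hr' := mem_Icc_of_mem_spectrum h0 h1 hr
  rw [← inv_sqrtFun hη hη1 hr']
  exact mul_inv_cancel₀ (hη.trans_le (sqrtFun_mem hη hη1 hr').1).ne'

theorem norm_one_sub_sqrtRes_le (h0 : 0 ≤ R) (h1 : 0 ≤ 1 - R) {η : ℝ} (hη : 0 < η) (hη1 : η ≤ 1) :
    ‖1 - sqrtRes η R‖ ≤ 1 - η := by
  have hsa : IsSelfAdjoint R := .of_nonneg h0
  have hc := continuousOn_spectrum h0 h1 (continuousOn_sqrtFun hη)
  unfold sqrtRes
  rw [← cfc_const_one ℝ R, ← cfc_sub (fun _ => (1 : ℝ)) (sqrtFun η) R (by fun_prop) hc]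
  refine norm_cfc_le (by linarith) fun r hr => ?_
  have h := sqrtFun_mem hη hη1 (mem_Icc_of_mem_spectrum h0 h1 hr)
  rw [Real.norm_of_nonneg (by linarith [h.2])]
  linarith [h.1]

theorem resOp_norm_le (h0 : 0 ≤ R) (h1 : 0 ≤ 1 - R) {η : ℝ} (hη : 0 < η) : ‖resOp η R‖ ≤ 1 := by
  refine norm_cfc_le zero_le_one fun r hr => ?_
  have h := resFun_mem hη (mem_Icc_of_mem_spectrum h0 h1 hr)
  rw [Real.norm_of_nonneg h.1]
  exact h.2

/-- The iteration `Y ↦ (X + Y²) / 2`, which converges to `1 - (1 - X)^{1/2}`. -/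
def sqrtIter (X : E →L[ℂ] E) : ℕ → E →L[ℂ] E
  | 0 => 0
  | n + 1 => (1 / 2 : ℝ) • (X + sqrtIter X n * sqrtIter X n)

/-- The ball of radius $q$ is invariant because $\frac12((2q-q^2)+q^2)=q$. On it
$Y^2-Q^2=Y(Y-Q)+(Y-Q)Q$ shows that one step shrinks the distance to the fixed point $Q$ by the
factor $q<1$. -/
theorem tendsto_sqrtIter {X Q : E →L[ℂ] E} {q : ℝ} (hq1 : q < 1) (hQ : ‖Q‖ ≤ q)
    (hX : ‖X‖ ≤ 2 * q - q ^ 2) (h : Q = (1 / 2 : ℝ) • (X + Q * Q)) :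
    Tendsto (sqrtIter X) atTop (𝓝 Q) := by
  have hq0 : 0 ≤ q := (norm_nonneg _).trans hQ
  have hhalf : ‖(1 / 2 : ℝ)‖ = 1 / 2 := by norm_num
  have hY : ∀ n, ‖sqrtIter X n‖ ≤ q := by
    intro n
    induction n with
    | zero => simpa [sqrtIter] using hq0
    | succ n ih =>
      rw [sqrtIter, norm_smul, hhalf]
      have h1 := norm_add_le X (sqrtIter X n * sqrtIter X n)
      have h2 := norm_mul_le (sqrtIter X n) (sqrtIter X n)
      have h3 := mul_le_mul ih ih (norm_nonneg _) hq0
      nlinarith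
  have hE : ∀ n, ‖sqrtIter X n - Q‖ ≤ q ^ n * q := by
    intro n
    induction n with
    | zero => simpa [sqrtIter] using hQ
    | succ n ih =>
      have e : sqrtIter X (n + 1) - Q
          = (1 / 2 : ℝ) • (sqrtIter X n * (sqrtIter X n - Q) + (sqrtIter X n - Q) * Q) := by
        conv_lhs => rw [h]
        rw [sqrtIter, ← smul_sub]
        congr 1
        noncomm_ring
      rw [e, norm_smul, hhalf]
      have h1 := norm_add_le (sqrtIter X n * (sqrtIter X n - Q)) ((sqrtIter X n - Q) * Q)
      have h2 := norm_mul_le (sqrtIter X n) (sqrtIter X n - Q)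
      have h3 := norm_mul_le (sqrtIter X n - Q) Q
      have h4 := mul_le_mul (hY n) ih (norm_nonneg _) hq0
      have h5 := mul_le_mul ih hQ (norm_nonneg _) (by positivity)
      calc _ ≤ 1 / 2 * (q * (q ^ n * q) + q ^ n * q * q) := by gcongr; linarith
        _ = _ := by ring
  rw [tendsto_iff_norm_sub_tendsto_zero]
  refine squeeze_zero (fun n => norm_nonneg _) hE ?_
  simpa using (tendsto_pow_atTop_nhds_zero_of_lt_one hq0 hq1).mul_const q

/-- For $S=$ `sqrtRes η R`, the operator $Q=1-S$ satisfies $2Q=(1-S^2)+Q^2$. The lower bound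
$S\ge\eta$ permits $q=1-\eta$, for which $2q-q^2=1-\eta^2$ is exactly the scaling factor. -/
theorem tendsto_sqrtIter_resOp (h0 : 0 ≤ R) (h1 : 0 ≤ 1 - R) {η : ℝ} (hη : 0 < η) (hη1 : η ≤ 1) :
    Tendsto (sqrtIter ((1 - η ^ 2) • resOp η R)) atTop (𝓝 (1 - sqrtRes η R)) := by
  have hθ : 0 ≤ 1 - η ^ 2 := by nlinarith
  refine tendsto_sqrtIter (q := 1 - η) (by linarith) (norm_one_sub_sqrtRes_le h0 h1 hη hη1) ?_ ?_
  · rw [norm_smul, Real.norm_of_nonneg hθ]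
    have := mul_le_mul_of_nonneg_left (resOp_norm_le h0 h1 hη) hθ
    linarith
  · have h := sqrtRes_mul_self h0 h1 hη hη1
    have e : (1 - sqrtRes η R) * (1 - sqrtRes η R)
        = 1 - (2 : ℝ) • sqrtRes η R + sqrtRes η R * sqrtRes η R := by
      rw [two_smul]; noncomm_ring
    rw [e, h]
    module

/-! ### Convergence of the approximate square roots -/

theorem tendsto_apply_of_denseRange {E : Type*} [NormedAddCommGroup E] [NormedSpace ℂ E] {T : E →L[ℂ] E} (hT : DenseRange T) {X : ℕ → E →L[ℂ] E} {C : ℝ}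
    (hC : ∀ n, ‖X n‖ ≤ C) (h : ∀ y, Tendsto (fun n => X n (T y)) atTop (𝓝 0)) (x : E) :
    Tendsto (fun n => X n x) atTop (𝓝 0) := by
  have hC0 : 0 ≤ C := (norm_nonneg _).trans (hC 0)
  rw [Metric.tendsto_atTop]
  intro ε hε
  obtain ⟨y, hy⟩ := hT.exists_dist_lt x (show 0 < ε / (2 * (C + 1)) by positivity)
  obtain ⟨N, hN⟩ := (Metric.tendsto_atTop.1 (h y)) (ε / 2) (by positivity)
  refine ⟨N, fun n hn => ?_⟩
  have h1 := hN n hn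
  rw [dist_zero_right] at h1
  have h3 : ‖X n (x - T y)‖ ≤ C * ‖x - T y‖ := (X n).le_of_opNorm_le (hC n) _
  have h4 : C * ‖x - T y‖ ≤ ε / 2 := by
    rw [dist_eq_norm] at hy
    calc C * ‖x - T y‖ ≤ (C + 1) * (ε / (2 * (C + 1))) := by gcongr; linarith
      _ = ε / 2 := by field_simp
  rw [dist_zero_right]
  calc ‖X n x‖ = ‖X n (x - T y) + X n (T y)‖ := by rw [← map_add, sub_add_cancel]
    _ ≤ ‖X n (x - T y)‖ + ‖X n (T y)‖ := norm_add_le _ _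
    _ < ε := by linarith

theorem sqrt_mul_sqrtFun {η r : ℝ} (hη : 0 < η) (hr : r ∈ Set.Icc (0 : ℝ) 1) :
    (√η)⁻¹ * (sqrtFun η r * √r) = √((1 - r + η * r) * r / den η r) := by
  have hd := den_pos hη hr
  have hn : 0 ≤ 1 - r + η * r := add_nonneg (sub_nonneg.2 hr.2) (mul_nonneg hη.le hr.1)
  rw [sqrtFun, one_sub_mul_resFun hη hr, ← Real.sqrt_inv, ← Real.sqrt_mul (by positivity),
    ← Real.sqrt_mul (by positivity)]
  congr 1
  field_simp

theorem abs_sqrt_sub_sqrt_le {a b : ℝ} (ha : 0 ≤ a) (hb : 0 ≤ b) : |√a - √b| ≤ √|a - b| := by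
  have e : a - b = (√a - √b) * (√a + √b) := by
    linear_combination Real.sq_sqrt hb - Real.sq_sqrt ha
  have h : |√a - √b| ≤ √a + √b := by
    have h1 := Real.sqrt_nonneg a
    have h2 := Real.sqrt_nonneg b
    exact abs_le.2 ⟨by linarith, by linarith⟩
  refine Real.le_sqrt_of_sq_le ?_
  rw [e, abs_mul, sq]
  exact mul_le_mul_of_nonneg_left (h.trans (le_abs_self _)) (abs_nonneg _)

/-- The approximation is not uniform near $r=0$, where $A$ is large: at $r=0$ the two functions are
0 and 1. The extra factor $r$ repairs this, at rate $\sqrt\eta$. -/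
theorem abs_sqrt_sub_mul_le {η r : ℝ} (hη : 0 < η) (hr : r ∈ Set.Icc (0 : ℝ) 1) :
    |((√η)⁻¹ * (sqrtFun η r * √r) - √(1 - r)) * r| ≤ √η := by
  have hd := den_pos hη hr
  rw [sqrt_mul_sqrtFun hη hr]
  have h1 : |√((1 - r + η * r) * r / den η r) - √(1 - r)|
      ≤ √|(1 - r + η * r) * r / den η r - (1 - r)| := by
    have hn : 0 ≤ 1 - r + η * r := add_nonneg (sub_nonneg.2 hr.2) (mul_nonneg hη.le hr.1)
    exact abs_sqrt_sub_sqrt_le (div_nonneg (mul_nonneg hn hr.1) hd.le) (sub_nonneg.2 hr.2)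
  have h2 : (1 - r + η * r) * r / den η r - (1 - r) = η * (2 * r - 1) / den η r := by
    field_simp
    unfold den
    ring
  rw [abs_mul, abs_of_nonneg hr.1]
  calc _ ≤ √|(1 - r + η * r) * r / den η r - (1 - r)| * √(r ^ 2) := by
        rw [Real.sqrt_sq hr.1]; gcongr; exact hr.1
    _ = √(|η * (2 * r - 1) / den η r| * r ^ 2) := by rw [h2, Real.sqrt_mul (abs_nonneg _)]
    _ ≤ √η := by
      refine Real.sqrt_le_sqrt ?_
      rw [abs_div, abs_mul, abs_of_pos hη, abs_of_pos hd, div_mul_eq_mul_div, div_le_iff₀ hd]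
      have h3 : |2 * r - 1| ≤ 1 := abs_le.2 ⟨by linarith [hr.1], by linarith [hr.2]⟩
      have h4 : r ≤ den η r := by
        have := mul_nonneg hη.le (sub_nonneg.2 hr.2)
        unfold den; linarith
      have h5 : r ^ 2 ≤ r := by nlinarith [hr.1, hr.2]
      calc η * |2 * r - 1| * r ^ 2 ≤ η * 1 * r := by gcongr
        _ ≤ η * den η r := by rw [mul_one]; gcongr

theorem sqrt_mul_sqrtFun_mem {η r : ℝ} (hη : 0 < η) (hη1 : η ≤ 1) (hr : r ∈ Set.Icc (0 : ℝ) 1) :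
    (√η)⁻¹ * (sqrtFun η r * √r) ∈ Set.Icc (0 : ℝ) 1 := by
  rw [sqrt_mul_sqrtFun hη hr]
  have hd := den_pos hη hr
  refine ⟨Real.sqrt_nonneg _, Real.sqrt_le_one.2 ((div_le_one hd).2 ?_)⟩
  have h4 : r ≤ den η r := by
    have := mul_nonneg hη.le (sub_nonneg.2 hr.2)
    unfold den; linarith
  have : (1 - r + η * r) ≤ 1 := by nlinarith [hr.1, hr.2]
  nlinarith [hr.1]

/-- This is $\eta^{-1/2}S\to A^{1/2}$ on the vectors $R^{1/2}x$, where $A^{1/2}R^{1/2}=(1-R)^{1/2}$.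
The errors are bounded by 1 in norm and tend to 0 in norm after composition with $R$, so density of
the range of $R$ suffices. -/
theorem tendsto_sqrtRes (h0 : 0 ≤ R) (h1 : 0 ≤ 1 - R) (hd : DenseRange R) {η : ℕ → ℝ}
    (hη : ∀ n, 0 < η n) (hη1 : ∀ n, η n ≤ 1) (hlim : Tendsto η atTop (𝓝 0)) (x : E) :
    Tendsto (fun n => (√(η n))⁻¹ • sqrtRes (η n) R (CFC.sqrt R x)) atTop
      (𝓝 (CFC.sqrt (1 - R) x)) := by
  have hsa : IsSelfAdjoint R := .of_nonneg h0
  set X : ℕ → E →L[ℂ] E := fun n =>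
    (√(η n))⁻¹ • (sqrtRes (η n) R * CFC.sqrt R) - CFC.sqrt (1 - R) with hX
  have hc : ∀ n, ContinuousOn (fun r => (√(η n))⁻¹ * (sqrtFun (η n) r * √r)) (spectrum ℝ R) :=
    fun n => continuousOn_spectrum h0 h1 (continuousOn_const.mul
      ((continuousOn_sqrtFun (hη n)).mul (by fun_prop)))
  have hXc : ∀ n, X n = cfc (fun r => (√(η n))⁻¹ * (sqrtFun (η n) r * √r) - √(1 - r)) R := by
    intro n
    have hs := continuousOn_spectrum h0 h1 (continuousOn_sqrtFun (hη n))
    simp only [hX]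
    rw [cfc_sub (fun r => (√(η n))⁻¹ * (sqrtFun (η n) r * √r)) (fun r => √(1 - r)) R (hc n)
        (by fun_prop),
      cfc_const_mul (√(η n))⁻¹ (fun r => sqrtFun (η n) r * √r) R (hs.mul (by fun_prop)),
      cfc_mul (sqrtFun (η n)) (fun r => √r) R hs (by fun_prop), cfc_sqrt_one_sub h0 h1,
      cfc_sqrt_eq h0]
    rfl
  have hbd : ∀ n, ‖X n‖ ≤ 1 := by
    intro n
    rw [hXc]
    refine norm_cfc_le zero_le_one fun r hr => ?_
    have hr' := mem_Icc_of_mem_spectrum h0 h1 hr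
    have m1 := sqrt_mul_sqrtFun_mem (hη n) (hη1 n) hr'
    have m2 : √(1 - r) ≤ 1 := Real.sqrt_le_one.2 (by linarith [hr'.1])
    have m3 := Real.sqrt_nonneg (1 - r)
    rw [Real.norm_eq_abs, abs_le]
    exact ⟨by linarith [m1.1], by linarith [m1.2]⟩
  have hR : Tendsto (fun n => ‖X n * R‖) atTop (𝓝 0) := by
    refine squeeze_zero (g := fun n => √(η n)) (fun n => norm_nonneg _) (fun n => ?_) ?_
    · have e : X n * R
          = cfc (fun r => ((√(η n))⁻¹ * (sqrtFun (η n) r * √r) - √(1 - r)) * r) R := by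
        rw [cfc_mul (fun r => (√(η n))⁻¹ * (sqrtFun (η n) r * √r) - √(1 - r)) (fun r => r) R
          ((hc n).sub (by fun_prop)) (by fun_prop), cfc_id' ℝ R, hXc]
      rw [e]
      exact norm_cfc_le (Real.sqrt_nonneg _) fun r hr =>
        abs_sqrt_sub_mul_le (hη n) (mem_Icc_of_mem_spectrum h0 h1 hr)
    · simpa using hlim.sqrt
  have hRy : ∀ y, Tendsto (fun n => X n (R y)) atTop (𝓝 0) := fun y => by
    refine squeeze_zero_norm (fun n => (X n * R).le_opNorm y) ?_
    simpa using hR.mul_const ‖y‖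
  have key := tendsto_apply_of_denseRange hd hbd hRy x
  have := key.add_const (CFC.sqrt (1 - R) x)
  rw [zero_add] at this
  refine this.congr fun n => ?_
  simp [hX]

end HilbertSpace

/-! ### Resolvents and their square roots from embedded form spaces. -/

section FormOperators

open Filter Topology
open scoped InnerProduct

variable {E : Type*} [NormedAddCommGroup E] [InnerProductSpace ℂ E] [CompleteSpace E]
  {F : Type*} [NormedAddCommGroup F] [InnerProductSpace ℂ F] [CompleteSpace F]

/-- The operator `(1 + A)⁻¹` for the form whose Hilbert space is embedded by `ι`. -/
def formResolvent (ι : F →L[ℂ] E) : E →L[ℂ] E := ι ∘L ι.adjoint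

theorem inner_formResolvent (ι : F →L[ℂ] E) (x : E) :
    inner ℂ (formResolvent ι x) x = ((‖ι.adjoint x‖ ^ 2 : ℝ) : ℂ) := by
  rw [formResolvent, ContinuousLinearMap.comp_apply, ← ContinuousLinearMap.adjoint_inner_right,
    inner_self_eq_norm_sq_to_K]
  norm_cast

theorem formResolvent_nonneg (ι : F →L[ℂ] E) : 0 ≤ formResolvent ι := by
  rw [ContinuousLinearMap.nonneg_iff_isPositive, ContinuousLinearMap.isPositive_iff_complex]
  intro x
  rw [inner_formResolvent]
  exact ⟨rfl, sq_nonneg _⟩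

theorem one_sub_formResolvent_nonneg {ι : F →L[ℂ] E} (hι : ‖ι‖ ≤ 1) : 0 ≤ 1 - formResolvent ι := by
  rw [ContinuousLinearMap.nonneg_iff_isPositive, ContinuousLinearMap.isPositive_iff_complex]
  intro x
  have e : inner ℂ ((1 - formResolvent ι) x) x = ((‖x‖ ^ 2 - ‖ι.adjoint x‖ ^ 2 : ℝ) : ℂ) := by
    have : (1 - formResolvent ι) x = x - formResolvent ι x := rfl
    rw [this, inner_sub_left, inner_formResolvent, inner_self_eq_norm_sq_to_K]
    push_cast
    rfl
  have h : ‖ι.adjoint x‖ ≤ ‖x‖ := by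
    have := ι.adjoint.le_opNorm x
    rw [LinearIsometryEquiv.norm_map] at this
    exact this.trans (mul_le_of_le_one_left (norm_nonneg _) hι)
  rw [e]
  exact ⟨rfl, sub_nonneg.2 (pow_le_pow_left₀ (norm_nonneg _) h 2)⟩

theorem adjoint_injective_of_denseRange {ι : F →L[ℂ] E} (hι : DenseRange ι) {x : E}
    (hx : ι.adjoint x = 0) : x = 0 := by
  refine hι.eq_zero_of_inner_left (𝕜 := ℂ) fun v => ?_
  rw [← ContinuousLinearMap.adjoint_inner_left, hx, inner_zero_left]

theorem formResolvent_injective {ι : F →L[ℂ] E} (hι : DenseRange ι) {x : E}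
    (hx : formResolvent ι x = 0) : x = 0 := by
  have h := inner_formResolvent ι x
  rw [hx, inner_zero_left] at h
  have h2 : ‖ι.adjoint x‖ ^ 2 = 0 := by exact_mod_cast h.symm
  exact adjoint_injective_of_denseRange hι (norm_eq_zero.1 (pow_eq_zero_iff two_ne_zero |>.1 h2))

theorem norm_sqrt_formResolvent (ι : F →L[ℂ] E) (x : E) :
    ‖CFC.sqrt (formResolvent ι) x‖ = ‖ι.adjoint x‖ := by
  have h := sqrt_norm_sq (formResolvent_nonneg ι) x
  rw [inner_formResolvent, Complex.ofReal_re] at h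
  exact (pow_left_inj₀ (norm_nonneg _) (norm_nonneg _) two_ne_zero).1 h

theorem norm_sqrt_one_sub_sq {R : E →L[ℂ] E} (h0 : 0 ≤ R) (h1 : 0 ≤ 1 - R) (x : E) :
    ‖CFC.sqrt (1 - R) x‖ ^ 2 = ‖x‖ ^ 2 - ‖CFC.sqrt R x‖ ^ 2 := by
  rw [sqrt_norm_sq h1, sqrt_norm_sq h0]
  have : (1 - R) x = x - R x := rfl
  rw [this, inner_sub_left, Complex.sub_re, ← inner_self_eq_norm_sq (𝕜 := ℂ)]
  rfl

/-- The square root of `(1 + A)⁻¹` maps unitarily onto the Hilbert space of the form. -/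
theorem exists_isometryEquiv_sqrt {ι : F →L[ℂ] E} (hι : DenseRange ι)
    (hinj : ∀ v, ι v = 0 → v = 0) :
    ∃ U : E ≃ₗᵢ[ℂ] F, ∀ x, ι (U x) = CFC.sqrt (formResolvent ι) x := by
  set P : E →L[ℂ] E := CFC.sqrt (formResolvent ι) with hP
  have d1 : DenseRange P := sqrt_denseRange (formResolvent_nonneg ι)
    fun x hx => formResolvent_injective hι hx
  have d2 : DenseRange ι.adjoint := denseRange_of_adjoint_injective fun v hv => by
    rw [ContinuousLinearMap.adjoint_adjoint] at hv
    exact hinj v hv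
  have hn : ∀ x, ‖ι.adjoint.toLinearMap (LinearEquiv.refl ℂ E x)‖ = ‖P.toLinearMap x‖ :=
    fun x => (norm_sqrt_formResolvent ι x).symm
  -- Since $\|R^{1/2}x\|=\|\iota^*x\|$ and both ranges are dense, $R^{1/2}x\mapsto\iota^*x$ extends
  -- to a unitary. Then $\iota UR^{1/2}=\iota\iota^*=R^{1/2}R^{1/2}$ yields $\iota U=R^{1/2}$.
  let U := LinearEquiv.extendOfIsometry (LinearEquiv.refl ℂ E) P.toLinearMap
    ι.adjoint.toLinearMap d1 d2 hn
  have hU : ∀ x, U (P x) = ι.adjoint x :=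
    fun x => LinearEquiv.extendOfIsometry_eq (LinearEquiv.refl ℂ E) P.toLinearMap
      ι.adjoint.toLinearMap d1 d2 hn x
  refine ⟨U, fun x => ?_⟩
  refine d1.induction_on (p := fun x => ι (U x) = P x) x ?_ fun y => ?_
  · exact isClosed_eq (ι.continuous.comp U.continuous) P.continuous
  · rw [hU]
    exact congrArg (fun T : E →L[ℂ] E => T y)
      (CFC.sqrt_mul_sqrt_self _ (formResolvent_nonneg ι)).symm

variable {G : Type*} [NormedAddCommGroup G] [InnerProductSpace ℂ G] [CompleteSpace G]

/-- A form domain contractively included in another one. -/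
theorem exists_contraction_sqrt {ι : F →L[ℂ] E} {ι' : G →L[ℂ] E} (hι : DenseRange ι)
    (hinj : ∀ v, ι v = 0 → v = 0) (hinj' : ∀ v, ι' v = 0 → v = 0)
    {j : F →L[ℂ] G} (hj : ‖j‖ ≤ 1) (hjι : ∀ v, ι' (j v) = ι v) :
    ∃ H : E →L[ℂ] E, ‖H‖ ≤ 1 ∧
      ∀ x, CFC.sqrt (formResolvent ι') (H x) = CFC.sqrt (formResolvent ι) x := by
  have hι' : DenseRange ι' := hι.mono <| by
    rintro _ ⟨v, rfl⟩
    exact ⟨j v, hjι v⟩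
  obtain ⟨U, hU⟩ := exists_isometryEquiv_sqrt hι hinj
  obtain ⟨U', hU'⟩ := exists_isometryEquiv_sqrt hι' hinj'
  -- $H=U'^{-1}jU$ is the inclusion of form domains transported to $E$ by the two unitaries.
  refine ⟨(U'.symm.toContinuousLinearEquiv : G →L[ℂ] E) ∘L j ∘L
    (U.toContinuousLinearEquiv : E →L[ℂ] F), ?_, fun x => ?_⟩
  · refine ContinuousLinearMap.opNorm_le_bound _ zero_le_one fun x => ?_
    have : ‖U'.symm (j (U x))‖ ≤ 1 * ‖x‖ := by
      rw [U'.symm.norm_map, ← U.norm_map x]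
      exact j.le_of_opNorm_le hj _
    exact this
  · have : CFC.sqrt (formResolvent ι') (U'.symm (j (U x))) = CFC.sqrt (formResolvent ι) x := by
      rw [← hU', U'.apply_symm_apply, hjι, hU]
    exact this

end FormOperators

/-! ### Comparison of two resolvents and strong convergence to $L^{1/2}A^{-1/2}$. -/

section Comparison

open Filter Topology

variable {E : Type*} [NormedAddCommGroup E] [InnerProductSpace ℂ E] [CompleteSpace E]
  {R R' : E →L[ℂ] E}

/-- The inverse of `sqrtRes η R`. -/
def sqrtResInv (η : ℝ) (R : E →L[ℂ] E) : E →L[ℂ] E :=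
  sqrtRes η R + ((1 - η ^ 2) / η ^ 2) • (resOp η⁻¹ R * sqrtRes η R)

theorem sqrtResInv_mul (h0 : 0 ≤ R) (h1 : 0 ≤ 1 - R) {η : ℝ} (hη : 0 < η) (hη1 : η ≤ 1) :
    sqrtResInv η R * sqrtRes η R = 1 := by
  rw [← sqrtRes_mul_inv h0 h1 hη hη1, sqrtResInv]
  have hc : Commute (sqrtRes η R) (resOp η⁻¹ R * sqrtRes η R) :=
    (cfc_commute_cfc _ _ R).mul_right (Commute.refl _)
  exact ((Commute.refl _).add_right (hc.smul_right _)).eq.symm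

/-- Taking adjoints in $R^{1/2}=R'^{1/2}H$ gives $R^{1/2}=H^*R'^{1/2}$, so
$\|R^{1/2}x\|\le\|R'^{1/2}x\|$. -/
theorem le_of_contraction_sqrt (h0 : 0 ≤ R) (h0' : 0 ≤ R') {H : E →L[ℂ] E} (hH : ‖H‖ ≤ 1)
    (h : ∀ x, CFC.sqrt R' (H x) = CFC.sqrt R x) : R ≤ R' := by
  have hs := (IsSelfAdjoint.of_nonneg (CFC.sqrt_nonneg R)).adjoint_eq
  have hs' := (IsSelfAdjoint.of_nonneg (CFC.sqrt_nonneg R')).adjoint_eq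
  have e : CFC.sqrt R = H.adjoint * CFC.sqrt R' := by
    have e1 : CFC.sqrt R = CFC.sqrt R' ∘L H := by ext x; exact (h x).symm
    have e2 := congrArg ContinuousLinearMap.adjoint e1
    rw [ContinuousLinearMap.adjoint_comp, hs, hs'] at e2
    exact e2
  have hn : ∀ x, ‖CFC.sqrt R x‖ ≤ ‖CFC.sqrt R' x‖ := fun x => by
    rw [e]
    have := H.adjoint.le_opNorm (CFC.sqrt R' x)
    rw [LinearIsometryEquiv.norm_map] at this
    exact this.trans (mul_le_of_le_one_left (norm_nonneg _) hH)
  have hsa := (IsSelfAdjoint.of_nonneg h0').sub (IsSelfAdjoint.of_nonneg h0)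
  rw [ContinuousLinearMap.le_def]
  refine ContinuousLinearMap.isPositive_def'.2 ⟨hsa, fun x => ?_⟩
  have hx := pow_le_pow_left₀ (norm_nonneg _) (hn x) 2
  rw [sqrt_norm_sq h0, sqrt_norm_sq h0'] at hx
  rw [ContinuousLinearMap.reApplyInnerSelf_apply]
  have : (R' - R) x = R' x - R x := rfl
  rw [this, inner_sub_left, map_sub]
  exact sub_nonneg.2 hx

/-- `den η R` as an invertible operator. -/
theorem exists_unit_den (h0 : 0 ≤ R) (h1 : 0 ≤ 1 - R) {η : ℝ} (hη : 0 < η) (hη1 : η ≤ 1) :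
    ∃ D : (E →L[ℂ] E)ˣ, (D : E →L[ℂ] E) = η • 1 + (1 - η) • R ∧
      sqrtRes η R * sqrtRes η R = (η * (1 + η)) • (↑D⁻¹ : E →L[ℂ] E) - η • 1 := by
  have hsa : IsSelfAdjoint R := .of_nonneg h0
  have hc : ContinuousOn (fun r => (den η r)⁻¹) (spectrum ℝ R) := by
    refine continuousOn_spectrum h0 h1 (ContinuousOn.inv₀ ?_ fun r hr => (den_pos hη hr).ne')
    unfold den; fun_prop
  have hcd : ContinuousOn (den η) (spectrum ℝ R) := by unfold den; fun_prop
  have e3 : cfc (den η) R = η • 1 + (1 - η) • R := by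
    have : cfc (fun r : ℝ => η * 1 + (1 - η) * r) R = η • 1 + (1 - η) • R := by
      rw [cfc_add R (fun r => η * 1) (fun r => (1 - η) * r) (by fun_prop) (by fun_prop),
        cfc_const_mul η (fun _ => (1 : ℝ)) R (by fun_prop),
        cfc_const_mul (1 - η) (fun r => r) R (by fun_prop), cfc_const_one ℝ R, cfc_id' ℝ R]
    rw [← this]
    exact cfc_congr fun r _ => by simp only [den]; ring
  have e4 : cfc (den η) R * cfc (fun r => (den η r)⁻¹) R = 1 := by
    rw [← cfc_mul _ _ R hcd hc, ← cfc_const_one ℝ R]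
    exact cfc_congr fun r hr => mul_inv_cancel₀ (den_pos hη (mem_Icc_of_mem_spectrum h0 h1 hr)).ne'
  refine ⟨⟨cfc (den η) R, cfc (fun r => (den η r)⁻¹) R, e4,
    (cfc_commute_cfc _ _ R).eq.trans e4⟩, e3, ?_⟩
  have hs := continuousOn_spectrum h0 h1 (continuousOn_sqrtFun hη)
  have e5 : (η * (1 + η)) • cfc (fun r => (den η r)⁻¹) R - η • 1
      = cfc (fun r => η * (1 + η) * (den η r)⁻¹ - η * 1) R := by
    rw [cfc_sub (fun r => η * (1 + η) * (den η r)⁻¹) (fun _ => η * 1) R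
        (continuousOn_const.mul hc) (by fun_prop),
      cfc_const_mul (η * (1 + η)) (fun r => (den η r)⁻¹) R hc,
      cfc_const_mul η (fun _ => (1 : ℝ)) R (by fun_prop), cfc_const_one ℝ R]
  refine Eq.trans ?_ e5.symm
  rw [sqrtRes, ← cfc_mul _ _ R hs hs]
  refine cfc_congr fun r hr => ?_
  have hr' := mem_Icc_of_mem_spectrum h0 h1 hr
  have := sqrtFun_sq hη hη1 hr'
  rw [one_sub_mul_resFun hη hr', sq] at this
  refine this.trans ?_
  have hd := (den_pos hη hr').ne'
  field_simp
  unfold den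
  ring

/-- The square of `sqrtRes η R` is an affine function of $(\eta+(1-\eta)R)^{-1}$ with positive
slope. Inversion reverses the operator order, so $R\le R'$ yields the opposite inequality between
the squares. -/
theorem norm_sqrtRes_le (h0 : 0 ≤ R) (h1 : 0 ≤ 1 - R) (h1' : 0 ≤ 1 - R') (hle : R ≤ R')
    {η : ℝ} (hη : 0 < η) (hη1 : η ≤ 1) (x : E) : ‖sqrtRes η R' x‖ ≤ ‖sqrtRes η R x‖ := by
  obtain ⟨D, hD, hDS⟩ := exists_unit_den h0 h1 hη hη1
  obtain ⟨D', hD', hDS'⟩ := exists_unit_den (h0.trans hle) h1' hη hη1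
  have hDD : (D : E →L[ℂ] E) ≤ D' := by
    rw [hD, hD']
    gcongr
  have hD0 : (0 : E →L[ℂ] E) ≤ D := by
    rw [hD]
    have := smul_nonneg (sub_nonneg.2 hη1) h0
    have := smul_nonneg hη.le (zero_le_one (α := E →L[ℂ] E))
    positivity
  have hinv := CStarAlgebra.inv_le_inv hD0 hDD
  have hsq : sqrtRes η R' * sqrtRes η R' ≤ sqrtRes η R * sqrtRes η R := by
    rw [hDS, hDS']
    gcongr
  have h2 := (ContinuousLinearMap.le_def _ _).1 hsq
  have h3 := (ContinuousLinearMap.isPositive_def'.1 h2).2 x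
  refine (pow_le_pow_iff_left₀ (norm_nonneg _) (norm_nonneg _) two_ne_zero).1 ?_
  rw [inner_self_apply_eq_of_sq (sqrtRes_nonneg η R') rfl,
    inner_self_apply_eq_of_sq (sqrtRes_nonneg η R) rfl]
  rw [ContinuousLinearMap.reApplyInnerSelf_apply] at h3
  have e : (sqrtRes η R * sqrtRes η R - sqrtRes η R' * sqrtRes η R') x
    = (sqrtRes η R * sqrtRes η R) x - (sqrtRes η R' * sqrtRes η R') x := rfl
  rw [e, inner_sub_left, map_sub] at h3
  exact sub_nonneg.1 h3

/-- The bounded extension of `L^{1/2} A^{-1/2}`. -/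
theorem exists_extension (h0 : 0 ≤ R) (h1 : 0 ≤ 1 - R) (h0' : 0 ≤ R') (h1' : 0 ≤ 1 - R')
    (hinj : ∀ x, (1 - R) x = 0 → x = 0) {H : E →L[ℂ] E} (hH : ‖H‖ ≤ 1)
    (h : ∀ x, CFC.sqrt R' (H x) = CFC.sqrt R x) :
    ∃ T : E →L[ℂ] E, ∀ x, T (CFC.sqrt (1 - R) x) = CFC.sqrt (1 - R') (H x) := by
  have hd := sqrt_denseRange h1 hinj
  -- Both squared norms subtract the same quantity $\|R^{1/2}x\|^2=\|R'^{1/2}Hx\|^2$, from $\|x\|^2$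
  -- and from $\|Hx\|^2\le\|x\|^2$ respectively.
  have hn : ∀ x, ‖((CFC.sqrt (1 - R') : E →L[ℂ] E) ∘L H).toLinearMap x‖
      ≤ 1 * ‖(CFC.sqrt (1 - R) : E →L[ℂ] E).toLinearMap x‖ := fun x => by
    have e1 := norm_sqrt_one_sub_sq h0 h1 x
    have e2 := norm_sqrt_one_sub_sq h0' h1' (H x)
    rw [h] at e2
    have e3 := pow_le_pow_left₀ (norm_nonneg _) (H.le_of_opNorm_le hH x) 2
    rw [one_mul] at e3 ⊢
    refine (pow_le_pow_iff_left₀ (norm_nonneg _) (norm_nonneg _) two_ne_zero).1 ?_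
    have : ‖CFC.sqrt (1 - R') (H x)‖ ^ 2 ≤ ‖CFC.sqrt (1 - R) x‖ ^ 2 := by linarith
    exact this
  exact ⟨_, LinearMap.extendOfNorm_eq (e := (CFC.sqrt (1 - R) : E →L[ℂ] E).toLinearMap) hd
    ⟨1, hn⟩⟩

theorem norm_approx_le (h0 : 0 ≤ R) (h1 : 0 ≤ 1 - R) (h1' : 0 ≤ 1 - R') (hle : R ≤ R')
    {η : ℝ} (hη : 0 < η) (hη1 : η ≤ 1) (f : E) :
    ‖sqrtRes η R' (sqrtResInv η R f)‖ ≤ ‖f‖ := by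
  refine (norm_sqrtRes_le h0 h1 h1' hle hη hη1 _).trans_eq ?_
  exact congrArg (fun T : E →L[ℂ] E => ‖T f‖) (sqrtRes_mul_inv h0 h1 hη hη1)

/-- The operators $X_n=S_n'S_n^{-1}$ are contractions with $X_nS_n=S_n'$. On the dense range of
$(1-R)^{1/2}$, replace $(1-R)^{1/2}g$ by $\eta_n^{-1/2}S_nR^{1/2}g$: its image is
$\eta_n^{-1/2}S_n'R'^{1/2}Hg$, which tends to $(1-R')^{1/2}Hg$. -/
theorem tendsto_approx (h0 : 0 ≤ R) (h1 : 0 ≤ 1 - R) (h0' : 0 ≤ R') (h1' : 0 ≤ 1 - R')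
    (hR : DenseRange R) (hR' : DenseRange R')
    (hinj : ∀ x, (1 - R) x = 0 → x = 0) {H T : E →L[ℂ] E} (hH : ‖H‖ ≤ 1)
    (h : ∀ x, CFC.sqrt R' (H x) = CFC.sqrt R x)
    (hT : ∀ x, T (CFC.sqrt (1 - R) x) = CFC.sqrt (1 - R') (H x)) {η : ℕ → ℝ}
    (hη : ∀ n, 0 < η n) (hη1 : ∀ n, η n ≤ 1) (hlim : Tendsto η atTop (𝓝 0)) (f : E) :
    Tendsto (fun n => sqrtRes (η n) R' (sqrtResInv (η n) R f)) atTop (𝓝 (T f)) := by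
  have hle := le_of_contraction_sqrt h0 h0' hH h
  set X : ℕ → E →L[ℂ] E := fun n => sqrtRes (η n) R' * sqrtResInv (η n) R with hX
  have hXn : ∀ n x, ‖X n x‖ ≤ ‖x‖ := fun n x =>
    norm_approx_le h0 h1 h1' hle (hη n) (hη1 n) x
  have hXS : ∀ n x, X n (sqrtRes (η n) R x) = sqrtRes (η n) R' x := fun n x =>
    congrArg (sqrtRes (η n) R')
      (congrArg (fun T : E →L[ℂ] E => T x) (sqrtResInv_mul h0 h1 (hη n) (hη1 n)))
  have hdense : ∀ g, Tendsto (fun n => X n (CFC.sqrt (1 - R) g)) atTop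
      (𝓝 (T (CFC.sqrt (1 - R) g))) := by
    intro g
    have t1 := tendsto_sqrtRes h0 h1 hR hη hη1 hlim g
    have t2 := tendsto_sqrtRes h0' h1' hR' hη hη1 hlim (H g)
    rw [h] at t2
    have t3 : Tendsto (fun n => X n (CFC.sqrt (1 - R) g
        - (√(η n))⁻¹ • sqrtRes (η n) R (CFC.sqrt R g))) atTop (𝓝 0) := by
      refine squeeze_zero_norm (fun n => hXn n _) ?_
      simpa using (t1.const_sub (CFC.sqrt (1 - R) g)).norm
    rw [hT]
    have t4 := t3.add t2
    rw [zero_add] at t4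
    refine t4.congr fun n => ?_
    rw [← hXS n, map_sub, ContinuousLinearMap.map_smul_of_tower, sub_add_cancel]
  have hS := sqrt_denseRange h1 hinj
  have hC : ∀ n, ‖X n - T‖ ≤ 1 + ‖T‖ := fun n => by
    refine (norm_sub_le _ _).trans (add_le_add_left ?_ _)
    exact ContinuousLinearMap.opNorm_le_bound _ zero_le_one fun x => by
      rw [one_mul]; exact hXn n x
  have key := (tendsto_apply_of_denseRange hS hC (fun y => by
    simpa using! (hdense y).sub_const (T (CFC.sqrt (1 - R) y))) f).add_const (T f)
  rw [zero_add] at key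
  exact key.congr fun n => sub_add_cancel _ _

end Comparison

/-! ### The form domain as a closed subspace of a Hilbert space. -/

section FormSpace

open Filter Topology

variable {d m : ℕ}

/-- The functional `f ↦ ∫ ψ f` on `L²`. -/
def testPairing (m : ℕ) {ψ : RSpace d → ℂ} (hψ : MemLp ψ 2 volume) : LTwo d m →L[ℂ] CSpace m :=
  (ContinuousLinearMap.lsmul ℂ ℂ).lpPairing volume 2 2 (hψ.toLp ψ)

theorem testPairing_apply {ψ : RSpace d → ℂ} (hψ : MemLp ψ 2 volume) (f : LTwo d m) :
    testPairing m hψ f = ∫ x, ψ x • f x := by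
  rw [testPairing, ContinuousLinearMap.lpPairing_eq_integral]
  refine integral_congr_ae ?_
  filter_upwards [hψ.coeFn_toLp] with x hx
  rw [hx]
  rfl

theorem memLp_ofReal_of_continuous {φ : RSpace d → ℝ} (hφ : Continuous φ)
    (hc : HasCompactSupport φ) : MemLp (fun x => (φ x : ℂ)) 2 volume :=
  (hφ.memLp_of_hasCompactSupport hc).ofReal

theorem memLp_test_mul_magnetic {a : RSpace d → RSpace d} (ha : MemLpLoc a 2) {φ : RSpace d → ℝ}
    (hφ : Continuous φ) (hc : HasCompactSupport φ) (k : Fin d) :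
    MemLp (fun x => (φ x : ℂ) * (Complex.I * (a x k : ℂ))) 2 volume := by
  have hm : MeasurableSet (tsupport φ) := (isClosed_tsupport φ).measurableSet
  have h1 : MemLp (fun x => a x k) 2 (volume.restrict (tsupport φ)) :=
    (EuclideanSpace.proj (𝕜 := ℝ) k).comp_memLp' (ha _ hc.isCompact.isBounded hm)
  have h2 := (memLp_indicator_iff_restrict hm).2 h1
  obtain ⟨C, hC⟩ := hφ.bounded_above_of_compact_support hc
  have h3 : MemLp (fun x => φ x * (tsupport φ).indicator (fun x => a x k) x) 2 volume := by
    refine h2.of_le_mul (c := C) (hφ.aestronglyMeasurable.mul h2.1) (.of_forall fun x => ?_)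
    rw [norm_mul]
    exact mul_le_mul_of_nonneg_right (hC x) (norm_nonneg _)
  refine (h3.ofReal.const_mul Complex.I).ae_eq (.of_forall fun x => ?_)
  by_cases hx : x ∈ tsupport φ
  · simp only [Set.indicator_of_mem hx]
    change Complex.I * ((φ x * a x k : ℝ) : ℂ) = (φ x : ℂ) * (Complex.I * (a x k : ℂ))
    push_cast
    ring
  · simp [image_eq_zero_of_notMem_tsupport hx]

/-- The Hilbert space of all `(u, v, w)` with `u, v ∈ L²(ℝ^d; ℂ^m)` and `w ∈ L²(ℝ^d; ℂ^m)^d`. -/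
abbrev FormAmbient (d m : ℕ) : Type := PiLp 2 (fun _ : Option (Option (Fin d)) => LTwo d m)

theorem FormAmbient.inner_eq (z w : FormAmbient d m) :
    inner ℂ z w = inner ℂ (z none) (w none) + (inner ℂ (z (some none)) (w (some none))
      + ∑ k, inner ℂ (z (some (some k))) (w (some (some k)))) := by
  rw [PiLp.inner_apply, Fintype.sum_option, Fintype.sum_option]

/-- Evaluation of a component. -/
def FormAmbient.proj (i : Option (Option (Fin d))) : FormAmbient d m →L[ℂ] LTwo d m :=
  PiLp.proj 2 (fun _ : Option (Option (Fin d)) => LTwo d m) i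

/-- The functional whose vanishing for all `φ` says that `∇_a u = w`. -/
def gradDefect (S : Potentials d m) (k : Fin d) (φ : {φ : RSpace d → ℝ // IsTest φ}) :
    FormAmbient d m →L[ℂ] CSpace m :=
  testPairing m (memLp_ofReal_of_continuous (isTest_partialDeriv (k := k) φ.2).1
      (isTest_partialDeriv φ.2).2) ∘L FormAmbient.proj none
    + (testPairing m (memLp_ofReal_of_continuous φ.2.1.continuous φ.2.2)
        ∘L FormAmbient.proj (some (some k))
      + testPairing m (memLp_test_mul_magnetic S.a_loc φ.2.1.continuous φ.2.2 k)
        ∘L FormAmbient.proj none)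

theorem gradDefect_eq_zero_iff (S : Potentials d m) (z : FormAmbient d m) :
    (∀ k φ, gradDefect S k φ z = 0) ↔
      IsVecMagGrad S.a (z none) fun k => z (some (some k)) := by
  have e : ∀ k φ (hφ : IsTest φ), gradDefect S k ⟨φ, hφ⟩ z
      = (∫ x, partialDeriv k φ x • z none x)
        + ∫ x, φ x • (z (some (some k)) x + (Complex.I * (S.a x k : ℂ)) • z none x) := by
    intro k φ hφ
    have i2 := ((Lp.memLp (z (some (some k)))).locallyIntegrable
      one_le_two).integrable_smul_left_of_hasCompactSupport hφ.1.continuous hφ.2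
    have i3 := (locallyIntegrable_magnetic_smul S.a_loc (Lp.memLp (z none))
      k).integrable_smul_left_of_hasCompactSupport hφ.1.continuous hφ.2
    simp only [smul_add]
    rw [integral_add i2 i3]
    have e1 : gradDefect S k ⟨φ, hφ⟩ z
      = testPairing m (memLp_ofReal_of_continuous (isTest_partialDeriv (k := k) hφ).1
          (isTest_partialDeriv hφ).2) (z none)
        + (testPairing m (memLp_ofReal_of_continuous hφ.1.continuous hφ.2) (z (some (some k)))
          + testPairing m (memLp_test_mul_magnetic S.a_loc hφ.1.continuous hφ.2 k) (z none)) := rfl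
    rw [e1, testPairing_apply, testPairing_apply, testPairing_apply]
    simp only [mul_smul, Complex.coe_smul]
  constructor
  · intro h k φ hφ
    have := h k ⟨φ, hφ⟩
    rw [e] at this
    exact eq_neg_of_add_eq_zero_left this
  · rintro h k ⟨φ, hφ⟩
    rw [e, h k φ hφ, neg_add_cancel]

/-- The relation `v = V^{1/2} u`. -/
def potentialGraph (S : Potentials d m) : Submodule ℂ (FormAmbient d m) where
  carrier := {z | z (some none) =ᵐ[volume] fun x => act (matrixSqrt (S.V x)) (z none x)}
  add_mem' := fun {z w} hz hw => by
    filter_upwards [hz, hw, Lp.coeFn_add (z none) (w none),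
      Lp.coeFn_add (z (some none)) (w (some none))] with x h1 h2 h3 h4
    have e : (z (some none) + w (some none) : LTwo d m) x
      = act (matrixSqrt (S.V x)) ((z none + w none : LTwo d m) x) := by
      rw [h3, h4, Pi.add_apply, Pi.add_apply, act_add, h1, h2]
    exact e
  zero_mem' := by
    filter_upwards [Lp.coeFn_zero (CSpace m) 2 (volume : Measure (RSpace d))] with x h1
    have e : (0 : LTwo d m) x = act (matrixSqrt (S.V x)) ((0 : LTwo d m) x) := by
      rw [h1]
      simp [act]
    exact e
  smul_mem' := fun c z hz => by
    filter_upwards [hz, Lp.coeFn_smul c (z none), Lp.coeFn_smul c (z (some none))] with x h1 h2 h3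
    have e : (c • z (some none) : LTwo d m) x
      = act (matrixSqrt (S.V x)) ((c • z none : LTwo d m) x) := by
      rw [h2, h3, Pi.smul_apply, Pi.smul_apply, act_smul, h1]
    exact e

theorem continuous_act (M : Matrix (Fin m) (Fin m) ℂ) : Continuous (act M) := by
  refine (PiLp.continuous_toLp 2 _).comp (continuous_pi fun i => ?_)
  have : (fun v : CSpace m => M.mulVec (WithLp.ofLp v) i) = fun v => ∑ j, M i j * v j := rfl
  rw [this]
  fun_prop

/-- Multiplication by $V^{1/2}$ is unbounded on $L^2$ but continuous at each point $x$. Passing to a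
subsequence converging almost everywhere in both components preserves the relation. -/
theorem isClosed_potentialGraph (S : Potentials d m) :
    IsClosed (potentialGraph S : Set (FormAmbient d m)) := by
  refine isSeqClosed_iff_isClosed.1 fun z w hz hw => ?_
  have h0 : Tendsto (fun n => z n none) atTop (𝓝 (w none)) :=
    ((FormAmbient.proj none).continuous.tendsto w).comp hw
  have h1 : Tendsto (fun n => z n (some none)) atTop (𝓝 (w (some none))) :=
    ((FormAmbient.proj (some none)).continuous.tendsto w).comp hw
  obtain ⟨ns, hns, h2⟩ := (tendstoInMeasure_of_tendsto_Lp h0).exists_seq_tendsto_ae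
  obtain ⟨ms, hms, h3⟩ := (tendstoInMeasure_of_tendsto_Lp
    (h1.comp hns.tendsto_atTop)).exists_seq_tendsto_ae
  have h4 : ∀ᵐ x, ∀ n, z n (some none) x = act (matrixSqrt (S.V x)) (z n none x) :=
    ae_all_iff.2 hz
  filter_upwards [h2, h3, h4] with x hx2 hx3 hx4
  refine tendsto_nhds_unique hx3 ?_
  refine (((continuous_act _).tendsto _).comp (hx2.comp hms.tendsto_atTop)).congr fun n => ?_
  exact (hx4 _).symm

/-- The form domain with the form norm, realised as the space of all
`(u, V^{1/2} u, ∇_a u)`. -/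
def formSpace (S : Potentials d m) : Submodule ℂ (FormAmbient d m) :=
  (⨅ k, ⨅ φ, (gradDefect S k φ).ker) ⊓ potentialGraph S

theorem mem_formSpace {S : Potentials d m} {z : FormAmbient d m} :
    z ∈ formSpace S ↔ (IsVecMagGrad S.a (z none) fun k => z (some (some k))) ∧
      z (some none) =ᵐ[volume] fun x => act (matrixSqrt (S.V x)) (z none x) := by
  rw [formSpace, Submodule.mem_inf, ← gradDefect_eq_zero_iff]
  simp only [Submodule.mem_iInf]
  rfl

instance (S : Potentials d m) : CompleteSpace (formSpace S) := by
  refine IsClosed.completeSpace_coe (hs := ?_)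
  refine IsClosed.inter ?_ (isClosed_potentialGraph S)
  rw [Submodule.coe_iInf]
  refine isClosed_iInter fun k => ?_
  rw [Submodule.coe_iInf]
  exact isClosed_iInter fun φ => (gradDefect S k φ).isClosed_ker

/-- The inclusion of the form domain in `L²`. -/
def formIncl (S : Potentials d m) : formSpace S →L[ℂ] LTwo d m :=
  FormAmbient.proj none ∘L (formSpace S).subtypeL

theorem formIncl_apply (S : Potentials d m) (z : formSpace S) :
    formIncl S z = (z : FormAmbient d m) none := rfl

theorem norm_formIncl_le (S : Potentials d m) : ‖formIncl S‖ ≤ 1 := by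
  refine ContinuousLinearMap.opNorm_le_bound _ zero_le_one fun z => ?_
  rw [one_mul]
  exact PiLp.norm_apply_le (z : FormAmbient d m) none

theorem act_zero_vec (M : Matrix (Fin m) (Fin m) ℂ) : act M 0 = 0 := by
  simp [act]

theorem formIncl_injective (S : Potentials d m) (z : formSpace S) (hz : formIncl S z = 0) :
    z = 0 := by
  obtain ⟨⟨h1, h2⟩, h0⟩ := And.intro (mem_formSpace.1 z.2) hz
  rw [formIncl_apply] at h0
  have hz0 : (z : FormAmbient d m) none =ᵐ[volume] (0 : RSpace d → CSpace m) := by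
    rw [h0]
    exact Lp.coeFn_zero _ _ _
  have e1 : (z : FormAmbient d m) (some none) = 0 := by
    rw [Lp.eq_zero_iff_ae_eq_zero]
    filter_upwards [h2, hz0] with x hx hx0
    rw [hx, hx0]
    exact act_zero_vec _
  have e2 : ∀ k, (z : FormAmbient d m) (some (some k)) = 0 := by
    intro k
    rw [Lp.eq_zero_iff_ae_eq_zero]
    refine ae_eq_zero_of_integral_contDiff_smul_eq_zero
      ((Lp.memLp _).locallyIntegrable one_le_two) fun φ hφ hc => ?_
    have e := (h1.congr hz0) k φ ⟨hφ, hc⟩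
    simpa using e.symm
  refine Subtype.ext (PiLp.ext fun i => ?_)
  match i with
  | none => exact h0
  | some none => exact e1
  | some (some k) => exact e2 k

theorem memForm_formIncl (S : Potentials d m) (z : formSpace S) : S.MemForm (formIncl S z) := by
  obtain ⟨h1, h2⟩ := mem_formSpace.1 z.2
  exact S.memForm_of_isVecMagGrad (fun k => Lp.memLp _) h1 ((Lp.memLp _).ae_eq h2)

theorem exists_formIncl_eq {S : Potentials d m} {u : LTwo d m} (hu : S.MemForm u) :
    ∃ z : formSpace S, formIncl S z = u := by
  let z : FormAmbient d m := WithLp.toLp 2 fun i => match i with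
    | none => u
    | some none => hu.2.toLp _
    | some (some k) => (hu.memLp_grad k).toLp _
  have hz : z ∈ formSpace S := by
    refine mem_formSpace.2 ⟨fun k φ hφ => ?_, hu.2.coeFn_toLp⟩
    have e := hu.isVecMagGrad k φ hφ
    refine e.trans (congrArg Neg.neg (integral_congr_ae ?_))
    filter_upwards [(hu.memLp_grad k).coeFn_toLp] with x hx
    exact congrArg (fun v => φ x • (v + (Complex.I * (S.a x k : ℂ)) • u x)) hx.symm
  exact ⟨⟨z, hz⟩, rfl⟩

/-- The graph inner product is $\mathfrak a(u,v)+\langle u,v\rangle$. Therefore $\iota\iota^*$, for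
the inclusion $\iota$ of this space in $L^2$, is $(1+A)^{-1}$ by the defining property of the
adjoint. -/
theorem inner_formSpace (S : Potentials d m) (z w : formSpace S) :
    inner ℂ w z = S.form (formIncl S z) (formIncl S w)
      + inner ℂ (formIncl S w) (formIncl S z) := by
  obtain ⟨h1, h2⟩ := mem_formSpace.1 z.2
  obtain ⟨h1', h2'⟩ := mem_formSpace.1 w.2
  have e := S.form_eq (u := formIncl S z) (v := formIncl S w) (fun k => Lp.memLp _)
    (fun k => Lp.memLp _) h1 h1'
  rw [e, Submodule.coe_inner, FormAmbient.inner_eq]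
  have e1 : ∫ x, inner ℂ (formIncl S w x) (act (complexify (S.V x)) (formIncl S z x))
      = inner ℂ ((w : FormAmbient d m) (some none)) ((z : FormAmbient d m) (some none)) := by
    rw [← integral_inner_eq]
    refine integral_congr_ae ?_
    filter_upwards [h2, h2', S.V_symm, S.V_nonneg] with x hx hx' s1 s2
    rw [hx, hx', inner_complexify s1 s2]
    rfl
  rw [e1, Finset.sum_congr rfl fun k _ => integral_inner_eq
    ((w : FormAmbient d m) (some (some k))) ((z : FormAmbient d m) (some (some k)))]
  simp only [formIncl_apply]
  ring

theorem isVecMagGrad_test {a : RSpace d → RSpace d} {φ : RSpace d → ℝ} (hφ : IsTest φ)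
    (c : CSpace m) :
    IsVecMagGrad a (fun x => φ x • c) fun k x =>
      (partialDeriv k φ x : ℂ) • c - ((φ x : ℂ) * (Complex.I * (a x k : ℂ))) • c := by
  intro k ψ hψ
  have e1 : ∀ x, (partialDeriv k φ x : ℂ) • c - ((φ x : ℂ) * (Complex.I * (a x k : ℂ))) • c
      + (Complex.I * (a x k : ℂ)) • φ x • c = partialDeriv k φ x • c := by
    intro x
    rw [← Complex.coe_smul (φ x), smul_smul, mul_comm (Complex.I * (a x k : ℂ)), sub_add_cancel,
      Complex.coe_smul]
  simp only [e1, smul_smul]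
  rw [integral_smul_const, integral_smul_const, ← neg_smul]
  congr 1
  have hφ' := isTest_partialDeriv (k := k) hφ
  have hψ' := isTest_partialDeriv (k := k) hψ
  have e2 := integral_mul_fderiv_eq_neg_fderiv_mul_of_integrable (f := ψ) (g := φ)
    (μ := (volume : Measure (RSpace d))) (v := EuclideanSpace.single k (1 : ℝ))
    ((hψ'.1.mul hφ.1.continuous).integrable_of_hasCompactSupport hψ'.2.mul_right)
    ((hψ.1.continuous.mul hφ'.1).integrable_of_hasCompactSupport hψ.2.mul_right)
    ((hψ.1.continuous.mul hφ.1.continuous).integrable_of_hasCompactSupport hψ.2.mul_right)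
    (fun x _ => hψ.1.differentiable (by simp) x) (fun x _ => hφ.1.differentiable (by simp) x)
  exact (neg_eq_iff_eq_neg.2 e2).symm

theorem memLp_test_smul {φ : RSpace d → ℝ} (hφ : IsTest φ) (c : CSpace m) :
    MemLp (fun x => φ x • c) 2 volume :=
  (hφ.1.continuous.smul continuous_const).memLp_of_hasCompactSupport hφ.2.smul_right

theorem memForm_test (S : Potentials d m) {φ : RSpace d → ℝ} (hφ : IsTest φ) (c : CSpace m) :
    S.MemForm ((memLp_test_smul hφ c).toLp _) := by
  have hae := (memLp_test_smul hφ c).coeFn_toLp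
  have hcont : Continuous fun x => φ x • c := hφ.1.continuous.smul continuous_const
  obtain ⟨C, hC⟩ := hcont.bounded_above_of_compact_support hφ.2.smul_right
  refine S.memForm_of_isVecMagGrad (fun k => ?_) ((isVecMagGrad_test hφ c).congr hae.symm) ?_
  · have hp := isTest_partialDeriv (k := k) hφ
    have t1 : MemLp (fun x => (partialDeriv k φ x : ℂ) • c) 2 volume :=
      ((ContinuousLinearMap.id ℂ ℂ).smulRight c).comp_memLp'
        (memLp_ofReal_of_continuous hp.1 hp.2)
    have t2 : MemLp (fun x => ((φ x : ℂ) * (Complex.I * (S.a x k : ℂ))) • c) 2 volume :=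
      ((ContinuousLinearMap.id ℂ ℂ).smulRight c).comp_memLp'
        (memLp_test_mul_magnetic S.a_loc hφ.1.continuous hφ.2 k)
    exact t1.sub t2
  · refine (S.memLp_act_sqrt_of_bounded hcont.aestronglyMeasurable hC hφ.2.smul_right).ae_eq ?_
    filter_upwards [hae] with x hx
    rw [hx]

theorem denseRange_formIncl (S : Potentials d m) : DenseRange (formIncl S) := by
  refine denseRange_of_adjoint_injective fun f hf => ?_
  have h0 : ∀ v, S.MemForm v → inner ℂ v f = 0 := by
    intro v hv
    obtain ⟨z, rfl⟩ := exists_formIncl_eq hv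
    rw [← ContinuousLinearMap.adjoint_inner_right, hf, inner_zero_right]
  have h1 : ∀ i : Fin m, ∀ᵐ x, f x i = 0 := by
    intro i
    refine ae_eq_zero_of_integral_contDiff_smul_eq_zero
      ((memLp_coord (Lp.memLp f) i).locallyIntegrable one_le_two) fun φ hφ hc => ?_
    have e := h0 _ (memForm_test S ⟨hφ, hc⟩ (EuclideanSpace.single i 1))
    rw [← integral_inner_eq] at e
    rw [← e]
    refine integral_congr_ae ?_
    filter_upwards [(memLp_test_smul ⟨hφ, hc⟩
      (EuclideanSpace.single i (1 : ℂ) : CSpace m)).coeFn_toLp] with x hx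
    rw [hx, ← Complex.coe_smul (φ x) (EuclideanSpace.single i (1 : ℂ) : CSpace m),
      inner_smul_left, EuclideanSpace.inner_single_left]
    simp
  rw [Lp.eq_zero_iff_ae_eq_zero]
  filter_upwards [ae_all_iff.2 h1] with x hx
  ext i
  exact hx i

end FormSpace

/-! ### Graphs of the square roots, their inverses and their composition. -/

section Operators

variable {E : Type*} [NormedAddCommGroup E] [InnerProductSpace ℂ E] [CompleteSpace E]

theorem IsResolvent.resolvent_eq {E : Type*} [NormedAddCommGroup E] [InnerProductSpace ℂ E]
    {A : E →ₗ.[ℂ] E} {R : E →L[ℂ] E} (hR : IsResolvent A R) :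
    resolvent A = R := by
  have h : ∃ R : E →L[ℂ] E, IsResolvent A R := ⟨R, hR⟩
  unfold resolvent
  rw [dif_pos h]
  ext f
  obtain ⟨hd, hf⟩ := (h.choose_spec (h.choose f) f).2 rfl
  exact (hR _ f).1 ⟨hd, hf⟩

theorem IsResolvent.mem_sqrtOp_graph {A : E →ₗ.[ℂ] E} {R : E →L[ℂ] E} (hR : IsResolvent A R)
    (h0 : 0 ≤ R) (hinj : ∀ x, R x = 0 → x = 0) (x y : E) :
    (x, y) ∈ (sqrtOp A).graph ↔ ∃ g, CFC.sqrt R g = x ∧ CFC.sqrt (1 - R) g = y := by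
  unfold sqrtOp
  rw [hR.resolvent_eq, Submodule.toLinearPMap_graph_eq]
  · simp [LinearMap.mem_range]
  · rintro _ ⟨g, rfl⟩ hg
    have : g = 0 := sqrt_injective h0 hinj g hg
    simp [this]

theorem mem_compOp_graph {E : Type*} [NormedAddCommGroup E] [InnerProductSpace ℂ E]
    (T U : E →ₗ.[ℂ] E) (x z : E) :
    (x, z) ∈ (compOp T U).graph ↔ ∃ y, (x, y) ∈ U.graph ∧ (y, z) ∈ T.graph := by
  rw [LinearPMap.mem_graph_iff]
  constructor
  · rintro ⟨⟨x', hx'⟩, rfl, rfl⟩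
    have hx := hx'
    obtain ⟨⟨y, hy, hyx⟩, -⟩ := hx
    have hyx' : (y : E) = x' := hyx
    refine ⟨U y, hyx' ▸ U.mem_graph y, ?_⟩
    have e : U.domRestrict ((T.domain.comap U.toFun).map U.domain.subtype) ⟨x', hx'⟩ = U y :=
      LinearPMap.domRestrict_apply hyx'.symm
    rw [LinearPMap.mem_graph_iff]
    exact ⟨⟨_, hy⟩, rfl, congrArg T (Subtype.ext e.symm)⟩
  · rintro ⟨y, hy, hz⟩
    obtain ⟨x', rfl, rfl⟩ := (LinearPMap.mem_graph_iff _).1 hy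
    obtain ⟨y', hy', rfl⟩ := (LinearPMap.mem_graph_iff _).1 hz
    dsimp only at hy'
    have hmem : (x' : E) ∈ ((T.domain.comap U.toFun).map U.domain.subtype) ⊓ U.domain := by
      refine ⟨⟨x', ?_, rfl⟩, x'.2⟩
      have : U x' ∈ T.domain := hy' ▸ y'.2
      exact this
    refine ⟨⟨x', hmem⟩, rfl, ?_⟩
    have e : U.domRestrict ((T.domain.comap U.toFun).map U.domain.subtype) ⟨x', hmem⟩ = U x' :=
      LinearPMap.domRestrict_apply rfl
    exact congrArg T (Subtype.ext (e.trans hy'.symm))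

theorem IsResolvent.mem_inverse_sqrtOp_graph {A : E →ₗ.[ℂ] E} {R : E →L[ℂ] E}
    (hR : IsResolvent A R) (h0 : 0 ≤ R) (h1 : 0 ≤ 1 - R) (hinj : ∀ x, R x = 0 → x = 0)
    (hinj' : ∀ x, (1 - R) x = 0 → x = 0) (x y : E) :
    (y, x) ∈ (sqrtOp A).inverse.graph ↔ ∃ g, CFC.sqrt R g = x ∧ CFC.sqrt (1 - R) g = y := by
  have hker : (sqrtOp A).toFun.ker = ⊥ := by
    rw [LinearMap.ker_eq_bot']
    intro u hu
    have hg : ((u : E), (0 : E)) ∈ (sqrtOp A).graph :=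
      (LinearPMap.mem_graph_iff _).2 ⟨u, rfl, hu⟩
    obtain ⟨g, hg1, hg2⟩ := (hR.mem_sqrtOp_graph h0 hinj _ _).1 hg
    have : g = 0 := sqrt_injective h1 hinj' g hg2
    rw [this, map_zero] at hg1
    exact Subtype.ext hg1.symm
  rw [LinearPMap.inverse_graph hker, ← hR.mem_sqrtOp_graph h0 hinj]
  simp

/-- If $f=(1-R)^{1/2}g$, then $A^{-1/2}f=R^{1/2}g=R'^{1/2}Hg$. This lies in the domain of $L^{1/2}$,
which sends it to $(1-R')^{1/2}Hg$, so the composition imposes no further domain restriction. -/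
theorem mem_compOp_sqrtOp_graph {A L : E →ₗ.[ℂ] E} {R R' : E →L[ℂ] E} (hA : IsResolvent A R)
    (hL : IsResolvent L R') (h0 : 0 ≤ R) (h1 : 0 ≤ 1 - R) (h0' : 0 ≤ R')
    (hinj : ∀ x, R x = 0 → x = 0) (hinj' : ∀ x, R' x = 0 → x = 0)
    (hinj₁ : ∀ x, (1 - R) x = 0 → x = 0) {H : E →L[ℂ] E}
    (hH : ∀ x, CFC.sqrt R' (H x) = CFC.sqrt R x) (f y : E) :
    (f, y) ∈ (compOp (sqrtOp L) (sqrtOp A).inverse).graph ↔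
      ∃ g, CFC.sqrt (1 - R) g = f ∧ CFC.sqrt (1 - R') (H g) = y := by
  simp only [mem_compOp_graph, hA.mem_inverse_sqrtOp_graph h0 h1 hinj hinj₁,
    hL.mem_sqrtOp_graph h0' hinj']
  constructor
  · rintro ⟨x, ⟨g, rfl, rfl⟩, k, hk, rfl⟩
    refine ⟨g, rfl, ?_⟩
    have : H g - k = 0 := by
      refine sqrt_injective h0' hinj' _ ?_
      rw [map_sub, hH, hk, sub_self]
    rw [sub_eq_zero.1 this]
  · rintro ⟨g, rfl, rfl⟩
    exact ⟨_, ⟨g, rfl, rfl⟩, H g, hH g, rfl⟩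

variable {F : Type*} [NormedAddCommGroup F] [InnerProductSpace ℂ F] [CompleteSpace F]
  {G : Type*} [NormedAddCommGroup G] [InnerProductSpace ℂ G] [CompleteSpace G]

open Filter Topology in
theorem exists_riesz_extension {A L : E →ₗ.[ℂ] E} {ι : F →L[ℂ] E} {ι' : G →L[ℂ] E}
    (hA : IsResolvent A (formResolvent ι)) (hL : IsResolvent L (formResolvent ι'))
    (hι : DenseRange ι) (hn : ‖ι‖ ≤ 1) (hn' : ‖ι'‖ ≤ 1)
    (hinj : ∀ v, ι v = 0 → v = 0) (hinj' : ∀ v, ι' v = 0 → v = 0)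
    (hinj₁ : ∀ x, (1 - formResolvent ι) x = 0 → x = 0)
    {j : F →L[ℂ] G} (hj : ‖j‖ ≤ 1) (hjι : ∀ v, ι' (j v) = ι v) :
    ∃ T : E →L[ℂ] E,
      (∀ f : (compOp (sqrtOp L) (sqrtOp A).inverse).domain,
        T f = compOp (sqrtOp L) (sqrtOp A).inverse f) ∧
      (∀ T' : E →L[ℂ] E, (∀ f : (compOp (sqrtOp L) (sqrtOp A).inverse).domain,
        T' f = compOp (sqrtOp L) (sqrtOp A).inverse f) → T' = T) ∧
      ∀ f, Tendsto (fun n : ℕ => sqrtRes (1 / ((n : ℝ) + 1)) (formResolvent ι')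
        (sqrtResInv (1 / ((n : ℝ) + 1)) (formResolvent ι) f)) atTop (𝓝 (T f)) := by
  have hι' : DenseRange ι' := hι.mono <| by
    rintro _ ⟨v, rfl⟩
    exact ⟨j v, hjι v⟩
  have h0 := formResolvent_nonneg ι
  have h0' := formResolvent_nonneg ι'
  have h1 := one_sub_formResolvent_nonneg hn
  have h1' := one_sub_formResolvent_nonneg hn'
  have hdense : ∀ {R : E →L[ℂ] E}, 0 ≤ R → (∀ x, R x = 0 → x = 0) → DenseRange R := by
    intro R hR hRi
    refine denseRange_of_adjoint_injective fun x hx => ?_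
    rw [(IsSelfAdjoint.of_nonneg hR).adjoint_eq] at hx
    exact hRi x hx
  have hR : ∀ x, formResolvent ι x = 0 → x = 0 := fun x hx => formResolvent_injective hι hx
  have hR' : ∀ x, formResolvent ι' x = 0 → x = 0 := fun x hx => formResolvent_injective hι' hx
  obtain ⟨H, hH1, hH⟩ := exists_contraction_sqrt hι hinj hinj' hj hjι
  obtain ⟨T, hT⟩ := exists_extension h0 h1 h0' h1' hinj₁ hH1 hH
  have hgraph := mem_compOp_sqrtOp_graph hA hL h0 h1 h0' hR hR' hinj₁ hH
  refine ⟨T, fun f => ?_, fun T' hT' => ?_, fun f => ?_⟩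
  · obtain ⟨g, e1, e2⟩ := (hgraph _ _).1 (LinearPMap.mem_graph _ f)
    rw [← e1, hT g, e2]
  · have hS := sqrt_denseRange h1 hinj₁
    refine ContinuousLinearMap.ext fun x => ?_
    refine hS.induction_on (p := fun x => T' x = T x) x ?_ fun g => ?_
    · exact isClosed_eq T'.continuous T.continuous
    · obtain ⟨f, e1, e2⟩ := (LinearPMap.mem_graph_iff _).1 ((hgraph _ _).2 ⟨g, rfl, rfl⟩)
      dsimp only at e1 e2
      rw [hT, ← e2, ← hT' f, e1]
  · refine tendsto_approx h0 h1 h0' h1' (hdense h0 hR) (hdense h0' hR') hinj₁ hH1 hH hT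
      (fun n => by positivity) (fun n => ?_) tendsto_one_div_add_atTop_nhds_zero_nat f
    rw [div_le_one (by positivity)]
    linarith [(Nat.cast_nonneg n : (0 : ℝ) ≤ n)]

end Operators

/-! ### The resolvent of the concrete operator, its kernel, and the $L^2$ extension. -/

section Realization

open Filter Topology

variable {d m : ℕ}

/-- The operator `(1 + A)⁻¹`. -/
def Potentials.res (S : Potentials d m) : LTwo d m →L[ℂ] LTwo d m := formResolvent (formIncl S)

variable (S : Potentials d m)

theorem Potentials.res_nonneg : 0 ≤ S.res := formResolvent_nonneg _

theorem Potentials.one_sub_res_nonneg : 0 ≤ 1 - S.res :=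
  one_sub_formResolvent_nonneg (norm_formIncl_le S)

theorem Potentials.res_spec (f : LTwo d m) :
    S.MemForm (S.res f) ∧ ∀ v, S.MemForm v → S.form (S.res f) v = inner ℂ v (f - S.res f) := by
  refine ⟨memForm_formIncl S _, fun v hv => ?_⟩
  obtain ⟨w, rfl⟩ := exists_formIncl_eq hv
  have e := inner_formSpace S ((formIncl S).adjoint f) w
  rw [ContinuousLinearMap.adjoint_inner_right] at e
  rw [inner_sub_right, e]
  exact (add_sub_cancel_right _ _).symm

theorem Potentials.eq_res {u f : LTwo d m} (hu : S.MemForm u)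
    (h : ∀ v, S.MemForm v → S.form u v = inner ℂ v (f - u)) : u = S.res f := by
  obtain ⟨z, rfl⟩ := exists_formIncl_eq hu
  have hz : z = (formIncl S).adjoint f := by
    refine ext_inner_left ℂ fun w => ?_
    rw [ContinuousLinearMap.adjoint_inner_right, inner_formSpace, h _ (memForm_formIncl S w),
      inner_sub_right, sub_add_cancel]
  rw [hz]
  rfl

theorem Potentials.mem_operator_graph (u f : LTwo d m) :
    (u, f) ∈ S.operator.graph ↔
      S.MemForm u ∧ ∀ v, S.MemForm v → S.form u v = inner ℂ v f := by
  unfold Potentials.operator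
  rw [Submodule.toLinearPMap_graph_eq]
  · rfl
  · rintro ⟨u', f'⟩ ⟨h1, h2⟩ h0
    dsimp only at h0 h1 h2 ⊢
    subst h0
    refine (denseRange_formIncl S).eq_zero_of_inner_right (𝕜 := ℂ) fun w => ?_
    rw [← h2 _ (memForm_formIncl S w)]
    have h := S.form_smul_left 0 (v := formIncl S w) S.memForm_zero
    rwa [zero_smul, zero_mul] at h

theorem Potentials.isResolvent_res : IsResolvent S.operator S.res := by
  intro u f
  have e : (∃ h : u ∈ S.operator.domain, u + S.operator ⟨u, h⟩ = f)
      ↔ (u, f - u) ∈ S.operator.graph := by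
    rw [LinearPMap.mem_graph_iff]
    constructor
    · rintro ⟨h, rfl⟩
      exact ⟨⟨u, h⟩, rfl, (add_sub_cancel_left _ _).symm⟩
    · rintro ⟨⟨u', h⟩, rfl, hf⟩
      exact ⟨h, by rw [hf]; exact add_sub_cancel _ _⟩
  rw [e, S.mem_operator_graph]
  constructor
  · rintro ⟨h1, h2⟩
    exact S.eq_res h1 h2
  · rintro rfl
    exact S.res_spec f

theorem Potentials.resolventEq_resOp {η : ℝ} (hη : 0 < η) (f : LTwo d m) :
    S.ResolventEq η f (resOp η S.res f) := by
  obtain ⟨y, h1, h2⟩ := exists_resOp_eq S.res_nonneg S.one_sub_res_nonneg hη f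
  obtain ⟨h3, h4⟩ := S.res_spec y
  rw [h1]
  refine ⟨h3, fun v hv => ?_⟩
  conv_rhs => rw [h2]
  rw [h4 v hv, inner_add_right, ← Complex.coe_smul, inner_smul_right, add_comm]

/-! ### The kernel of `A` -/

/-- If $Rf=f$, the form norm of $z=\iota^*f$ satisfies $\|z\|^2=\langle f,\iota z\rangle=\|f\|^2$.
The $L^2$ component $f$ already exhausts it, so the gradient components vanish. -/
theorem isVecMagGrad_zero_of_res_eq {f : LTwo d m} (hf : S.res f = f) :
    IsVecMagGrad S.a f fun _ _ => 0 := by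
  set z := (formIncl S).adjoint f with hz
  have hιz : formIncl S z = f := hf
  have e1 : inner ℂ z z = inner ℂ f f := by
    conv_lhs => rw [hz]
    rw [ContinuousLinearMap.adjoint_inner_right, ← hz, hιz]
  rw [Submodule.coe_inner, FormAmbient.inner_eq, ← formIncl_apply, hιz] at e1
  have e2 := add_eq_left.1 e1
  have e3 := congrArg Complex.re e2
  rw [Complex.add_re, Complex.re_sum] at e3
  have hn : ∀ w : LTwo d m, (inner ℂ w w).re = ‖w‖ ^ 2 := fun w => by
    rw [← inner_self_eq_norm_sq (𝕜 := ℂ) w]; rfl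
  simp only [hn, Complex.zero_re] at e3
  have e4 := ((add_eq_zero_iff_of_nonneg (sq_nonneg _)
    (Finset.sum_nonneg fun k _ => sq_nonneg _)).1 e3).2
  rw [Finset.sum_eq_zero_iff_of_nonneg fun k _ => sq_nonneg _] at e4
  intro k φ hφ
  have h := (mem_formSpace.1 z.2).1 k φ hφ
  rw [← formIncl_apply, hιz] at h
  rw [h]
  congr 1
  refine integral_congr_ae ?_
  have hk : (z : FormAmbient d m) (some (some k)) = 0 :=
    norm_eq_zero.1 (pow_eq_zero_iff two_ne_zero |>.1 (e4 k (Finset.mem_univ k)))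
  filter_upwards [Lp.coeFn_zero (CSpace m) 2 (volume : Measure (RSpace d))] with x hx
  beta_reduce
  rw [hk, hx]
  rfl

theorem integral_eq_zero_of_isWeakDeriv_zero {k : Fin d} {G : RSpace d → ℝ} (hG : Integrable G)
    (h : IsWeakDeriv k G fun _ => 0) : ∫ x, G x = 0 := by
  -- Near the origin $\psi$ equals $x_k$, so its $k$-th derivative is 1 at the origin. The
  -- derivatives of its dilations, rescaled, are bounded functions tending to 1, and testing with
  -- them recovers $\int G$.
  let ψ : RSpace d → ℝ := fun x => x k * bump d x
  have hψ : IsTest ψ := by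
    refine ⟨ContDiff.mul ?_ (isTest_bump (d := d)).1, (isTest_bump (d := d)).2.mul_left⟩
    exact (EuclideanSpace.proj (𝕜 := ℝ) k).contDiff
  have hψ' := isTest_partialDeriv (k := k) hψ
  have hψ0 : partialDeriv k ψ 0 = 1 := by
    have h1 : HasFDerivAt (fun x : RSpace d => x k) (EuclideanSpace.proj (𝕜 := ℝ) k) 0 :=
      (EuclideanSpace.proj (𝕜 := ℝ) k).hasFDerivAt
    have h2 := h1.mul ((isTest_bump (d := d)).1.differentiable (by simp) 0).hasFDerivAt
    have h3 : bump d (0 : RSpace d) = 1 :=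
      (bump d).one_of_mem_closedBall (by simp [bump])
    have h4 : fderiv ℝ ψ 0 = _ := h2.fderiv
    rw [partialDeriv, h4]
    simp [h3]
  have e : ∀ n : ℕ, ∫ x, dilate n (partialDeriv k ψ) x * G x = 0 := by
    intro n
    have h1 := h _ (isTest_dilate n hψ)
    simp only [partialDeriv_dilate n hψ, smul_eq_mul, mul_zero, integral_zero, neg_zero,
      mul_assoc] at h1
    rw [integral_const_mul] at h1
    exact (mul_eq_zero.1 h1).resolve_left (by positivity)
  obtain ⟨C, hC⟩ := hψ'.1.bounded_above_of_compact_support hψ'.2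
  have hlim : Tendsto (fun n : ℕ => ∫ x, dilate n (partialDeriv k ψ) x * G x) atTop
      (𝓝 (∫ x, G x)) := by
    refine tendsto_integral_of_dominated_convergence (fun x => C * ‖G x‖) (fun n => ?_)
      (hG.norm.const_mul C) (fun n => .of_forall fun x => ?_) (.of_forall fun x => ?_)
    · exact (hψ'.1.comp (continuous_const_smul _)).aestronglyMeasurable.mul hG.1
    · rw [norm_mul]
      exact mul_le_mul_of_nonneg_right (hC _) (norm_nonneg _)
    · have h1 := ((hψ'.1.tendsto 0).comp (tendsto_inv_smul x)).mul_const (G x)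
      rwa [hψ0, one_mul] at h1
  simp only [e] at hlim
  exact tendsto_nhds_unique tendsto_const_nhds hlim |>.symm

theorem ae_eq_zero_of_isVecMagGrad_zero (hd : 1 ≤ d) {a : RSpace d → RSpace d}
    (ha : MemLpLoc a 2) {f : RSpace d → CSpace m} (hf : MemLp f 2 volume)
    (h : IsVecMagGrad a f fun _ _ => 0) : f =ᵐ[volume] 0 := by
  -- Subtracting 1 gives $0\le F(z)\le|z|^2$, so $F(f)$ is integrable for $f\in L^2$ and vanishes
  -- only where $f$ does. Its weak derivative is zero because $F'$ annihilates the magnetic term.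
  let F : CSpace m → ℝ := fun z => reg 1 z - 1
  have hF : ContDiff ℝ 1 F := (contDiff_reg one_pos).sub contDiff_const
  have hF' : ∀ z, fderiv ℝ F z = fderiv ℝ (reg 1) z := fun z => fderiv_sub_const _
  have hl := hf.locallyIntegrable one_le_two
  have hG0 : ∀ z, 0 ≤ F z := fun z => sub_nonneg.2 (le_reg z)
  have hG1 : ∀ z, F z ≤ ‖z‖ ^ 2 := fun z => by
    have : reg 1 z ≤ 1 + ‖z‖ ^ 2 :=
      Real.sqrt_le_iff.2 ⟨by positivity, by nlinarith [sq_nonneg (‖z‖ ^ 2)]⟩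
    simp only [F]
    linarith
  have hint : Integrable fun x => F (f x) := by
    refine hf.integrable_norm_pow two_ne_zero |>.mono'
      (hF.continuous.comp_aestronglyMeasurable hf.1) (.of_forall fun x => ?_)
    rw [Real.norm_of_nonneg (hG0 _)]
    exact hG1 _
  have hw : IsWeakDeriv (⟨0, hd⟩ : Fin d) (fun x => F (f x)) fun _ => 0 := by
    have := (h ⟨0, hd⟩).comp hl (by
      simpa only [zero_add] using! locallyIntegrable_magnetic_smul ha hf ⟨0, hd⟩) hF
      (C := 1) (fun z => by rw [hF']; exact norm_fderiv_reg_le one_pos z)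
    simpa only [hF', zero_add, fderiv_reg_apply one_pos, reInner_phase, mul_zero] using this
  have h0 := integral_eq_zero_of_isWeakDeriv_zero hint hw
  have h1 := (integral_eq_zero_iff_of_nonneg (fun x => hG0 _) hint).1 h0
  filter_upwards [h1] with x hx
  have h2 : reg 1 (f x) = 1 := sub_eq_zero.1 hx
  have h3 := reg_sq 1 (f x)
  rw [h2] at h3
  have h4 : ‖f x‖ ^ 2 = 0 := by linarith
  exact norm_eq_zero.1 (pow_eq_zero_iff two_ne_zero |>.1 h4)

theorem Potentials.one_sub_res_injective (hd : 1 ≤ d) (f : LTwo d m) (hf : (1 - S.res) f = 0) :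
    f = 0 := by
  have h : S.res f = f := (sub_eq_zero.1 hf).symm
  rw [Lp.eq_zero_iff_ae_eq_zero]
  exact ae_eq_zero_of_isVecMagGrad_zero hd S.a_loc (Lp.memLp f) (isVecMagGrad_zero_of_res_eq S h)

/-! ### Comparison of the form domains -/

/-- The map `(u, v, w) ↦ (u, 0, w)`. -/
def dropPotential : FormAmbient d m →L[ℂ] FormAmbient d m :=
  LinearMap.mkContinuous
    { toFun := fun z => WithLp.toLp 2 fun i => if i = some none then 0 else z i
      map_add' := fun z w => PiLp.ext fun i => by
        by_cases h : i = some none <;> simp [h]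
      map_smul' := fun c z => PiLp.ext fun i => by
        by_cases h : i = some none <;> simp [h] } 1 fun z => by
    rw [one_mul]
    refine (pow_le_pow_iff_left₀ (norm_nonneg _) (norm_nonneg _) two_ne_zero).1 ?_
    rw [PiLp.norm_sq_eq_of_L2, PiLp.norm_sq_eq_of_L2]
    refine Finset.sum_le_sum fun i _ => ?_
    by_cases h : i = some none <;> simp [h]

theorem norm_dropPotential_le (z : FormAmbient d m) : ‖dropPotential z‖ ≤ ‖z‖ := by
  simpa using (LinearMap.mkContinuous_norm_le _ zero_le_one _ : ‖dropPotential (d := d) (m := m)‖ ≤ 1)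
    |> fun h => (dropPotential (d := d) (m := m)).le_of_opNorm_le h z

theorem dropPotential_mem {z : FormAmbient d m} (hz : z ∈ formSpace S) :
    dropPotential z ∈ formSpace S.magnetic := by
  refine mem_formSpace.2 ⟨(mem_formSpace.1 hz).1, ?_⟩
  have e : dropPotential z (some none) = 0 := rfl
  rw [e]
  filter_upwards [Lp.coeFn_zero (CSpace m) 2 (volume : Measure (RSpace d))] with x hx
  rw [hx]
  change 0 = act (matrixSqrt (0 : Matrix (Fin m) (Fin m) ℝ)) _
  rw [matrixSqrt_zero, act_zero_matrix]

theorem dropPotential_none (z : FormAmbient d m) : dropPotential z none = z none := rfl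

/-- The inclusion of the form domain of `A` in that of `L`. -/
def formSpaceMap : formSpace S →L[ℂ] formSpace S.magnetic :=
  (dropPotential ∘L (formSpace S).subtypeL).codRestrict _ fun z => dropPotential_mem S z.2

theorem coe_formSpaceMap (z : formSpace S) :
    (formSpaceMap S z : FormAmbient d m) = dropPotential (z : FormAmbient d m) := rfl

theorem norm_formSpaceMap_le : ‖formSpaceMap S‖ ≤ 1 := by
  refine ContinuousLinearMap.opNorm_le_bound _ zero_le_one fun z => ?_
  rw [one_mul, Submodule.coe_norm, coe_formSpaceMap]
  exact norm_dropPotential_le (z : FormAmbient d m)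

theorem formIncl_formSpaceMap (z : formSpace S) :
    formIncl S.magnetic (formSpaceMap S z) = formIncl S z := by
  rw [formIncl_apply, formIncl_apply, coe_formSpaceMap, dropPotential_none]

theorem Potentials.exists_extension (hd : 1 ≤ d) :
    ∃ T : LTwo d m →L[ℂ] LTwo d m, ExtendsOp T S.rieszOp ∧
      (∀ T' : LTwo d m →L[ℂ] LTwo d m, ExtendsOp T' S.rieszOp → T' = T) ∧
      ∀ f, Tendsto (fun n : ℕ => sqrtRes (1 / ((n : ℝ) + 1)) S.magnetic.res
        (sqrtResInv (1 / ((n : ℝ) + 1)) S.res f)) atTop (𝓝 (T f)) := by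
  exact exists_riesz_extension S.isResolvent_res S.magnetic.isResolvent_res
    (denseRange_formIncl S) (norm_formIncl_le S) (norm_formIncl_le S.magnetic)
    (formIncl_injective S) (formIncl_injective S.magnetic) (S.one_sub_res_injective hd)
    (norm_formSpaceMap_le S) (formIncl_formSpaceMap S)

end Realization

/-! ### Propagation of the $L^1$ domination and extension to $L^1$. -/

section Mass

open Filter Topology

variable {d m : ℕ}

/-- The `L¹` norm of a function in `L²`, possibly infinite. -/
def mass (f : LTwo d m) : ENNReal := ∫⁻ x, ‖f x‖ₑ

theorem eLpNorm_one_eq_mass (f : LTwo d m) : eLpNorm f 1 volume = mass f :=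
  eLpNorm_one_eq_lintegral_enorm

theorem mass_add_le (f g : LTwo d m) : mass (f + g) ≤ mass f + mass g := by
  unfold mass
  rw [← lintegral_add_left' (Lp.aestronglyMeasurable f).enorm]
  refine lintegral_mono_ae ?_
  filter_upwards [Lp.coeFn_add f g] with x hx
  rw [hx]
  exact enorm_add_le _ _

theorem mass_smul (c : ℝ) (f : LTwo d m) : mass (c • f) = ENNReal.ofReal |c| * mass f := by
  unfold mass
  rw [← lintegral_const_mul'' _ (Lp.aestronglyMeasurable f).enorm]
  refine lintegral_congr_ae ?_
  filter_upwards [Lp.coeFn_smul c f] with x hx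
  rw [hx, Pi.smul_apply, enorm_smul, ← Real.norm_eq_abs, ofReal_norm]

theorem mass_sub_comm (f g : LTwo d m) : mass (f - g) = mass (g - f) := by
  have : f - g = (-1 : ℝ) • (g - f) := by rw [neg_one_smul, neg_sub]
  rw [this, mass_smul]
  simp

theorem mass_zero : mass (0 : LTwo d m) = 0 := by
  have := mass_smul 0 (0 : LTwo d m)
  simpa using this

/-- Fatou's lemma for a combination of `L¹` norms along `L²`-convergent sequences. -/
theorem mass_add_mul_le_of_tendsto {f g : ℕ → LTwo d m} {f₀ g₀ : LTwo d m}
    (hf : Tendsto f atTop (𝓝 f₀)) (hg : Tendsto g atTop (𝓝 g₀)) {c C : ENNReal} (hc : c ≠ ⊤)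
    (h : ∀ n, mass (f n) + c * mass (g n) ≤ C) : mass f₀ + c * mass g₀ ≤ C := by
  obtain ⟨ns, hns, h1⟩ := (tendstoInMeasure_of_tendsto_Lp hf).exists_seq_tendsto_ae
  obtain ⟨ms, hms, h2⟩ := (tendstoInMeasure_of_tendsto_Lp
    (hg.comp hns.tendsto_atTop)).exists_seq_tendsto_ae
  have e : ∀ f g : LTwo d m, mass f + c * mass g = ∫⁻ x, (‖f x‖ₑ + c * ‖g x‖ₑ) := by
    intro f g
    rw [lintegral_add_left' (Lp.aestronglyMeasurable f).enorm,
      lintegral_const_mul'' _ (Lp.aestronglyMeasurable g).enorm]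
    rfl
  simp only [e] at h ⊢
  calc ∫⁻ x, (‖f₀ x‖ₑ + c * ‖g₀ x‖ₑ)
      ≤ ∫⁻ x, liminf (fun n => ‖f (ns (ms n)) x‖ₑ + c * ‖g (ns (ms n)) x‖ₑ) atTop := by
        refine lintegral_mono_ae ?_
        filter_upwards [h1, h2] with x hx1 hx2
        have t1 := (hx1.comp hms.tendsto_atTop).enorm
        have t2 := ENNReal.Tendsto.const_mul (a := c) hx2.enorm (Or.inr hc)
        exact (t1.add t2).liminf_eq.ge
    _ ≤ liminf (fun n => ∫⁻ x, (‖f (ns (ms n)) x‖ₑ + c * ‖g (ns (ms n)) x‖ₑ)) atTop :=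
        lintegral_liminf_le' fun n => (Lp.aestronglyMeasurable _).enorm.add
          ((Lp.aestronglyMeasurable _).enorm.const_mul c)
    _ ≤ C := by
        refine liminf_le_of_le (by isBoundedDefault) fun b hb => ?_
        obtain ⟨n, hn⟩ := hb.exists
        exact hn.trans (h _)

theorem mass_le_of_tendsto {f : ℕ → LTwo d m} {f₀ : LTwo d m}
    (hf : Tendsto f atTop (𝓝 f₀)) {C : ENNReal} (h : ∀ n, mass (f n) ≤ C) : mass f₀ ≤ C := by
  simpa using mass_add_mul_le_of_tendsto hf hf ENNReal.zero_ne_top (c := 0) (by simpa using h)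

/-! ### Pairs of operators with an `L¹` domination -/

/-- `J` is a contraction in the `L¹` norm, and so is `κ⁻¹ |J - K| + |K|`. -/
structure Dominated (κ : ℝ) (J K : LTwo d m →L[ℂ] LTwo d m) : Prop where
  left : ∀ w, mass (J w) ≤ mass w
  sub : ∀ w, mass (J w - K w) + ENNReal.ofReal κ * mass (K w) ≤ ENNReal.ofReal κ * mass w

variable {κ : ℝ} {J K J' K' : LTwo d m →L[ℂ] LTwo d m}

theorem dominated_zero : Dominated κ (0 : LTwo d m →L[ℂ] LTwo d m) 0 where
  left w := by
    rw [zero_apply, mass_zero]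
    exact zero_le
  sub w := by
    rw [zero_apply, sub_zero, mass_zero, mul_zero, add_zero]
    exact zero_le

/-- Telescoping: $JJ'-KK'=J(J'-K')+(J-K)K'$. The contraction $J$ handles the first term, and the
mass lost in the second is paid for by $\kappa\|K'w\|_1$. -/
theorem Dominated.mul (h : Dominated κ J K) (h' : Dominated κ J' K') :
    Dominated κ (J * J') (K * K') where
  left w := (h.left _).trans (h'.left w)
  sub w := by
    have e : (J * J') w - (K * K') w = J (J' w - K' w) + (J (K' w) - K (K' w)) := by
      rw [map_sub, sub_add_sub_cancel]
      rfl
    rw [e]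
    calc mass (J (J' w - K' w) + (J (K' w) - K (K' w))) + ENNReal.ofReal κ * mass (K (K' w))
        ≤ (mass (J (J' w - K' w)) + mass (J (K' w) - K (K' w)))
          + ENNReal.ofReal κ * mass (K (K' w)) := by gcongr; exact mass_add_le _ _
      _ ≤ mass (J' w - K' w) + ENNReal.ofReal κ * mass (K' w) := by
        rw [add_assoc]
        exact add_le_add (h.left _) (h.sub _)
      _ ≤ _ := h'.sub w

theorem Dominated.smul (h : Dominated κ J K) {c : ℝ} (hc : 0 ≤ c) (hc1 : c ≤ 1) :
    Dominated κ (c • J) (c • K) where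
  left w := by
    rw [smul_apply, mass_smul, abs_of_nonneg hc]
    exact (mul_le_of_le_one_left' (ENNReal.ofReal_le_one.2 hc1)).trans (h.left w)
  sub w := by
    rw [smul_apply, smul_apply, ← smul_sub, mass_smul, mass_smul, abs_of_nonneg hc, mul_left_comm,
      ← mul_add]
    exact (mul_le_of_le_one_left' (ENNReal.ofReal_le_one.2 hc1)).trans (h.sub w)

theorem Dominated.average (h : Dominated κ J K) (h' : Dominated κ J' K') :
    Dominated κ ((1 / 2 : ℝ) • (J + J')) ((1 / 2 : ℝ) • (K + K')) := by
  have hhalf : ∀ a : ENNReal, ENNReal.ofReal |1 / 2| * (a + a) = a := fun a => by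
    rw [← two_mul, ← mul_assoc, abs_of_pos (by norm_num), ← ENNReal.ofReal_ofNat 2,
      ← ENNReal.ofReal_mul (by norm_num)]
    norm_num
  refine ⟨fun w => ?_, fun w => ?_⟩
  · rw [smul_apply, add_apply, mass_smul, ← hhalf (mass w)]
    gcongr
    exact (mass_add_le _ _).trans (add_le_add (h.left w) (h'.left w))
  · rw [smul_apply, smul_apply, add_apply, add_apply, ← smul_sub, mass_smul, mass_smul,
      mul_left_comm, ← mul_add, ← hhalf (ENNReal.ofReal κ * mass w)]
    refine mul_le_mul' le_rfl ?_
    rw [add_sub_add_comm]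
    calc mass (J w - K w + (J' w - K' w)) + ENNReal.ofReal κ * mass (K w + K' w)
        ≤ (mass (J w - K w) + mass (J' w - K' w))
          + ENNReal.ofReal κ * (mass (K w) + mass (K' w)) := by
          gcongr <;> exact mass_add_le _ _
      _ = (mass (J w - K w) + ENNReal.ofReal κ * mass (K w))
          + (mass (J' w - K' w) + ENNReal.ofReal κ * mass (K' w)) := by ring
      _ ≤ _ := add_le_add (h.sub w) (h'.sub w)

theorem Dominated.of_tendsto {X Y : ℕ → LTwo d m →L[ℂ] LTwo d m} (hX : Tendsto X atTop (𝓝 J))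
    (hY : Tendsto Y atTop (𝓝 K)) (h : ∀ n, Dominated κ (X n) (Y n)) : Dominated κ J K := by
  have hX' : ∀ w, Tendsto (fun n => X n w) atTop (𝓝 (J w)) := fun w =>
    ((ContinuousLinearMap.apply ℂ (LTwo d m) w).continuous.tendsto J).comp hX
  have hY' : ∀ w, Tendsto (fun n => Y n w) atTop (𝓝 (K w)) := fun w =>
    ((ContinuousLinearMap.apply ℂ (LTwo d m) w).continuous.tendsto K).comp hY
  exact ⟨fun w => mass_le_of_tendsto (hX' w) fun n => (h n).left w,
    fun w => mass_add_mul_le_of_tendsto ((hX' w).sub (hY' w)) (hY' w) ENNReal.ofReal_ne_top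
      fun n => (h n).sub w⟩

theorem Dominated.sqrtIter (h : Dominated κ J K) (n : ℕ) :
    Dominated κ (MagneticSchrodinger.sqrtIter J n) (MagneticSchrodinger.sqrtIter K n) := by
  induction n with
  | zero => exact dominated_zero
  | succ n ih => exact h.average (ih.mul ih)

/-- An `L¹` contraction estimate for `1 - J`, `1 - K` relative to `1 - K`. -/
theorem Dominated.mass_sub_le (h : Dominated κ J K) {w : LTwo d m} (hw : mass w ≠ ⊤) :
    mass (J w - K w) ≤ ENNReal.ofReal κ * mass (w - K w) := by
  have h1 := h.sub w
  -- Finiteness allows this term to be cancelled after the estimate $\|w\|_1\le\|w-Kw\|_1+\|Kw\|_1$.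
  have hfin : ENNReal.ofReal κ * mass (K w) ≠ ⊤ :=
    ((le_add_self.trans h1).trans_lt (ENNReal.mul_lt_top ENNReal.ofReal_lt_top hw.lt_top)).ne
  refine (ENNReal.add_le_add_iff_right hfin).1 (h1.trans ?_)
  rw [← mul_add]
  gcongr
  have := mass_add_le (w - K w) (K w)
  rwa [sub_add_cancel] at this

theorem Dominated.mass_right_ne_top (hκ : 0 < κ) (h : Dominated κ J K) {w : LTwo d m}
    (hw : mass w ≠ ⊤) : mass (K w) ≠ ⊤ := by
  have h1 : ENNReal.ofReal κ * mass (K w) < ⊤ := (le_add_self.trans (h.sub w)).trans_lt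
    (ENNReal.mul_lt_top ENNReal.ofReal_lt_top hw.lt_top)
  intro htop
  rw [htop, ENNReal.mul_top (by simpa using hκ)] at h1
  exact lt_irrefl _ h1

variable {S : Potentials d m}

theorem Potentials.dominated_resOp (hκ : 0 ≤ κ) (hV : S.Comparable κ) {η : ℝ} (hη : 0 < η) :
    Dominated κ (resOp η S.magnetic.res) (resOp η S.res) where
  left w := (S.magnetic.resolventEq_resOp hη w).lintegral_enorm_le hη
  sub w := (S.resolventEq_resOp hη w).lintegral_sub_le hκ hV hη (S.magnetic.resolventEq_resOp hη w)

/-- The iteration for $1-(1-X)^{1/2}$ uses only products and averages, starting from 0, so it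
preserves the domination at each step. Norm convergence and Fatou's lemma transfer it to the limit.
-/
theorem Potentials.dominated_one_sub_sqrtRes (hκ : 0 ≤ κ) (hV : S.Comparable κ) {η : ℝ}
    (hη : 0 < η) (hη1 : η ≤ 1) :
    Dominated κ (1 - sqrtRes η S.magnetic.res) (1 - sqrtRes η S.res) := by
  have hθ : 0 ≤ 1 - η ^ 2 := by nlinarith
  refine Dominated.of_tendsto
    (tendsto_sqrtIter_resOp S.magnetic.res_nonneg S.magnetic.one_sub_res_nonneg hη hη1)
    (tendsto_sqrtIter_resOp S.res_nonneg S.one_sub_res_nonneg hη hη1) fun n => ?_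
  exact ((S.dominated_resOp hκ hV hη).smul hθ (by nlinarith [sq_nonneg η])).sqrtIter n

/-- Only finiteness is needed, to justify cancellation; the bound behind it deteriorates as
$\eta\to0$. -/
theorem Potentials.mass_sqrtResInv_ne_top (hκ : 0 < κ) (hV : S.Comparable κ) {η : ℝ}
    (hη : 0 < η) (hη1 : η ≤ 1) {f : LTwo d m} (hf : mass f ≠ ⊤) :
    mass (sqrtResInv η S.res f) ≠ ⊤ := by
  have h1 := (S.dominated_one_sub_sqrtRes hκ.le hV hη hη1).mass_right_ne_top hκ hf
  have h2 : mass (sqrtRes η S.res f) ≠ ⊤ := by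
    have e : sqrtRes η S.res f = f + (-1 : ℝ) • ((1 - sqrtRes η S.res) f) := by
      have : (1 - sqrtRes η S.res) f = f - sqrtRes η S.res f := rfl
      rw [this, neg_one_smul, neg_sub, add_sub_cancel]
    rw [e]
    refine ((mass_add_le _ _).trans_lt (ENNReal.add_lt_top.2 ⟨hf.lt_top, ?_⟩)).ne
    rw [mass_smul]
    exact ENNReal.mul_lt_top ENNReal.ofReal_lt_top h1.lt_top
  have h3 : mass (resOp η⁻¹ S.res (sqrtRes η S.res f)) ≤ mass (sqrtRes η S.res f) :=
    (S.resolventEq_resOp (inv_pos.2 hη) _).lintegral_enorm_le (inv_pos.2 hη)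
  have e : sqrtResInv η S.res f = sqrtRes η S.res f
      + ((1 - η ^ 2) / η ^ 2) • resOp η⁻¹ S.res (sqrtRes η S.res f) := rfl
  rw [e]
  refine ((mass_add_le _ _).trans_lt (ENNReal.add_lt_top.2 ⟨h2.lt_top, ?_⟩)).ne
  rw [mass_smul]
  exact ENNReal.mul_lt_top ENNReal.ofReal_lt_top (h3.trans_lt h2.lt_top)

/-- For $w=S^{-1}f$ the domination of $1-S'$ and $1-S$ reads
$\|f-S'w\|_1\le\kappa\|Sw\|_1=\kappa\|f\|_1$. The triangle inequality adds the 1 in $1+\kappa$. -/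
theorem Potentials.mass_approx_le (hκ : 0 < κ) (hV : S.Comparable κ) {η : ℝ} (hη : 0 < η)
    (hη1 : η ≤ 1) {f : LTwo d m} (hf : mass f ≠ ⊤) :
    mass (sqrtRes η S.magnetic.res (sqrtResInv η S.res f)) ≤ ENNReal.ofReal (1 + κ) * mass f := by
  set w := sqrtResInv η S.res f with hw
  have hSw : sqrtRes η S.res w = f := congrArg (fun T : LTwo d m →L[ℂ] LTwo d m => T f)
    (sqrtRes_mul_inv S.res_nonneg S.one_sub_res_nonneg hη hη1)
  have h := (S.dominated_one_sub_sqrtRes hκ.le hV hη hη1).mass_sub_le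
    (S.mass_sqrtResInv_ne_top hκ hV hη hη1 hf)
  rw [← hw] at h
  have e1 : (1 - sqrtRes η S.magnetic.res) w - (1 - sqrtRes η S.res) w
      = f - sqrtRes η S.magnetic.res w := by
    have a1 : (1 - sqrtRes η S.magnetic.res) w = w - sqrtRes η S.magnetic.res w := rfl
    have a2 : (1 - sqrtRes η S.res) w = w - sqrtRes η S.res w := rfl
    rw [a1, a2, hSw]
    abel
  have e2 : w - (1 - sqrtRes η S.res) w = f := by
    have a2 : (1 - sqrtRes η S.res) w = w - sqrtRes η S.res w := rfl
    rw [a2, hSw, sub_sub_cancel]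
  rw [e1, e2, mass_sub_comm] at h
  rw [ENNReal.ofReal_add zero_le_one hκ.le, ENNReal.ofReal_one, add_mul, one_mul, add_comm]
  calc mass (sqrtRes η S.magnetic.res w)
      = mass ((sqrtRes η S.magnetic.res w - f) + f) := by rw [sub_add_cancel]
    _ ≤ mass (sqrtRes η S.magnetic.res w - f) + mass f := mass_add_le _ _
    _ ≤ _ := by gcongr

/-! ### Extension to `L¹` -/

/-- The subspace `L¹ ∩ L²` of `L²`. -/
def interSpace (d m : ℕ) : Submodule ℂ (LTwo d m) where
  carrier := {f | MemLp f 1 volume}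
  add_mem' := fun {f g} hf hg => (MemLp.add hf hg).ae_eq (Lp.coeFn_add f g).symm
  zero_mem' := MemLp.zero.ae_eq (Lp.coeFn_zero _ _ _).symm
  smul_mem' := fun c f hf => (MemLp.const_smul hf c).ae_eq (Lp.coeFn_smul c f).symm

theorem mem_interSpace {f : LTwo d m} : f ∈ interSpace d m ↔ MemLp f 1 volume := Iff.rfl

/-- The inclusion of `L¹ ∩ L²` in `L¹`. -/
def interIncl (d m : ℕ) : interSpace d m →ₗ[ℂ] LOne d m where
  toFun f := MemLp.toLp (f : LTwo d m) (mem_interSpace.1 f.2)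
  map_add' f g := Lp.ext <| by
    filter_upwards [MemLp.coeFn_toLp (mem_interSpace.1 (f + g).2),
      Lp.coeFn_add (MemLp.toLp (f : LTwo d m) (mem_interSpace.1 f.2))
        (MemLp.toLp (g : LTwo d m) (mem_interSpace.1 g.2)),
      Lp.coeFn_add (f : LTwo d m) g, MemLp.coeFn_toLp (mem_interSpace.1 f.2),
      MemLp.coeFn_toLp (mem_interSpace.1 g.2)] with x h1 h2 h3 h4 h5
    rw [h1, h2, Submodule.coe_add, h3, Pi.add_apply, Pi.add_apply, h4, h5]
  map_smul' c f := Lp.ext <| by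
    filter_upwards [MemLp.coeFn_toLp (mem_interSpace.1 (c • f).2),
      Lp.coeFn_smul c (MemLp.toLp (f : LTwo d m) (mem_interSpace.1 f.2)),
      Lp.coeFn_smul c (f : LTwo d m), MemLp.coeFn_toLp (mem_interSpace.1 f.2)] with x h1 h2 h3 h4
    rw [RingHom.id_apply, h1, h2, Submodule.coe_smul, h3, Pi.smul_apply, Pi.smul_apply, h4]

theorem coeFn_interIncl (f : interSpace d m) : interIncl d m f =ᵐ[volume] (f : LTwo d m) :=
  MemLp.coeFn_toLp (mem_interSpace.1 f.2)

theorem norm_interIncl (f : interSpace d m) : ‖interIncl d m f‖ = (mass (f : LTwo d m)).toReal := by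
  rw [← eLpNorm_one_eq_mass]
  exact Lp.norm_toLp _ (mem_interSpace.1 f.2)

theorem exists_interIncl_eq {f : LOne d m} {g : LTwo d m} (h : f =ᵐ[volume] g) :
    ∃ hg : g ∈ interSpace d m, interIncl d m ⟨g, hg⟩ = f := by
  have hg : g ∈ interSpace d m := (Lp.memLp f).ae_eq h
  exact ⟨hg, Lp.ext ((coeFn_interIncl ⟨g, hg⟩).trans h.symm)⟩

/-- Integrable simple functions are supported on sets of finite measure and are therefore also in
$L^2$. -/
theorem denseRange_interIncl : DenseRange (interIncl d m) := by
  refine (Lp.simpleFunc.denseRange (E := CSpace m) (μ := (volume : Measure (RSpace d)))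
    ENNReal.one_ne_top).mono ?_
  rintro _ ⟨f, rfl⟩
  have h1 := Lp.simpleFunc.memLp f
  have h2 : MemLp (Lp.simpleFunc.toSimpleFunc f) 2 (volume : Measure (RSpace d)) :=
    (SimpleFunc.memLp_iff (by simp) (by simp)).2
      ((SimpleFunc.memLp_iff (by simp) (by simp)).1 h1)
  obtain ⟨hg, e⟩ := exists_interIncl_eq (f := (f : LOne d m)) (g := h2.toLp _)
    ((Lp.simpleFunc.toSimpleFunc_eq_toFun f).symm.trans h2.coeFn_toLp.symm)
  exact ⟨_, e⟩

theorem mem_interSpace_iff_mass {f : LTwo d m} : f ∈ interSpace d m ↔ mass f ≠ ⊤ := by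
  rw [mem_interSpace, ← eLpNorm_one_eq_mass]
  exact ⟨fun h => h.2.ne, fun h => ⟨Lp.aestronglyMeasurable f, h.lt_top⟩⟩

theorem exists_extension_L1 {T : LTwo d m →L[ℂ] LTwo d m} {C : ℝ} (hC : 0 ≤ C)
    (hT : ∀ f, mass f ≠ ⊤ → mass (T f) ≤ ENNReal.ofReal C * mass f) :
    ∃ T₁ : LOne d m →L[ℂ] LOne d m, AgreeOnInter T₁ T ∧
      (∀ T₁' : LOne d m →L[ℂ] LOne d m, AgreeOnInter T₁' T → T₁' = T₁) ∧
      ∀ f, ‖T₁ f‖ ≤ C * ‖f‖ := by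
  have hmem : ∀ f ∈ interSpace d m, T f ∈ interSpace d m := fun f hf => by
    rw [mem_interSpace_iff_mass] at hf ⊢
    exact ((hT f hf).trans_lt (ENNReal.mul_lt_top ENNReal.ofReal_lt_top hf.lt_top)).ne
  let t : interSpace d m →ₗ[ℂ] LOne d m := interIncl d m ∘ₗ T.toLinearMap.restrict hmem
  have ht : ∀ f : interSpace d m, t f = interIncl d m ⟨T f, hmem f f.2⟩ := fun f => rfl
  have hbound : ∀ f, ‖t f‖ ≤ C * ‖interIncl d m f‖ := fun f => by
    have hf := mem_interSpace_iff_mass.1 f.2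
    rw [ht, norm_interIncl, norm_interIncl]
    have h := ENNReal.toReal_mono (ENNReal.mul_ne_top ENNReal.ofReal_ne_top hf) (hT f hf)
    rwa [ENNReal.toReal_mul, ENNReal.toReal_ofReal hC] at h
  have hext := LinearMap.extendOfNorm_eq (f := t) denseRange_interIncl ⟨C, hbound⟩
  refine ⟨t.extendOfNorm (interIncl d m), fun f g hfg => ?_, fun T₁' h' => ?_,
    LinearMap.norm_extendOfNorm_apply_le denseRange_interIncl C hbound⟩
  · obtain ⟨hg, rfl⟩ := exists_interIncl_eq hfg
    rw [hext, ht]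
    exact coeFn_interIncl _
  · refine (LinearMap.extendOfNorm_unique denseRange_interIncl C hbound T₁' ?_).symm
    refine LinearMap.ext fun f => ?_
    have e := h' _ _ (coeFn_interIncl f)
    exact Lp.ext (e.trans (coeFn_interIncl ⟨T f, hmem f f.2⟩).symm)

end Mass

end MagneticSchrodinger

end

/-! ### Conclusion: the uniform $L^1$ bound passes to the strong $L^2$ limit. -/

theorem mainTheorem5 {d m : ℕ} (hd : 1 ≤ d) (hm : 1 ≤ m)
    (S : MagneticSchrodinger.Potentials d m) (κ : ℝ) (hκ : 1 ≤ κ)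
    (hV : S.Comparable κ) (ha : S.Regular) :
    ∃ T₂ : MagneticSchrodinger.LTwo d m →L[ℂ] MagneticSchrodinger.LTwo d m,
      MagneticSchrodinger.ExtendsOp T₂ S.rieszOp ∧
      (∀ T₂' : MagneticSchrodinger.LTwo d m →L[ℂ] MagneticSchrodinger.LTwo d m,
        MagneticSchrodinger.ExtendsOp T₂' S.rieszOp → T₂' = T₂) ∧
      ∃ T₁ : MagneticSchrodinger.LOne d m →L[ℂ] MagneticSchrodinger.LOne d m,
        MagneticSchrodinger.AgreeOnInter T₁ T₂ ∧
        (∀ T₁' : MagneticSchrodinger.LOne d m →L[ℂ] MagneticSchrodinger.LOne d m,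
          MagneticSchrodinger.AgreeOnInter T₁' T₂ → T₁' = T₁) ∧
        ∀ f : MagneticSchrodinger.LOne d m, ‖T₁ f‖ ≤ (1 + κ) * ‖f‖ := by
  obtain ⟨T₂, h1, h2, h3⟩ := S.exists_extension hd
  have hκ0 : 0 < κ := one_pos.trans_le hκ
  refine ⟨T₂, h1, h2, MagneticSchrodinger.exists_extension_L1 (by linarith) fun f hf => ?_⟩
  -- The approximants use $\eta=1/(n+1)\in(0,1]$, and their bound $1+\kappa$ does not depend on
  -- $\eta$.
  refine MagneticSchrodinger.mass_le_of_tendsto (h3 f) fun n => ?_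
  refine S.mass_approx_le hκ0 hV (by positivity) ?_ hf
  rw [div_le_one (by positivity)]
  linarith [(Nat.cast_nonneg n : (0 : ℝ) ≤ n)]
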